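/- Let $\gamma\in(0,1)$ and $k>2$, and write $\langle v\rangle=(1+|v|^2)^{1/2}$ and $m(v)=\langle v\rangle^k$ for $v\in\mathbb R^3$. Let $b$ be a measurable (for instance locally smooth) function of $\cos\theta$, vanishing for $\cos\theta<0$, such that for some $c_b>0$ and $s\in(0,1/2)$ $$\frac{c_b}{\theta^{1+2s}}\le \sin\theta\, b(\cos\theta)\le \frac{1}{c_b\,\theta^{1+2s}}\qquad\text{for all }\theta\in(0,\pi/2],$$ and let $B(v-v_*,\sigma)=|v-v_*|^\gamma\, b(\cos\theta)$ with $\cos\theta=\left\langle \frac{v-v_*}{|v-v_*|},\sigma\right\rangle$, $\sigma\in\mathbb S^2$. Let $$Q(g,f)(v)=\int_{\mathbb R^3\times\mathbb S^2}B(v-v_*,\sigma)\,\bigl[g(v'_*)f(v')-g(v_*)f(v)\bigr]\,d\sigma\,dv_*,$$ where $v'=\frac{v+v_*}2+\frac{|v-v_*|}2\sigma$, $v'_*=\frac{v+v_*}2-\frac{|v-v_*|}2\sigma$ and $d\sigma$ is the surface measure on $\mathbb S^2$. For a weight $w$ put $\|h\|_{L^1(w)}=\|h\,w\|_{L^1(\mathbb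 R^3)}$ and $\|h\|_{W^{1,1}(w)}=\sum_{|\alpha|\le1}\|\partial^\alpha h\|_{L^1(w)}$ (weak derivatives). Then there is a constant $C>0$ (depending on $B$ and $k$ but not on $h$) such that for every real-valued $h\in W^{1,1}(\langle v\rangle^{\gamma+1}m)$ the integral defining $Q(h,h)(v)$ converges absolutely for almost every $v$, $Q(h,h)\in L^1(m)$, and $$\|Q(h,h)\|_{L^1(m)}\le C\Bigl(\|h\|_{L^1(\langle v\rangle^{\gamma}m)}\,\|h\|_{L^1(m)}+\|h\|_{L^1(\langle v\rangle^{\gamma+1})}\,\|h\|_{W^{1,1}(\langle v\rangle^{\gamma+1}m)}\Bigr).$$ -/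

import Mathlib

open MeasureTheory
open scoped ENNReal ContDiff

/-- The velocity space `ℝ³` with its Euclidean norm. -/
abbrev V3 : Type := EuclideanSpace ℝ (Fin 3)

/-- The unit sphere `𝕊²` of `ℝ³`. -/
abbrev S2 : Type := Metric.sphere (0 : V3) 1

/-- The surface measure `dσ` on `𝕊²` (of total mass `4π`). -/
noncomputable def surfaceMeasure : Measure S2 := (volume : Measure V3).toSphere

/-- The Japanese bracket `⟨v⟩ = (1 + |v|²)^{1/2}`. -/
noncomputable def bracket (v : V3) : ℝ := Real.sqrt (1 + ‖v‖ ^ 2)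

/-- The post-collisional velocity `v' = (v + v_*)/2 + |v - v_*|/2 σ`. -/
noncomputable def postVel (v vs : V3) (σ : S2) : V3 :=
  (2⁻¹ : ℝ) • (v + vs) + (‖v - vs‖ / 2) • (σ : V3)

/-- The post-collisional velocity `v'_* = (v + v_*)/2 - |v - v_*|/2 σ`. -/
noncomputable def postVelStar (v vs : V3) (σ : S2) : V3 :=
  (2⁻¹ : ℝ) • (v + vs) - (‖v - vs‖ / 2) • (σ : V3)

/-- The integrand `B(v - v_*, σ) [g'_* f' - g_* f]` of the collision operator at velocity `v`, as a
function of `(v_*, σ) ∈ ℝ³ × 𝕊²`. -/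
noncomputable def collisionIntegrand (B : V3 → S2 → ℝ) (g f : V3 → ℝ) (v : V3) (p : V3 × S2) : ℝ :=
  B (v - p.1) p.2 *
    (g (postVelStar v p.1 p.2) * f (postVel v p.1 p.2) - g p.1 * f v)

/-- The Boltzmann collision operator
`Q(g,f)(v) = ∫_{ℝ³ × 𝕊²} B(v - v_*, σ) [g'_* f' - g_* f] dσ dv_*`. -/
noncomputable def collisionQ (B : V3 → S2 → ℝ) (g f : V3 → ℝ) (v : V3) : ℝ :=
  ∫ p : V3 × S2, collisionIntegrand B g f v p ∂((volume : Measure V3).prod surfaceMeasure)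

/-- The collision kernel in product form `B(z, σ) = |z|^γ b(cos θ)` with
`cos θ = ⟨z/|z|, σ⟩`; for `γ > 0` it vanishes at `z = 0`. -/
noncomputable def productKernel (γ : ℝ) (b : ℝ → ℝ) (z : V3) (σ : S2) : ℝ :=
  ‖z‖ ^ γ * b (inner ℝ (‖z‖⁻¹ • z) (σ : V3))

/-- The angular function `b`, as a function of `cos θ`: it is measurable, it is supported in
`cos θ ≥ 0` (that is, `0 ≤ θ ≤ π/2`), and it has the moderate singularity
`c_b θ^{-1-2s} ≤ sin θ b(cos θ) ≤ c_b⁻¹ θ^{-1-2s}` on `(0, π/2]` for some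
`c_b > 0` and `s ∈ (0, 1/2)`. -/
structure IsModerateAngular (b : ℝ → ℝ) : Prop where
  measurable : Measurable b
  support : ∀ x : ℝ, x < 0 → b x = 0
  singularity : ∃ cb s : ℝ, 0 < cb ∧ 0 < s ∧ s < 1 / 2 ∧
    ∀ θ : ℝ, 0 < θ → θ ≤ Real.pi / 2 →
      cb / θ ^ (1 + 2 * s) ≤ Real.sin θ * b (Real.cos θ) ∧
      Real.sin θ * b (Real.cos θ) ≤ 1 / (cb * θ ^ (1 + 2 * s))

/-- The weighted Lebesgue norm `‖h‖_{L¹(w)} = ‖h w‖_{L¹}`, with values in `[0, ∞]`. -/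
noncomputable def wL1Norm (w h : V3 → ℝ) : ℝ≥0∞ :=
  eLpNorm (fun v => h v * w v) 1 volume

/-- Membership in the weighted Lebesgue space `L¹(w)`. -/
def MemWL1 (w h : V3 → ℝ) : Prop :=
  MemLp (fun v => h v * w v) 1 volume

/-- `g` is a weak (distributional) `i`-th partial derivative of `h` on `ℝ³`. -/
def HasWeakPartial (i : Fin 3) (h g : V3 → ℝ) : Prop :=
  LocallyIntegrable h volume ∧ LocallyIntegrable g volume ∧
    ∀ φ : V3 → ℝ, ContDiff ℝ ∞ φ → HasCompactSupport φ →
      ∫ v, h v * fderiv ℝ φ v (EuclideanSpace.single i 1) = - ∫ v, g v * φ v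

open Classical in
/-- The weak partial derivative `∂_i h` (unique up to a null set; `0` if there is none). -/
noncomputable def weakPartial (i : Fin 3) (h : V3 → ℝ) : V3 → ℝ :=
  if H : ∃ g, HasWeakPartial i h g then H.choose else 0

/-- Membership in the weighted Sobolev space `W^{1,1}(w)`. -/
def MemWW11 (w h : V3 → ℝ) : Prop :=
  MemWL1 w h ∧ ∀ i : Fin 3, (∃ g, HasWeakPartial i h g) ∧ MemWL1 w (weakPartial i h)

/-- The norm `‖h‖_{W^{1,1}(w)} = ∑_{|α| ≤ 1} ‖∂^α h‖_{L¹(w)}`, used for `h ∈ W^{1,1}(w)`. -/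
noncomputable def wW11Norm (w h : V3 → ℝ) : ℝ≥0∞ :=
  wL1Norm w h + ∑ i : Fin 3, wL1Norm w (weakPartial i h)

/-!
The estimate rests on the splitting
`h'_* h' - h_* h = h'_* (h' - h) + h (h'_* - h_*)`.

For the first part, the pre-post-collisional change of variables (`lintegral_prePost`: in the
variables centre of mass, `|v - v_*|`, `(v - v_*)/|v - v_*|`, `σ` it merely exchanges the last two)
moves the weight to `⟨v'⟩^k` and leaves `∫∫∫ B |h_*| |h' - h| ⟨v'⟩^k`. Where `|v' - v| ≤ ⟨v⟩/2`, all
weights on the segment from `v` to `v'` are comparable; there `h' - h` is written as the integral of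
`∇h` over this segment. The factor `|v' - v| = |v - v_*| sin (θ/2)` makes the angular singularity
integrable because `s < 1/2`, and for each `t` the map `v ↦ v + t (v' - v)`, with `v_*` and `σ`
fixed, is injective on the half-space `cos θ ≥ 0` with Jacobian at least `1/8`
(`lintegral_angularWeight_segmentMap_le`). Where `|v' - v| > ⟨v⟩/2`, the weight is at most
`(3 |v' - v|)^k ≤ C |v - v_*|^k (sin (θ/2))^k`, whose angular factor compensates the singularity with
no derivative of `h`. This keeps all `k` moments off the factor that is paired with the gradient
carrying them (`AngularBound.exists_totalIncrement_le`). The gradient bound is proved for smooth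
functions and transferred to `W^{1,1}` by mollification and Fatou's lemma.

The second part must not be estimated in absolute value, since this would put the `k` moments on one
factor and the gradient on the other. Its absolute convergence for almost every `v` follows from the
first estimate by exchanging the particles, and its value is controlled by the cancellation lemma
`AngularBound.norm_integral_cancellation_le`: for truncated angular functions the change of variables
`v_* ↦ v'_*`, which halves the angle with `σ`, has the explicit Jacobian `cos² (θ/2) / 4`, and by
Archimedes' theorem (`lintegral_inner_sphere`) the two angular masses differ by at most a constant
times `∫ (1 - cos θ) b(cos θ) dσ`, uniformly in the truncation. Hence
`|∫∫ B (h'_* - h_*)| ≤ K ∫ |v - v_*|^γ |h_*| dv_*`.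
-/

/-! ### Polar coordinates and the pre-post-collisional change of variables -/

instance isFiniteMeasure_surfaceMeasure : IsFiniteMeasure surfaceMeasure := by
  unfold surfaceMeasure; infer_instance

/-- The direction `z / |z|` of a vector, as a point of the sphere (with a fixed arbitrary value
at `z = 0`). -/
noncomputable def direction (z : V3) : S2 :=
  ⟨if z = 0 then EuclideanSpace.single 0 1 else ‖z‖⁻¹ • z, by
    split_ifs with h
    · simp
    · simp [norm_smul, h]⟩

@[fun_prop]
lemma measurable_direction : Measurable direction := by
  apply Measurable.subtype_mk
  refine Measurable.ite (measurableSet_singleton 0) measurable_const ?_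
  exact (measurable_norm.inv).smul measurable_id

lemma coe_direction {z : V3} (hz : z ≠ 0) : (direction z : V3) = ‖z‖⁻¹ • z := by
  simp [direction, hz]

lemma norm_smul_direction (z : V3) : ‖z‖ • (direction z : V3) = z := by
  by_cases hz : z = 0
  · simp [hz]
  · rw [coe_direction hz, smul_smul, mul_inv_cancel₀ (norm_ne_zero_iff.2 hz), one_smul]

lemma norm_coe_sphere (σ : S2) : ‖(σ : V3)‖ = 1 := by simp

lemma direction_smul {r : ℝ} (hr : 0 < r) (σ : S2) : direction (r • (σ : V3)) = σ := by
  have h : r • (σ : V3) ≠ 0 := smul_ne_zero hr.ne' (by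
    rw [← norm_ne_zero_iff, norm_coe_sphere]; exact one_ne_zero)
  apply Subtype.ext
  rw [coe_direction h, norm_smul, norm_coe_sphere, mul_one, Real.norm_of_nonneg hr.le, smul_smul,
    inv_mul_cancel₀ hr.ne', one_smul]

/-- Polar coordinates `x = r σ` in `ℝ³`. -/
lemma lintegral_polar {F : V3 → ℝ≥0∞} (hF : Measurable F) :
    ∫⁻ x, F x = ∫⁻ σ, (∫⁻ r in Set.Ioi (0 : ℝ), ENNReal.ofReal (r ^ 2) * F (r • (σ : V3)))
      ∂surfaceMeasure := by
  have hmp := Measure.measurePreserving_homeomorphUnitSphereProd (volume : Measure V3)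
  have h0 : ∫⁻ x, F x = ∫⁻ x : ({0}ᶜ : Set V3), F (x : V3) ∂(volume.comap Subtype.val) := by
    rw [lintegral_subtype_comap (measurableSet_singleton _).compl,
      setLIntegral_congr (s := {0}ᶜ) (t := Set.univ), setLIntegral_univ]
    rw [ae_eq_univ, compl_compl]; simp
  have h1 : ∀ x : ({0}ᶜ : Set V3), F x =
      (fun q : S2 × Set.Ioi (0 : ℝ) => F ((q.2 : ℝ) • (q.1 : V3)))
        (homeomorphUnitSphereProd V3 x) := by
    intro x
    have hx : (x : V3) ≠ 0 := x.2
    simp only [homeomorphUnitSphereProd_apply_fst_coe, homeomorphUnitSphereProd_apply_snd_coe]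
    rw [smul_smul, mul_inv_cancel₀ (norm_ne_zero_iff.2 hx), one_smul]
  have hm : Measurable (fun q : S2 × Set.Ioi (0 : ℝ) => F ((q.2 : ℝ) • (q.1 : V3))) := by
    fun_prop
  rw [h0, lintegral_congr h1, hmp.lintegral_comp hm, lintegral_prod _ hm.aemeasurable]
  refine lintegral_congr fun σ => ?_
  have hd : Module.finrank ℝ V3 - 1 = 2 := by simp
  rw [hd, Measure.volumeIoiPow, lintegral_withDensity_eq_lintegral_mul _ (by fun_prop)
    (by fun_prop), ← lintegral_subtype_comap measurableSet_Ioi]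
  rfl

/-- Interchange of the directions of `z` and `σ` preserves `dz dσ`: in polar coordinates
`z = r u` it is the swap of `u` and `σ`. -/
lemma lintegral_swap_direction {F : V3 → S2 → ℝ≥0∞} (hF : Measurable (Function.uncurry F)) :
    ∫⁻ z, ∫⁻ σ, F (‖z‖ • (σ : V3)) (direction z) ∂surfaceMeasure =
      ∫⁻ z, ∫⁻ σ, F z σ ∂surfaceMeasure := by
  have e1 : Measurable fun z : V3 => ∫⁻ σ, F (‖z‖ • (σ : V3)) (direction z) ∂surfaceMeasure := by
    apply Measurable.lintegral_prod_right'
      (f := fun p : V3 × S2 => F (‖p.1‖ • (p.2 : V3)) (direction p.1))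
    refine hF.comp (Measurable.prodMk (by fun_prop) (measurable_direction.comp measurable_fst))
  have e2 : Measurable fun z : V3 => ∫⁻ σ, F z σ ∂surfaceMeasure := hF.lintegral_prod_right
  rw [lintegral_polar e1, lintegral_polar e2]
  have a1 : ∀ u : S2, ∫⁻ r in Set.Ioi (0 : ℝ), ENNReal.ofReal (r ^ 2) *
      ∫⁻ σ, F (‖r • (u : V3)‖ • (σ : V3)) (direction (r • (u : V3))) ∂surfaceMeasure =
      ∫⁻ σ, (∫⁻ r in Set.Ioi (0 : ℝ), ENNReal.ofReal (r ^ 2) * F (r • (σ : V3)) u)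
        ∂surfaceMeasure := by
    intro u
    rw [lintegral_lintegral_swap]
    · refine setLIntegral_congr_fun measurableSet_Ioi fun r hr => ?_
      beta_reduce
      rw [direction_smul hr, norm_smul, norm_coe_sphere, mul_one, Real.norm_of_nonneg (le_of_lt hr),
        lintegral_const_mul]
      exact hF.comp (Measurable.prodMk (by fun_prop) measurable_const)
    · apply Measurable.aemeasurable
      refine Measurable.mul (by fun_prop) (hF.comp (Measurable.prodMk (by fun_prop)
        measurable_const))
  have a2 : ∀ u : S2, ∫⁻ r in Set.Ioi (0 : ℝ), ENNReal.ofReal (r ^ 2) *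
      ∫⁻ σ, F (r • (u : V3)) σ ∂surfaceMeasure =
      ∫⁻ σ, (∫⁻ r in Set.Ioi (0 : ℝ), ENNReal.ofReal (r ^ 2) * F (r • (u : V3)) σ)
        ∂surfaceMeasure := by
    intro u
    rw [lintegral_lintegral_swap]
    · refine lintegral_congr fun r => ?_
      rw [lintegral_const_mul]
      exact hF.comp (Measurable.prodMk measurable_const measurable_id)
    · apply Measurable.aemeasurable
      refine Measurable.mul (by fun_prop) (hF.comp (Measurable.prodMk (by fun_prop)
        (by fun_prop)))
  rw [lintegral_congr a1, lintegral_congr a2, lintegral_lintegral_swap]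
  apply Measurable.aemeasurable
  apply Measurable.lintegral_prod_right'
    (f := fun p : (S2 × S2) × ℝ =>
      ENNReal.ofReal (p.2 ^ 2) * F (p.2 • (p.1.2 : V3)) p.1.1)
  refine Measurable.mul (by fun_prop) (hF.comp (Measurable.prodMk (by fun_prop)
        (by fun_prop)))

@[fun_prop]
lemma Measurable.postVel {α : Type*} [MeasurableSpace α] {f g : α → V3} {h : α → S2}
    (hf : Measurable f) (hg : Measurable g) (hh : Measurable h) :
    Measurable fun x => postVel (f x) (g x) (h x) := by
  unfold _root_.postVel; fun_prop

@[fun_prop]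
lemma Measurable.postVelStar {α : Type*} [MeasurableSpace α] {f g : α → V3} {h : α → S2}
    (hf : Measurable f) (hg : Measurable g) (hh : Measurable h) :
    Measurable fun x => postVelStar (f x) (g x) (h x) := by
  unfold _root_.postVelStar; fun_prop

/-- Relative velocity and centre of mass as variables of integration. -/
lemma lintegral_centerOfMass {F : V3 → V3 → ℝ≥0∞} (hF : Measurable (Function.uncurry F)) :
    ∫⁻ v, ∫⁻ vs, F v vs =
      ∫⁻ z : V3, ∫⁻ c : V3, F (c + (2⁻¹ : ℝ) • z) (c - (2⁻¹ : ℝ) • z) := by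
  have hF' : ∀ {α : Type} [MeasurableSpace α] {f g : α → V3}, Measurable f → Measurable g →
      Measurable fun x => F (f x) (g x) := fun hf hg => hF.comp (hf.prodMk hg)
  calc ∫⁻ v, ∫⁻ vs, F v vs = ∫⁻ vs, ∫⁻ v, F v vs :=
        lintegral_lintegral_swap (hF' (by fun_prop) (by fun_prop)).aemeasurable
    _ = ∫⁻ vs, ∫⁻ z, F (z + vs) vs :=
        lintegral_congr fun vs => (lintegral_add_right_eq_self (fun v => F v vs) vs).symm
    _ = ∫⁻ z, ∫⁻ vs, F (z + vs) vs :=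
        lintegral_lintegral_swap (hF' (by fun_prop) (by fun_prop)).aemeasurable
    _ = _ := lintegral_congr fun z => by
        rw [← lintegral_sub_right_eq_self _ ((2⁻¹ : ℝ) • z)]
        refine lintegral_congr fun c => ?_
        congr 1
        module

lemma Measurable.comp₃ {α : Type*} [MeasurableSpace α] {F : V3 → V3 → S2 → ℝ≥0∞}
    (hF : Measurable fun p : V3 × V3 × S2 => F p.1 p.2.1 p.2.2) {f g : α → V3} {h : α → S2}
    (hf : Measurable f) (hg : Measurable g) (hh : Measurable h) :
    Measurable fun x => F (f x) (g x) (h x) :=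
  hF.comp (hf.prodMk (hg.prodMk hh))

/-- The pre-post-collisional change of variables `(v, v_*, σ) ↦ (v', v'_*, (v-v_*)/|v-v_*|)`
preserves `dv dv_* dσ`. -/
lemma lintegral_prePost {F : V3 → V3 → S2 → ℝ≥0∞}
    (hF : Measurable fun p : V3 × V3 × S2 => F p.1 p.2.1 p.2.2) :
    ∫⁻ v, ∫⁻ vs, ∫⁻ σ, F (postVel v vs σ) (postVelStar v vs σ) (direction (v - vs))
      ∂surfaceMeasure = ∫⁻ v, ∫⁻ vs, ∫⁻ σ, F v vs σ ∂surfaceMeasure := by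
  have e1 : ∀ z : V3, ∫⁻ c, ∫⁻ σ, F (postVel (c + (2⁻¹ : ℝ) • z) (c - (2⁻¹ : ℝ) • z) σ)
      (postVelStar (c + (2⁻¹ : ℝ) • z) (c - (2⁻¹ : ℝ) • z) σ)
      (direction (c + (2⁻¹ : ℝ) • z - (c - (2⁻¹ : ℝ) • z))) ∂surfaceMeasure =
      ∫⁻ σ, (∫⁻ c, F (c + (2⁻¹ : ℝ) • (‖z‖ • (σ : V3))) (c - (2⁻¹ : ℝ) • (‖z‖ • (σ : V3)))
      (direction z)) ∂surfaceMeasure := by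
    intro z
    have hz : ∀ c : V3, c + (2⁻¹ : ℝ) • z - (c - (2⁻¹ : ℝ) • z) = z := fun c => by module
    have hc : ∀ c : V3, c + (2⁻¹ : ℝ) • z + (c - (2⁻¹ : ℝ) • z) = (2 : ℝ) • c := fun c => by module
    rw [lintegral_lintegral_swap]
    · refine lintegral_congr fun σ => lintegral_congr fun c => ?_
      unfold postVel postVelStar
      rw [hz, hc]
      congr 1 <;> module
    · exact Measurable.aemeasurable (hF.comp₃ (by fun_prop) (by fun_prop) (by fun_prop))
  have e2 : ∀ z : V3, ∫⁻ c, ∫⁻ σ, F (c + (2⁻¹ : ℝ) • z) (c - (2⁻¹ : ℝ) • z) σ ∂surfaceMeasure =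
      ∫⁻ σ, (∫⁻ c, F (c + (2⁻¹ : ℝ) • z) (c - (2⁻¹ : ℝ) • z) σ) ∂surfaceMeasure := fun z =>
    lintegral_lintegral_swap
      (Measurable.aemeasurable (hF.comp₃ (by fun_prop) (by fun_prop) (by fun_prop)))
  refine (lintegral_centerOfMass ?_).trans (Eq.trans ?_ (lintegral_centerOfMass ?_).symm)
  · exact Measurable.lintegral_prod_right'
      (f := fun p : (V3 × V3) × S2 => F (postVel p.1.1 p.1.2 p.2) (postVelStar p.1.1 p.1.2 p.2)
        (direction (p.1.1 - p.1.2))) (hF.comp₃ (by fun_prop) (by fun_prop) (by fun_prop))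
  · rw [lintegral_congr e1, lintegral_congr e2]
    refine lintegral_swap_direction
      (F := fun z σ => ∫⁻ c, F (c + (2⁻¹ : ℝ) • z) (c - (2⁻¹ : ℝ) • z) σ) ?_
    exact Measurable.lintegral_prod_right'
      (f := fun p : (V3 × S2) × V3 => F (p.2 + (2⁻¹ : ℝ) • p.1.1) (p.2 - (2⁻¹ : ℝ) • p.1.1) p.1.2)
      (hF.comp₃ (by fun_prop) (by fun_prop) (by fun_prop))
  · exact Measurable.lintegral_prod_right' (f := fun p : (V3 × V3) × S2 => F p.1.1 p.1.2 p.2)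
      (hF.comp₃ (by fun_prop) (by fun_prop) (by fun_prop))

/-! ### Integrals of zonal functions over the sphere -/

lemma measurePreserving_coordinates :
    MeasurePreserving (fun x : V3 => (x 0, x 1, x 2)) volume volume := by
  have h1 := PiLp.volume_preserving_ofLp (Fin 3)
  have h2 := volume_preserving_piFinSuccAbove (fun _ : Fin 3 => ℝ) 0
  have h3 := (MeasurePreserving.id (volume : Measure ℝ)).prod (volume_preserving_finTwoArrow ℝ)
  exact (h3.comp (h2.comp h1))

lemma lintegral_sin_mul_comp_cos {Φ : ℝ → ℝ≥0∞} :
    ∫⁻ t in Set.Ioo (-Real.pi) Real.pi, ENNReal.ofReal (Real.sin t) * Φ (Real.cos t) =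
      ∫⁻ t in Set.Ioo (-1 : ℝ) 1, Φ t := by
  have himg : Real.cos '' Set.Ioo 0 Real.pi = Set.Ioo (-1) 1 := by
    refine Set.Subset.antisymm ?_ fun t ht => ⟨Real.arccos t, ⟨Real.arccos_pos.2 ht.2, ?_⟩,
      Real.cos_arccos ht.1.le ht.2.le⟩
    · rintro _ ⟨t, ht, rfl⟩
      constructor
      · rw [← Real.cos_pi]
        exact Real.cos_lt_cos_of_nonneg_of_le_pi ht.1.le le_rfl ht.2
      · rw [← Real.cos_zero]
        exact Real.cos_lt_cos_of_nonneg_of_le_pi le_rfl ht.2.le ht.1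
    · exact lt_of_le_of_ne (Real.arccos_le_pi t) fun h => (Real.arccos_eq_pi.1 h).not_gt ht.1
  rw [← himg, lintegral_image_eq_lintegral_abs_deriv_mul measurableSet_Ioo
    (fun x _ => (Real.hasDerivAt_cos x).hasDerivWithinAt)
    (Real.injOn_cos.mono Set.Ioo_subset_Icc_self)]
  rw [← lintegral_indicator measurableSet_Ioo, ← lintegral_indicator measurableSet_Ioo]
  refine lintegral_congr fun t => ?_
  by_cases h : t ∈ Set.Ioo 0 Real.pi
  · have h' : t ∈ Set.Ioo (-Real.pi) Real.pi := ⟨by linarith [h.1, h.2], h.2⟩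
    rw [Set.indicator_of_mem h, Set.indicator_of_mem h', abs_neg,
      abs_of_nonneg (Real.sin_pos_of_mem_Ioo h).le]
  · rw [Set.indicator_of_notMem h]
    refine Set.indicator_apply_eq_zero.2 fun h' => ?_
    have ht : t ≤ 0 := by
      by_contra ht
      exact h ⟨not_le.1 ht, h'.2⟩
    rw [ENNReal.ofReal_of_nonpos (Real.sin_nonpos_of_nonpos_of_neg_pi_le ht h'.1.le), zero_mul]

lemma lintegral_polar_plane {f : ℝ × ℝ → ℝ≥0∞} (hf : Measurable f) :
    ∫⁻ p, f p = ∫⁻ r in Set.Ioi (0 : ℝ), ENNReal.ofReal r *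
      ∫⁻ t in Set.Ioo (-Real.pi) Real.pi, f (r * Real.cos t, r * Real.sin t) := by
  have hm : Measurable fun p : ℝ × ℝ => f (p.1 * Real.cos p.2, p.1 * Real.sin p.2) := by fun_prop
  rw [← lintegral_comp_polarCoord_symm, polarCoord_target, Measure.volume_eq_prod,
    ← Measure.prod_restrict]
  simp only [polarCoord_symm_apply, smul_eq_mul]
  rw [lintegral_prod _ (by fun_prop)]
  refine lintegral_congr fun r => ?_
  have hr : Measurable fun t => f (r * Real.cos t, r * Real.sin t) := by fun_prop
  rw [← lintegral_const_mul _ hr]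

/-- In coordinates `(x₁, y)`, `y ∈ ℝ²`, polar coordinates are used twice: for `y`, and then for the
half-plane of the pairs `(x₁, |y|)`. -/
lemma lintegral_norm_coord {G : ℝ → ℝ → ℝ≥0∞} (hG : Measurable (Function.uncurry G)) :
    ∫⁻ x : V3, G ‖x‖ (x 0) = ENNReal.ofReal (2 * Real.pi) * ∫⁻ r in Set.Ioi (0 : ℝ),
      ENNReal.ofReal (r ^ 2) * ∫⁻ t in Set.Ioo (-Real.pi) Real.pi,
        ENNReal.ofReal (Real.sin t) * G r (r * Real.cos t) := by
  have hG' : ∀ {α : Type} [MeasurableSpace α] {f g : α → ℝ}, Measurable f → Measurable g →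
      Measurable fun x => G (f x) (g x) := fun hf hg => hG.comp (hf.prodMk hg)
  have e0 : ∀ x : V3, G ‖x‖ (x 0) = (fun p : ℝ × ℝ × ℝ =>
      G (√(p.1 ^ 2 + (p.2.1 ^ 2 + p.2.2 ^ 2))) p.1) (x 0, x 1, x 2) := by
    intro x
    simp only [EuclideanSpace.norm_eq, Fin.sum_univ_three, Real.norm_eq_abs, sq_abs, add_assoc]
  have hm1 : Measurable fun p : ℝ × ℝ × ℝ => G (√(p.1 ^ 2 + (p.2.1 ^ 2 + p.2.2 ^ 2))) p.1 :=
    hG' (by fun_prop) (by fun_prop)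
  rw [lintegral_congr e0, measurePreserving_coordinates.lintegral_comp hm1, Measure.volume_eq_prod,
    lintegral_prod _ hm1.aemeasurable]
  have e1 : ∀ a : ℝ, ∫⁻ q : ℝ × ℝ, G (√(a ^ 2 + (q.1 ^ 2 + q.2 ^ 2))) a =
      ENNReal.ofReal (2 * Real.pi) *
        ∫⁻ ρ : ℝ, ENNReal.ofReal ρ * G (√(a ^ 2 + ρ ^ 2)) a := by
    intro a
    rw [lintegral_polar_plane (hG' (by fun_prop) (by fun_prop)), ← lintegral_const_mul _
      (by have := hG' (α := ℝ) (f := fun ρ => √(a ^ 2 + ρ ^ 2)) (g := fun _ => a) (by fun_prop)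
            (by fun_prop)
          fun_prop), ← lintegral_indicator measurableSet_Ioi]
    refine lintegral_congr fun ρ => ?_
    rw [Set.indicator_apply]
    split_ifs with h
    · have : ∀ t : ℝ, (ρ * Real.cos t) ^ 2 + (ρ * Real.sin t) ^ 2 = ρ ^ 2 := fun t => by
        linear_combination ρ ^ 2 * Real.cos_sq_add_sin_sq t
      simp only [this, lintegral_const, Measure.restrict_apply_univ, Real.volume_Ioo]
      rw [show Real.pi - -Real.pi = 2 * Real.pi by ring]
      ring
    · rw [ENNReal.ofReal_of_nonpos (not_lt.1 h)]; simp
  have hm2 : Measurable fun p : ℝ × ℝ => ENNReal.ofReal p.2 * G (√(p.1 ^ 2 + p.2 ^ 2)) p.1 :=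
    Measurable.mul (by fun_prop) (hG' (by fun_prop) (by fun_prop))
  rw [lintegral_congr e1, lintegral_const_mul _ hm2.lintegral_prod_right',
    ← lintegral_prod _ hm2.aemeasurable, ← Measure.volume_eq_prod, lintegral_polar_plane hm2]
  congr 1
  refine setLIntegral_congr_fun measurableSet_Ioi fun r hr => ?_
  have hr' : (0 : ℝ) < r := hr
  have e2 : ∀ t : ℝ, (r * Real.cos t) ^ 2 + (r * Real.sin t) ^ 2 = r ^ 2 := fun t => by
    linear_combination r ^ 2 * Real.cos_sq_add_sin_sq t
  simp only [e2, Real.sqrt_sq hr'.le, ENNReal.ofReal_mul hr'.le, mul_assoc]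
  rw [lintegral_const_mul, pow_two, ENNReal.ofReal_mul hr'.le, mul_assoc]
  have hm3 : Measurable fun t => G r (r * Real.cos t) := hG' (by fun_prop) (by fun_prop)
  fun_prop

lemma exists_linearIsometryEquiv_coord {e : V3} (he : ‖e‖ = 1) :
    ∃ L : V3 ≃ₗᵢ[ℝ] V3, ∀ x, L x 0 = inner ℝ e x := by
  obtain ⟨b, hb⟩ := Orthonormal.exists_orthonormalBasis_extension_of_card_eq (𝕜 := ℝ) (E := V3)
    (ι := Fin 3) (by simp) (v := fun _ => e) (s := {0}) (by
      rw [orthonormal_iff_ite]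
      rintro ⟨i, hi⟩ ⟨j, hj⟩
      obtain rfl := Set.mem_singleton_iff.1 hi
      obtain rfl := Set.mem_singleton_iff.1 hj
      simp [Set.domRestrict, he])
  refine ⟨b.repr, fun x => ?_⟩
  rw [b.repr_apply_apply, hb 0 rfl]

/-- Archimedes' theorem: the projection of the surface measure of `𝕊²` to an axis is `2π` times
Lebesgue measure on `(-1, 1)`. -/
theorem lintegral_inner_sphere {Φ : ℝ → ℝ≥0∞} (hΦ : Measurable Φ) {e : V3} (he : ‖e‖ = 1) :
    ∫⁻ σ, Φ (inner ℝ e (σ : V3)) ∂surfaceMeasure =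
      ENNReal.ofReal (2 * Real.pi) * ∫⁻ t in Set.Ioo (-1 : ℝ) 1, Φ t := by
  obtain ⟨L, hL⟩ := exists_linearIsometryEquiv_coord he
  set χ : ℝ → ℝ≥0∞ := Set.indicator (Set.Ioo 0 1) 1 with hχ
  have hχm : Measurable χ := measurable_one.indicator measurableSet_Ioo
  set G : ℝ → ℝ → ℝ≥0∞ := fun r y => χ r * Φ (r⁻¹ * y) with hGdef
  have hG : Measurable (Function.uncurry G) := by
    simp only [Function.uncurry_def, hGdef]
    fun_prop
  set c : ℝ≥0∞ := ∫⁻ r in Set.Ioi (0 : ℝ), ENNReal.ofReal (r ^ 2) * χ r with hc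
  have hA : ∫⁻ x : V3, G ‖x‖ (inner ℝ e x) =
      c * ∫⁻ σ, Φ (inner ℝ e (σ : V3)) ∂surfaceMeasure := by
    have hm : Measurable fun x : V3 => G ‖x‖ (inner ℝ e x) := by
      simp only [hGdef]
      fun_prop
    rw [lintegral_polar hm, ← lintegral_const_mul _ (by fun_prop)]
    refine lintegral_congr fun σ => ?_
    rw [hc, ← lintegral_mul_const _ (by fun_prop)]
    refine setLIntegral_congr_fun measurableSet_Ioi fun r hr => ?_
    have hr' : (0 : ℝ) < r := hr
    simp only [hGdef, norm_smul, norm_coe_sphere, mul_one, Real.norm_of_nonneg hr'.le,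
      inner_smul_right, inv_mul_cancel_left₀ hr'.ne', mul_assoc]
  have hB : ∫⁻ x : V3, G ‖x‖ (inner ℝ e x) =
      c * (ENNReal.ofReal (2 * Real.pi) * ∫⁻ t in Set.Ioo (-1 : ℝ) 1, Φ t) := by
    have : ∀ x : V3, G ‖x‖ (inner ℝ e x) = (fun x : V3 => G ‖x‖ (x 0)) (L x) := fun x => by
      simp only [hL, L.norm_map]
    have hm : Measurable fun x : V3 => G ‖x‖ (x 0) := by
      simp only [hGdef]
      fun_prop
    rw [lintegral_congr this, L.measurePreserving.lintegral_comp hm, lintegral_norm_coord hG, mul_left_comm]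
    congr 1
    rw [hc, ← lintegral_mul_const _ (by fun_prop), ← lintegral_sin_mul_comp_cos]
    refine setLIntegral_congr_fun measurableSet_Ioi fun r hr => ?_
    have hr' : (0 : ℝ) < r := hr
    simp only [hGdef, inv_mul_cancel_left₀ hr'.ne', mul_assoc]
    rw [← lintegral_const_mul _ (by fun_prop), ← lintegral_const_mul _ (by fun_prop),
      ← lintegral_const_mul _ (by fun_prop)]
    refine lintegral_congr fun t => ?_
    ring
  have hc' : c = ENNReal.ofReal (1 / 3) := by
    have h1 : c = ∫⁻ r in Set.Ioo (0 : ℝ) 1, ENNReal.ofReal (r ^ 2) := by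
      rw [hc, ← lintegral_indicator measurableSet_Ioi, ← lintegral_indicator measurableSet_Ioo]
      refine lintegral_congr fun r => ?_
      by_cases h : r ∈ Set.Ioo (0 : ℝ) 1
      · rw [Set.indicator_of_mem (Set.mem_Ioi.2 h.1), Set.indicator_of_mem h, hχ, Set.indicator_of_mem h]; simp
      · rw [Set.indicator_of_notMem h, hχ]
        refine Set.indicator_apply_eq_zero.2 fun _ => ?_
        rw [Set.indicator_of_notMem h, mul_zero]
    rw [h1, ← setLIntegral_congr Ioo_ae_eq_Ioc.symm, ← ofReal_integral_eq_lintegral_ofReal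
      (intervalIntegral.intervalIntegrable_pow 2).1 (ae_of_all _ fun r => sq_nonneg r),
      ← intervalIntegral.integral_of_le zero_le_one, integral_pow]
    norm_num
  have hc0 : c ≠ 0 := by rw [hc']; simp
  have hct : c ≠ ⊤ := by rw [hc']; simp
  exact (ENNReal.mul_right_inj hc0 hct).1 (hA.symm.trans hB)

/-! ### The segment from `v` to `v'` -/

/-- The cosine `cos θ = ⟨z/|z|, σ⟩` of the deviation angle (`0` if `z = 0`). -/
noncomputable def cosDeviation (z : V3) (σ : S2) : ℝ := inner ℝ (‖z‖⁻¹ • z) (σ : V3)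

@[fun_prop]
lemma Measurable.cosDeviation {α : Type*} [MeasurableSpace α] {f : α → V3} {h : α → S2}
    (hf : Measurable f) (hh : Measurable h) :
    Measurable fun x => cosDeviation (f x) (h x) := by
  unfold _root_.cosDeviation; fun_prop

lemma norm_mul_cosDeviation (z : V3) (σ : S2) : ‖z‖ * cosDeviation z σ = inner ℝ z (σ : V3) := by
  by_cases hz : z = 0
  · simp [hz]
  · rw [cosDeviation, inner_smul_left]
    simp [norm_ne_zero_iff.2 hz]

lemma cosDeviation_eq_div (z : V3) (σ : S2) : cosDeviation z σ = inner ℝ z (σ : V3) / ‖z‖ := by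
  rw [cosDeviation, inner_smul_left, div_eq_inv_mul]
  simp

lemma abs_cosDeviation_le (z : V3) (σ : S2) : |cosDeviation z σ| ≤ 1 := by
  rw [cosDeviation_eq_div, abs_div, abs_norm]
  refine div_le_one_of_le₀ ?_ (norm_nonneg z)
  simpa using abs_real_inner_le_norm z (σ : V3)

lemma cosDeviation_le_one (z : V3) (σ : S2) : cosDeviation z σ ≤ 1 :=
  (abs_le.1 (abs_cosDeviation_le z σ)).2

lemma cosDeviation_nonneg_iff {z : V3} (hz : z ≠ 0) (σ : S2) :
    0 ≤ cosDeviation z σ ↔ 0 ≤ inner ℝ z (σ : V3) := by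
  rw [cosDeviation_eq_div, le_div_iff₀ (norm_pos_iff.2 hz), zero_mul]

/-- The map `z ↦ (1 - t/2) z + (t/2) |z| σ`. If `z = v - v_*`, then its value is `v_t - v_*` for the
point `v_t = v + t (v' - v)` of the segment from `v` to `v'`. -/
noncomputable def segmentMap (t : ℝ) (σ : S2) (z : V3) : V3 :=
  (1 - t / 2) • z + (t / 2 * ‖z‖) • (σ : V3)

@[fun_prop]
lemma Measurable.segmentMap {α : Type*} [MeasurableSpace α] {f : α → V3} {h : α → S2} {t : α → ℝ}
    (ht : Measurable t) (hh : Measurable h) (hf : Measurable f) :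
    Measurable fun x => segmentMap (t x) (h x) (f x) := by
  unfold _root_.segmentMap; fun_prop

@[simp] lemma segmentMap_zero (σ : S2) (z : V3) : segmentMap 0 σ z = z := by simp [segmentMap]

lemma segmentMap_sub (v vs : V3) (σ : S2) (t : ℝ) :
    vs + segmentMap t σ (v - vs) = v + t • (postVel v vs σ - v) := by
  unfold segmentMap postVel; module

lemma segmentMap_one_sub (v vs : V3) (σ : S2) :
    vs + segmentMap 1 σ (v - vs) = postVel v vs σ := by
  rw [segmentMap_sub]; module

lemma segmentMap_one_sub' (v vs : V3) (σ : S2) :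
    v - segmentMap 1 σ (v - vs) = postVelStar v vs σ := by
  unfold segmentMap postVelStar; module

/-- The half-space of the vectors making an angle of at most `π/2` with `σ`, without the origin. -/
def forwardCone (σ : S2) : Set V3 := {z | z ≠ 0 ∧ 0 ≤ inner ℝ z (σ : V3)}

lemma measurableSet_forwardCone (σ : S2) : MeasurableSet (forwardCone σ) := by
  have h : MeasurableSet {z : V3 | 0 ≤ inner ℝ z (σ : V3)} :=
    measurableSet_le measurable_const (by fun_prop)
  exact (measurableSet_singleton (0 : V3)).compl.inter h

lemma injOn_segmentMap {t : ℝ} (ht0 : 0 ≤ t) (ht1 : t ≤ 1) (σ : S2) :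
    Set.InjOn (segmentMap t σ) (forwardCone σ) := by
  -- If the images agree then `z - w` is a multiple of `σ`, and `|w + τ σ| > |w|` for `τ > 0`.
  have key : ∀ z ∈ forwardCone σ, ∀ w ∈ forwardCone σ, segmentMap t σ z = segmentMap t σ w →
      ‖w‖ ≤ ‖z‖ := by
    intro z hz w hw h
    by_contra! hlt
    set τ : ℝ := t / 2 * (‖w‖ - ‖z‖) / (1 - t / 2) with hτ
    have ha : 0 < 1 - t / 2 := by linarith
    have hτ0 : 0 ≤ τ := div_nonneg (mul_nonneg (by linarith) (by linarith)) ha.le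
    have hzw : z = w + τ • (σ : V3) := by
      have h1 : (1 - t / 2) • z = (1 - t / 2) • (w + τ • (σ : V3)) := by
        rw [smul_add, smul_smul, hτ, mul_div_cancel₀ _ ha.ne']
        unfold segmentMap at h
        rw [eq_sub_of_add_eq h]
        module
      exact smul_right_injective V3 ha.ne' h1
    have h2 : ‖z‖ ^ 2 = ‖w‖ ^ 2 + 2 * (τ * inner ℝ w (σ : V3)) + τ ^ 2 := by
      rw [hzw, norm_add_sq_real, inner_smul_right, norm_smul, norm_coe_sphere, mul_one,
        Real.norm_eq_abs, sq_abs]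
    have h3 := mul_nonneg hτ0 hw.2
    nlinarith [norm_nonneg z, norm_nonneg w, sq_nonneg τ]
  intro z hz w hw h
  have hn : ‖z‖ = ‖w‖ := le_antisymm (key w hw z hz h.symm) (key z hz w hw h)
  have ha : (1 - t / 2) ≠ 0 := by linarith
  unfold segmentMap at h
  rw [hn] at h
  exact smul_right_injective V3 ha (add_right_cancel h)

/-- The derivative of `segmentMap t σ` at `z ≠ 0`. -/
noncomputable def segmentMapDeriv (t : ℝ) (σ : S2) (z : V3) : V3 →L[ℝ] V3 :=
  (1 - t / 2) • ContinuousLinearMap.id ℝ V3 +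
    ((t / 2) • innerSL ℝ (‖z‖⁻¹ • z)).smulRight (σ : V3)

lemma hasFDerivAt_segmentMap (t : ℝ) (σ : S2) {z : V3} (hz : z ≠ 0) :
    HasFDerivAt (segmentMap t σ) (segmentMapDeriv t σ z) z := by
  have hn : HasFDerivAt (fun x : V3 => ‖x‖) (innerSL ℝ (‖z‖⁻¹ • z)) z := by
    have h1 := (hasStrictFDerivAt_norm_sq z).hasFDerivAt.sqrt
      (pow_ne_zero 2 (norm_ne_zero_iff.2 hz))
    simp only [Real.sqrt_sq (norm_nonneg _)] at h1
    have h2 : innerSL ℝ (‖z‖⁻¹ • z) = (1 / (2 * ‖z‖)) • 2 • innerSL ℝ z := by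
      ext x
      have := norm_ne_zero_iff.2 hz
      simp only [innerSL_apply_apply, inner_smul_left, _root_.smul_apply, smul_eq_mul,
        nsmul_eq_mul, conj_trivial]
      push_cast
      field_simp
    rw [h2]
    exact h1
  exact ((hasFDerivAt_id z).const_smul (1 - t / 2)).add
    (((hn.const_mul (t / 2))).smul_const (σ : V3))

lemma det_segmentMapDeriv {t : ℝ} (ht1 : t ≤ 1) (σ : S2) (z : V3) :
    (segmentMapDeriv t σ z).det =
      (1 - t / 2) ^ 3 + (1 - t / 2) ^ 2 * (t / 2) * cosDeviation z σ := by
  have ha : (1 - t / 2) ≠ 0 := by linarith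
  have h1 : ((segmentMapDeriv t σ z : V3 →L[ℝ] V3) : V3 →ₗ[ℝ] V3) = (1 - t / 2) •
      LinearMap.transvection ((t / 2 / (1 - t / 2)) • (innerSL ℝ (‖z‖⁻¹ • z) : V3 →ₗ[ℝ] ℝ))
        (σ : V3) := by
    apply LinearMap.ext
    intro x
    rw [LinearMap.smul_apply, LinearMap.transvection.apply]
    change (1 - t / 2) • x + (t / 2 * inner ℝ (‖z‖⁻¹ • z) x) • (σ : V3) =
      (1 - t / 2) • (x + (t / 2 / (1 - t / 2) * inner ℝ (‖z‖⁻¹ • z) x) • (σ : V3))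
    rw [smul_add, smul_smul, ← mul_assoc, mul_div_cancel₀ _ ha]
  rw [ContinuousLinearMap.det, h1, LinearMap.det_smul, LinearMap.transvection.det]
  have h2 : ((t / 2 / (1 - t / 2)) • (innerSL ℝ (‖z‖⁻¹ • z) : V3 →ₗ[ℝ] ℝ)) (σ : V3) =
      t / 2 / (1 - t / 2) * cosDeviation z σ := rfl
  rw [h2, finrank_euclideanSpace, Fintype.card_fin, mul_add, mul_one, pow_succ (1 - t / 2) 2,
    mul_assoc ((1 - t / 2) ^ 2), ← mul_assoc (1 - t / 2), mul_div_cancel₀ _ ha, mul_assoc]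

lemma one_eighth_le_det_segmentMapDeriv {t : ℝ} (ht0 : 0 ≤ t) (ht1 : t ≤ 1) {σ : S2} {z : V3}
    (hy : 0 ≤ cosDeviation z σ) : 1 / 8 ≤ (segmentMapDeriv t σ z).det := by
  rw [det_segmentMapDeriv ht1]
  have h1 : (1 / 2 : ℝ) ^ 3 ≤ (1 - t / 2) ^ 3 := by gcongr; linarith
  have h2 : 0 ≤ (1 - t / 2) ^ 2 * (t / 2) * cosDeviation z σ := by positivity
  linarith

lemma norm_le_two_mul_norm_segmentMap {t : ℝ} (ht0 : 0 ≤ t) (ht1 : t ≤ 1) {σ : S2} {z : V3}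
    (hy : 0 ≤ cosDeviation z σ) : ‖z‖ ≤ 2 * ‖segmentMap t σ z‖ := by
  have hi : 0 ≤ inner ℝ z (σ : V3) := by
    rw [← norm_mul_cosDeviation]; positivity
  have h : ‖segmentMap t σ z‖ ^ 2 = (1 - t / 2) ^ 2 * ‖z‖ ^ 2 +
      2 * ((1 - t / 2) * (t / 2 * ‖z‖) * inner ℝ z (σ : V3)) + (t / 2 * ‖z‖) ^ 2 := by
    rw [segmentMap, norm_add_sq_real, inner_smul_left, inner_smul_right, norm_smul, norm_smul,
      norm_coe_sphere, mul_one, mul_pow, Real.norm_eq_abs, Real.norm_eq_abs, sq_abs, sq_abs]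
    simp; ring
  have h2 : 0 ≤ 2 * ((1 - t / 2) * (t / 2 * ‖z‖) * inner ℝ z (σ : V3)) := by
    have : 0 ≤ 1 - t / 2 := by linarith
    positivity
  have h3 : (1 / 2 : ℝ) ^ 2 * ‖z‖ ^ 2 ≤ (1 - t / 2) ^ 2 * ‖z‖ ^ 2 := by gcongr; linarith
  have h4 : (‖z‖ / 2) ^ 2 ≤ ‖segmentMap t σ z‖ ^ 2 := by
    nlinarith [sq_nonneg (t / 2 * ‖z‖)]
  have := (pow_le_pow_iff_left₀ (by positivity) (norm_nonneg _) two_ne_zero).1 h4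
  linarith

lemma norm_segmentMap_le {t : ℝ} (ht0 : 0 ≤ t) (ht1 : t ≤ 1) (σ : S2) (z : V3) :
    ‖segmentMap t σ z‖ ≤ ‖z‖ := by
  refine (norm_add_le _ _).trans ?_
  rw [norm_smul, norm_smul, norm_coe_sphere, Real.norm_of_nonneg (by linarith),
    Real.norm_of_nonneg (by positivity)]
  linarith

/-- Along the segment from `v` to `v'` the relative velocity turns towards `σ`. -/
lemma cosDeviation_le_cosDeviation_segmentMap {t : ℝ} (ht0 : 0 ≤ t) (ht1 : t ≤ 1) {σ : S2} {z : V3}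
    (hz : z ≠ 0) (hy : 0 ≤ cosDeviation z σ) :
    cosDeviation z σ ≤ cosDeviation (segmentMap t σ z) σ := by
  have hzp := norm_pos_iff.2 hz
  have hw : 0 < ‖segmentMap t σ z‖ := by
    linarith [norm_le_two_mul_norm_segmentMap ht0 ht1 hy]
  rw [cosDeviation_eq_div (segmentMap t σ z), le_div_iff₀ hw]
  have h1 : inner ℝ (segmentMap t σ z) (σ : V3) =
      ‖z‖ * ((1 - t / 2) * cosDeviation z σ + t / 2) := by
    rw [segmentMap, inner_add_left, inner_smul_left, inner_smul_left, ← norm_mul_cosDeviation,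
      real_inner_self_eq_norm_sq, norm_coe_sphere]
    simp; ring
  rw [h1]
  calc cosDeviation z σ * ‖segmentMap t σ z‖ ≤ cosDeviation z σ * ‖z‖ := by
        gcongr; exact norm_segmentMap_le ht0 ht1 σ z
    _ ≤ ‖z‖ * ((1 - t / 2) * cosDeviation z σ + t / 2) := by
        nlinarith [mul_nonneg ht0 (sub_nonneg.2 (cosDeviation_le_one z σ)),
          mul_nonneg hzp.le (mul_nonneg ht0 (sub_nonneg.2 (cosDeviation_le_one z σ)))]

/-- The change of variables `w = segmentMap t σ z` costs at most a factor `8`, since the Jacobian is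
at least `1/8` on the half-space. -/
lemma setLIntegral_forwardCone_segmentMap_le {t : ℝ} (ht0 : 0 ≤ t) (ht1 : t ≤ 1) (σ : S2)
    (G : V3 → ℝ≥0∞) :
    ∫⁻ z in forwardCone σ, G (segmentMap t σ z) ≤ 8 * ∫⁻ w, G w := by
  have h := lintegral_image_eq_lintegral_abs_det_fderiv_mul volume (measurableSet_forwardCone σ)
    (fun z hz => (hasFDerivAt_segmentMap t σ hz.1).hasFDerivWithinAt)
    (injOn_segmentMap ht0 ht1 σ) G
  calc ∫⁻ z in forwardCone σ, G (segmentMap t σ z)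
      ≤ ∫⁻ z in forwardCone σ, 8 * (ENNReal.ofReal |(segmentMapDeriv t σ z).det| *
          G (segmentMap t σ z)) := by
        refine setLIntegral_mono' (measurableSet_forwardCone σ) fun z hz => ?_
        have hd := one_eighth_le_det_segmentMapDeriv ht0 ht1
          ((cosDeviation_nonneg_iff hz.1 σ).2 hz.2)
        rw [← mul_assoc]
        refine le_mul_of_one_le_left' ?_
        rw [show (8 : ℝ≥0∞) = ENNReal.ofReal 8 by simp, ← ENNReal.ofReal_mul (by norm_num),
          ← ENNReal.ofReal_one]
        exact ENNReal.ofReal_le_ofReal (by linarith [le_abs_self (segmentMapDeriv t σ z).det])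
    _ = 8 * ∫⁻ w in segmentMap t σ '' forwardCone σ, G w := by
        rw [h, lintegral_const_mul' _ _ (by simp)]
    _ ≤ 8 * ∫⁻ w, G w := mul_le_mul_right (setLIntegral_le_lintegral _ _) _

/-! ### Angular weights and velocity weights -/

/-- The angular weight `1_{x ≥ 0} (1 - x)^{-p}` (with value `∞` at `x = 1`), which is integrable
over the sphere for `p < 1`. -/
noncomputable def angularWeight (p x : ℝ) : ℝ≥0∞ :=
  if 0 ≤ x then ENNReal.ofReal (1 - x) ^ (-p) else 0

lemma measurable_angularWeight (p : ℝ) : Measurable (angularWeight p) :=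
  Measurable.ite measurableSet_Ici (by fun_prop) measurable_const

@[fun_prop]
lemma Measurable.angularWeight {α : Type*} [MeasurableSpace α] {f : α → ℝ} {p : ℝ}
    (hf : Measurable f) : Measurable fun x => angularWeight p (f x) :=
  (measurable_angularWeight p).comp hf

lemma angularWeight_le_of_le {p x y : ℝ} (hp : 0 ≤ p) (hx : 0 ≤ x) (hxy : x ≤ y) :
    angularWeight p x ≤ angularWeight p y := by
  rw [angularWeight, angularWeight, if_pos hx, if_pos (hx.trans hxy), ENNReal.rpow_neg,
    ENNReal.rpow_neg]
  gcongr

lemma angularWeight_of_lt_one {p x : ℝ} (h0 : 0 ≤ x) (h1 : x < 1) :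
    angularWeight p x = ENNReal.ofReal ((1 - x) ^ (-p)) := by
  rw [angularWeight, if_pos h0, ENNReal.ofReal_rpow_of_pos (by linarith)]

lemma lintegral_one_sub_rpow_lt_top {p : ℝ} (hp : p < 1) :
    ∫⁻ t in Set.Ioo (0 : ℝ) 1, ENNReal.ofReal ((1 - t) ^ (-p)) < ⊤ := by
  have h1 : IntervalIntegrable (fun x : ℝ => (1 - x) ^ (-p)) volume 0 1 := by
    have := (intervalIntegral.intervalIntegrable_rpow' (a := 0) (b := 1)
      (r := -p) (by linarith)).comp_sub_left 1
    simpa using this.symm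
  have h2 := ((intervalIntegrable_iff_integrableOn_Ioo_of_le zero_le_one).1 h1).lintegral_lt_top
  exact h2

lemma lintegral_angularWeight_lt_top {p : ℝ} (hp : p < 1) :
    ∫⁻ t in Set.Ioo (-1 : ℝ) 1, angularWeight p t < ⊤ := by
  refine lt_of_le_of_lt ?_ (lintegral_one_sub_rpow_lt_top hp)
  rw [← lintegral_indicator measurableSet_Ioo, ← lintegral_indicator measurableSet_Ioo]
  refine lintegral_mono_ae ?_
  filter_upwards [Measure.ae_ne volume (0 : ℝ)] with t ht
  by_cases h : t ∈ Set.Ioo (0 : ℝ) 1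
  · rw [Set.indicator_of_mem h, Set.indicator_of_mem (Set.mem_Ioo.2 ⟨by linarith [h.1], h.2⟩),
      angularWeight_of_lt_one h.1.le h.2]
  · rw [Set.indicator_of_notMem h]
    refine (Set.indicator_apply_eq_zero.2 fun h' => ?_).le
    have : ¬ 0 ≤ t := fun h0 => h ⟨lt_of_le_of_ne h0 ht.symm, h'.2⟩
    rw [angularWeight, if_neg this]

/-- The integral of the angular weight over the sphere. -/
noncomputable def angularMass (p : ℝ) : ℝ≥0∞ :=
  ENNReal.ofReal (2 * Real.pi) * ∫⁻ t in Set.Ioo (-1 : ℝ) 1, angularWeight p t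

lemma angularMass_lt_top {p : ℝ} (hp : p < 1) : angularMass p < ⊤ :=
  ENNReal.mul_lt_top ENNReal.ofReal_lt_top (lintegral_angularWeight_lt_top hp)

/-- By Archimedes' theorem, `∫ Φ(cos θ) dσ` does not depend on `z ≠ 0`. -/
lemma lintegral_cosDeviation {Φ : ℝ → ℝ≥0∞} (hΦ : Measurable Φ) {z : V3} (hz : z ≠ 0) :
    ∫⁻ σ, Φ (cosDeviation z σ) ∂surfaceMeasure =
      ENNReal.ofReal (2 * Real.pi) * ∫⁻ t in Set.Ioo (-1 : ℝ) 1, Φ t := by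
  refine lintegral_inner_sphere hΦ ?_
  rw [norm_smul, norm_inv, norm_norm, inv_mul_cancel₀ (norm_ne_zero_iff.2 hz)]

/-- The singular change of variables: uniformly along the segments from `v` to `v'`, an angular
weight with an integrable singularity may be integrated out. -/
lemma lintegral_angularWeight_segmentMap_le {p : ℝ} (hp : 0 ≤ p) {t : ℝ} (ht0 : 0 ≤ t)
    (ht1 : t ≤ 1) {F : V3 → ℝ≥0∞} (hF : Measurable F) :
    ∫⁻ q : S2 × V3, angularWeight p (cosDeviation q.2 q.1) * F (segmentMap t q.1 q.2)
      ∂(surfaceMeasure.prod volume) ≤ 8 * angularMass p * ∫⁻ w, F w := by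
  rw [lintegral_prod _ (Measurable.aemeasurable (by fun_prop))]
  have h1 : ∀ σ : S2, ∫⁻ z, angularWeight p (cosDeviation z σ) * F (segmentMap t σ z) ≤
      8 * ∫⁻ w, angularWeight p (cosDeviation w σ) * F w := by
    intro σ
    refine le_trans ?_ (setLIntegral_forwardCone_segmentMap_le ht0 ht1 σ _)
    rw [← lintegral_indicator (measurableSet_forwardCone σ)]
    refine lintegral_mono_ae ?_
    filter_upwards [Measure.ae_ne volume (0 : V3)] with z hz
    by_cases hy : 0 ≤ cosDeviation z σ
    · rw [Set.indicator_of_mem (show z ∈ forwardCone σ from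
        ⟨hz, (cosDeviation_nonneg_iff hz σ).1 hy⟩)]
      gcongr
      exact angularWeight_le_of_le hp hy (cosDeviation_le_cosDeviation_segmentMap ht0 ht1 hz hy)
    · rw [angularWeight, if_neg hy, zero_mul]
      exact zero_le
  refine (lintegral_mono h1).trans ?_
  rw [lintegral_const_mul' _ _ (by simp), mul_assoc, lintegral_lintegral_swap
    (Measurable.aemeasurable (by fun_prop)), ← lintegral_const_mul _ hF]
  gcongr 8 * ?_
  refine lintegral_mono_ae ?_
  filter_upwards [Measure.ae_ne volume (0 : V3)] with w hw
  rw [lintegral_mul_const _ (by fun_prop), lintegral_cosDeviation (measurable_angularWeight p) hw]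
  exact le_rfl

lemma norm_postVel_sub_sq (v vs : V3) (σ : S2) :
    ‖postVel v vs σ - v‖ ^ 2 = ‖v - vs‖ ^ 2 * ((1 - cosDeviation (v - vs) σ) / 2) := by
  have h : postVel v vs σ - v = (2⁻¹ : ℝ) • (‖v - vs‖ • (σ : V3) - (v - vs)) := by
    unfold postVel; module
  rw [h, norm_smul, mul_pow, norm_sub_sq_real, inner_smul_left, norm_smul, norm_coe_sphere,
    real_inner_comm, ← norm_mul_cosDeviation]
  simp
  ring

lemma one_le_bracket (v : V3) : 1 ≤ bracket v := by
  rw [bracket, Real.one_le_sqrt]; nlinarith [sq_nonneg ‖v‖]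

lemma bracket_pos (v : V3) : 0 < bracket v := one_pos.trans_le (one_le_bracket v)

lemma norm_le_bracket (v : V3) : ‖v‖ ≤ bracket v := by
  rw [bracket]; exact Real.le_sqrt_of_sq_le (by linarith)

lemma bracket_le_add (u v : V3) : bracket u ≤ bracket v + ‖u - v‖ := by
  have hb := norm_le_bracket v
  have h1 : bracket v ^ 2 = 1 + ‖v‖ ^ 2 := by rw [bracket, Real.sq_sqrt (by positivity)]
  have h2 : ‖u‖ ≤ ‖v‖ + ‖u - v‖ := by
    calc ‖u‖ = ‖v + (u - v)‖ := by rw [add_sub_cancel]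
      _ ≤ _ := norm_add_le _ _
  rw [bracket, Real.sqrt_le_left (by have := bracket_pos v; positivity)]
  nlinarith [norm_nonneg u, norm_nonneg v, norm_nonneg (u - v), mul_le_mul_of_nonneg_right hb
    (norm_nonneg (u - v)), mul_self_le_mul_self (norm_nonneg u) h2]

@[fun_prop]
lemma continuous_bracket : Continuous bracket := by unfold bracket; fun_prop

@[fun_prop]
lemma measurable_bracket : Measurable bracket := continuous_bracket.measurable

/-- The weight `⟨v⟩^a` with values in `[0, ∞]`. -/
noncomputable def bracketWeight (a : ℝ) (v : V3) : ℝ≥0∞ := ENNReal.ofReal (bracket v ^ a)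

@[fun_prop]
lemma measurable_bracketWeight (a : ℝ) : Measurable (bracketWeight a) := by
  unfold bracketWeight; fun_prop

/-- The weighted norm `∫ |h| ⟨v⟩^a dv`, with values in `[0, ∞]`. -/
noncomputable def weightedMass (a : ℝ) (h : V3 → ℝ) : ℝ≥0∞ := ∫⁻ v, ‖h v‖ₑ * bracketWeight a v

lemma bracketWeight_mono {a c : ℝ} (hac : a ≤ c) (v : V3) :
    bracketWeight a v ≤ bracketWeight c v :=
  ENNReal.ofReal_le_ofReal (Real.rpow_le_rpow_of_exponent_le (one_le_bracket v) hac)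

lemma one_le_bracketWeight {a : ℝ} (ha : 0 ≤ a) (v : V3) : 1 ≤ bracketWeight a v := by
  rw [bracketWeight, ENNReal.one_le_ofReal]
  exact Real.one_le_rpow (one_le_bracket v) ha

lemma weightedMass_mono {a c : ℝ} (hac : a ≤ c) (h : V3 → ℝ) :
    weightedMass a h ≤ weightedMass c h :=
  lintegral_mono fun v => mul_le_mul_right (bracketWeight_mono hac v) _

/-- If `|v' - v| ≤ ⟨v⟩/2`, then all the weights along the segment from `v` to `v'` are comparable. -/
lemma weights_le_of_close {γ k : ℝ} (hγ : 0 ≤ γ) (hk : 0 ≤ k) {v vs : V3} {σ : S2} {t : ℝ}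
    (ht0 : 0 ≤ t) (ht1 : t ≤ 1) (hy : 0 ≤ cosDeviation (v - vs) σ)
    (hA : ‖postVel v vs σ - v‖ ≤ bracket v / 2) :
    (bracket v ^ k + bracket (postVel v vs σ) ^ k) * ‖v - vs‖ ^ (γ + 1) ≤
      2 * 3 ^ k * 4 ^ (γ + 1) * (bracket vs ^ (γ + 1) *
        bracket (vs + segmentMap t σ (v - vs)) ^ (γ + 1 + k)) := by
  set u := vs + segmentMap t σ (v - vs) with hu
  have hbu := bracket_pos u
  have hbs := bracket_pos vs
  have hbv := bracket_pos v
  have hd : ‖v - u‖ ≤ ‖postVel v vs σ - v‖ := by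
    rw [hu, segmentMap_sub, sub_add_cancel_left, norm_neg, norm_smul, Real.norm_of_nonneg ht0]
    exact mul_le_of_le_one_left (norm_nonneg _) ht1
  have h1 : bracket v ≤ 2 * bracket u := by linarith [bracket_le_add v u]
  have h2 : bracket (postVel v vs σ) ≤ 3 * bracket u := by
    linarith [bracket_le_add (postVel v vs σ) v]
  have h3 : ‖v - vs‖ ≤ 4 * (bracket vs * bracket u) := by
    have e1 := norm_le_two_mul_norm_segmentMap ht0 ht1 hy
    have e2 : ‖segmentMap t σ (v - vs)‖ ≤ ‖u‖ + ‖vs‖ := by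
      rw [show segmentMap t σ (v - vs) = u - vs by rw [hu]; abel]
      exact norm_sub_le _ _
    nlinarith [norm_le_bracket u, norm_le_bracket vs, one_le_bracket u, one_le_bracket vs,
      mul_nonneg (sub_nonneg.2 (one_le_bracket u)) (sub_nonneg.2 (one_le_bracket vs))]
  have e1 : bracket v ^ k ≤ 3 ^ k * bracket u ^ k := by
    rw [← Real.mul_rpow (by norm_num) hbu.le]
    exact Real.rpow_le_rpow hbv.le (by linarith) hk
  have e2 : bracket (postVel v vs σ) ^ k ≤ 3 ^ k * bracket u ^ k := by
    rw [← Real.mul_rpow (by norm_num) hbu.le]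
    exact Real.rpow_le_rpow (bracket_pos _).le h2 hk
  have e3 : ‖v - vs‖ ^ (γ + 1) ≤ 4 ^ (γ + 1) * (bracket vs ^ (γ + 1) * bracket u ^ (γ + 1)) := by
    rw [← Real.mul_rpow hbs.le hbu.le, ← Real.mul_rpow (by norm_num) (by positivity)]
    exact Real.rpow_le_rpow (norm_nonneg _) h3 (by linarith)
  calc (bracket v ^ k + bracket (postVel v vs σ) ^ k) * ‖v - vs‖ ^ (γ + 1)
      ≤ (3 ^ k * bracket u ^ k + 3 ^ k * bracket u ^ k) *
        (4 ^ (γ + 1) * (bracket vs ^ (γ + 1) * bracket u ^ (γ + 1))) := by gcongr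
    _ = _ := by rw [Real.rpow_add hbu (γ + 1) k]; ring

/-- If `|v' - v| > ⟨v⟩/2`, then the weights are controlled by the deviation, which compensates a
part of the angular singularity. -/
lemma weights_le_of_far {k : ℝ} (hk : 1 ≤ k) {v vs : V3} {σ : S2}
    (hy : 0 ≤ cosDeviation (v - vs) σ) (hA : bracket v / 2 < ‖postVel v vs σ - v‖) :
    bracket v ^ k + bracket (postVel v vs σ) ^ k ≤
      2 * 3 ^ k * ‖v - vs‖ ^ k * (1 - cosDeviation (v - vs) σ) ^ (1 / 2 : ℝ) := by
  set δ := ‖postVel v vs σ - v‖ with hδ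
  set x := 1 - cosDeviation (v - vs) σ with hx
  have hx0 : 0 ≤ x := by have := cosDeviation_le_one (v - vs) σ; linarith
  have hx1 : x ≤ 1 := by linarith
  have h1 : bracket v ≤ 3 * δ := by linarith [norm_nonneg (postVel v vs σ - v)]
  have h2 : bracket (postVel v vs σ) ≤ 3 * δ := by linarith [bracket_le_add (postVel v vs σ) v]
  have hδk : δ ^ k ≤ ‖v - vs‖ ^ k * x ^ (1 / 2 : ℝ) := by
    have e0 : δ ^ 2 ≤ ‖v - vs‖ ^ 2 * x := by
      rw [hδ, norm_postVel_sub_sq, ← hx]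
      gcongr
      linarith
    have e1 : δ ^ k = (δ ^ 2) ^ (k / 2) := by
      rw [← Real.rpow_natCast, ← Real.rpow_mul (norm_nonneg _)]
      congr 1; push_cast; ring
    have e2 : ‖v - vs‖ ^ k = (‖v - vs‖ ^ 2) ^ (k / 2) := by
      rw [← Real.rpow_natCast, ← Real.rpow_mul (norm_nonneg _)]
      congr 1; push_cast; ring
    calc δ ^ k = (δ ^ 2) ^ (k / 2) := e1
      _ ≤ (‖v - vs‖ ^ 2 * x) ^ (k / 2) := Real.rpow_le_rpow (by positivity) e0 (by linarith)
      _ = ‖v - vs‖ ^ k * x ^ (k / 2) := by rw [Real.mul_rpow (by positivity) hx0, e2]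
      _ ≤ ‖v - vs‖ ^ k * x ^ (1 / 2 : ℝ) := by
          gcongr ?_ * ?_
          rcases hx0.eq_or_lt with h | h
          · rw [← h, Real.zero_rpow (by linarith), Real.zero_rpow (by norm_num)]
          · exact Real.rpow_le_rpow_of_exponent_ge h hx1 (by linarith)
  have hk0 : 0 ≤ k := by linarith
  calc bracket v ^ k + bracket (postVel v vs σ) ^ k ≤ (3 * δ) ^ k + (3 * δ) ^ k :=
        add_le_add (Real.rpow_le_rpow (bracket_pos _).le h1 hk0)
          (Real.rpow_le_rpow (bracket_pos _).le h2 hk0)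
    _ = 2 * 3 ^ k * δ ^ k := by rw [Real.mul_rpow (by norm_num) (norm_nonneg _)]; ring
    _ ≤ 2 * 3 ^ k * (‖v - vs‖ ^ k * x ^ (1 / 2 : ℝ)) := by gcongr
    _ = _ := by ring

lemma norm_sub_rpow_le {a : ℝ} (ha : 0 ≤ a) (u vs : V3) :
    ‖u - vs‖ ^ a ≤ 2 ^ a * (bracket u ^ a + bracket vs ^ a) := by
  have h : ‖u - vs‖ ≤ 2 * max (bracket u) (bracket vs) := by
    linarith [norm_sub_le u vs, norm_le_bracket u, norm_le_bracket vs,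
      le_max_left (bracket u) (bracket vs), le_max_right (bracket u) (bracket vs)]
  have hu := Real.rpow_nonneg (bracket_pos u).le a
  have hs := Real.rpow_nonneg (bracket_pos vs).le a
  calc ‖u - vs‖ ^ a ≤ (2 * max (bracket u) (bracket vs)) ^ a :=
        Real.rpow_le_rpow (norm_nonneg _) h ha
    _ = 2 ^ a * max (bracket u) (bracket vs) ^ a :=
        Real.mul_rpow (by norm_num) ((bracket_pos u).le.trans (le_max_left _ _))
    _ ≤ _ := by
        gcongr
        rcases max_choice (bracket u) (bracket vs) with h | h <;> rw [h] <;> linarith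

lemma norm_rpow_le_segmentMap {a : ℝ} (ha : 0 ≤ a) {t : ℝ} (ht0 : 0 ≤ t) (ht1 : t ≤ 1) {z vs : V3}
    {σ : S2} (hy : 0 ≤ cosDeviation z σ) :
    ‖z‖ ^ a ≤ 4 ^ a * (bracket (vs + segmentMap t σ z) ^ a + bracket vs ^ a) := by
  calc ‖z‖ ^ a ≤ (2 * ‖segmentMap t σ z‖) ^ a :=
        Real.rpow_le_rpow (norm_nonneg _) (norm_le_two_mul_norm_segmentMap ht0 ht1 hy) ha
    _ = 2 ^ a * ‖vs + segmentMap t σ z - vs‖ ^ a := by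
        rw [Real.mul_rpow (by norm_num) (norm_nonneg _), add_sub_cancel_left]
    _ ≤ 2 ^ a * (2 ^ a * (bracket (vs + segmentMap t σ z) ^ a + bracket vs ^ a)) := by
        gcongr; exact norm_sub_rpow_le ha _ _
    _ = _ := by
        rw [← mul_assoc, ← Real.mul_rpow (by norm_num) (by norm_num)]; norm_num

/-! ### Weighted increments of a smooth function -/

/-- The properties of the angular function used in the estimates: compared with
`IsModerateAngular`, the bounds are expressed in `x = cos θ`, and `b` vanishes at `x = 1`. -/
structure AngularBound (b : ℝ → ℝ) (C s : ℝ) : Prop where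
  measurable : Measurable b
  nonneg : ∀ x, 0 ≤ b x
  eq_zero_of_neg : ∀ x, x < 0 → b x = 0
  eq_zero_of_one_le : ∀ x, 1 ≤ x → b x = 0
  le : ∀ x, 0 ≤ x → x < 1 → b x ≤ C * (1 - x) ^ (-(1 + s))
  const_nonneg : 0 ≤ C
  s_pos : 0 < s
  s_lt : s < 1 / 2

lemma productKernel_eq (γ : ℝ) (b : ℝ → ℝ) (z : V3) (σ : S2) :
    productKernel γ b z σ = ‖z‖ ^ γ * b (cosDeviation z σ) := rfl

lemma Measurable.productKernel {α : Type*} [MeasurableSpace α] {γ : ℝ} {b : ℝ → ℝ}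
    (hb : Measurable b) {f : α → V3} {h : α → S2} (hf : Measurable f) (hh : Measurable h) :
    Measurable fun x => productKernel γ b (f x) (h x) := by
  simp only [productKernel_eq]
  fun_prop

namespace AngularBound

variable {b : ℝ → ℝ} {C s : ℝ}

lemma productKernel_nonneg (hb : AngularBound b C s) (γ : ℝ) (z : V3) (σ : S2) :
    0 ≤ productKernel γ b z σ :=
  mul_nonneg (Real.rpow_nonneg (norm_nonneg _) _) (hb.nonneg _)

/-- Half a power of `1 - cos θ` makes the angular singularity integrable. -/
lemma mul_sqrt_le (hb : AngularBound b C s) (x : ℝ) :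
    ENNReal.ofReal (b x * (1 - x) ^ (1 / 2 : ℝ)) ≤
      ENNReal.ofReal C * angularWeight (1 / 2 + s) x := by
  rcases lt_or_ge x 0 with h | h0
  · simp [hb.eq_zero_of_neg x h]
  rcases le_or_gt 1 x with h | h1
  · simp [hb.eq_zero_of_one_le x h]
  rw [angularWeight_of_lt_one h0 h1, ← ENNReal.ofReal_mul hb.const_nonneg]
  apply ENNReal.ofReal_le_ofReal
  have h : 0 < 1 - x := by linarith
  calc b x * (1 - x) ^ (1 / 2 : ℝ) ≤ C * (1 - x) ^ (-(1 + s)) * (1 - x) ^ (1 / 2 : ℝ) := by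
        gcongr; exact hb.le x h0 h1
    _ = _ := by rw [mul_assoc, ← Real.rpow_add h]; congr 2; ring

lemma cosDeviation_nonneg (hb : AngularBound b C s) {x : ℝ} (h : b x ≠ 0) : 0 ≤ x := by
  by_contra! h'
  exact h (hb.eq_zero_of_neg x h')

/-- Where `|v' - v| ≤ ⟨v⟩/2`, the whole weight is carried by the point of the segment, which will be
the argument of the gradient, and `v_*` only receives `⟨v_*⟩^(γ+1)`. -/
lemma kernel_mul_weights_le_of_close (hb : AngularBound b C s) {γ k : ℝ} (hγ : 0 ≤ γ) (hk : 0 ≤ k)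
    {v vs : V3} {σ : S2} {t : ℝ} (ht0 : 0 ≤ t) (ht1 : t ≤ 1)
    (hA : ‖postVel v vs σ - v‖ ≤ bracket v / 2) :
    ENNReal.ofReal (productKernel γ b (v - vs) σ) * ‖postVel v vs σ - v‖ₑ *
        (bracketWeight k v + bracketWeight k (postVel v vs σ)) ≤
      ENNReal.ofReal (2 * 3 ^ k * 4 ^ (γ + 1)) * ENNReal.ofReal C *
        (bracketWeight (γ + 1) vs * (angularWeight (1 / 2 + s) (cosDeviation (v - vs) σ) *
          bracketWeight (γ + 1 + k) (vs + segmentMap t σ (v - vs)))) := by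
  set y := cosDeviation (v - vs) σ with hydef
  by_cases hb0 : b y = 0
  · rw [productKernel_eq, ← hydef, hb0]; simp
  have hy := hb.cosDeviation_nonneg hb0
  have hy1 : 0 ≤ 1 - y := sub_nonneg.2 (cosDeviation_le_one _ _)
  have hbn : 0 ≤ b y * (1 - y) ^ (1 / 2 : ℝ) :=
    mul_nonneg (hb.nonneg y) (Real.rpow_nonneg hy1 _)
  have hδ : ‖postVel v vs σ - v‖ ≤ ‖v - vs‖ * (1 - y) ^ (1 / 2 : ℝ) := by
    rw [← Real.sqrt_eq_rpow]
    refine (sq_le_sq₀ (norm_nonneg _) (by positivity)).1 ?_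
    rw [norm_postVel_sub_sq, mul_pow, Real.sq_sqrt hy1]
    gcongr
    linarith
  have hm : 0 ≤ bracket v ^ k + bracket (postVel v vs σ) ^ k :=
    add_nonneg (Real.rpow_nonneg (bracket_pos _).le _) (Real.rpow_nonneg (bracket_pos _).le _)
  have hs := Real.rpow_nonneg (bracket_pos vs).le (γ + 1)
  have hu := Real.rpow_nonneg (bracket_pos (vs + segmentMap t σ (v - vs))).le (γ + 1 + k)
  have h1 : productKernel γ b (v - vs) σ * ‖postVel v vs σ - v‖ *
      (bracket v ^ k + bracket (postVel v vs σ) ^ k) ≤ (2 * 3 ^ k * 4 ^ (γ + 1)) *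
        ((b y * (1 - y) ^ (1 / 2 : ℝ)) * (bracket vs ^ (γ + 1) *
          bracket (vs + segmentMap t σ (v - vs)) ^ (γ + 1 + k))) := by
    calc _ ≤ (‖v - vs‖ ^ γ * b y) * (‖v - vs‖ * (1 - y) ^ (1 / 2 : ℝ)) *
          (bracket v ^ k + bracket (postVel v vs σ) ^ k) := by
          rw [productKernel_eq, ← hydef]
          have := hb.nonneg y
          gcongr
      _ = (b y * (1 - y) ^ (1 / 2 : ℝ)) * ((bracket v ^ k + bracket (postVel v vs σ) ^ k) *
            ‖v - vs‖ ^ (γ + 1)) := by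
          rw [Real.rpow_add_one' (norm_nonneg _) (by linarith)]; ring
      _ ≤ (b y * (1 - y) ^ (1 / 2 : ℝ)) * (2 * 3 ^ k * 4 ^ (γ + 1) * (bracket vs ^ (γ + 1) *
            bracket (vs + segmentMap t σ (v - vs)) ^ (γ + 1 + k))) := by
          exact mul_le_mul_of_nonneg_left (weights_le_of_close hγ hk ht0 ht1 hy hA) hbn
      _ = _ := by ring
  calc _ = ENNReal.ofReal (productKernel γ b (v - vs) σ * ‖postVel v vs σ - v‖ *
      (bracket v ^ k + bracket (postVel v vs σ) ^ k)) := by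
        rw [ENNReal.ofReal_mul (mul_nonneg (hb.productKernel_nonneg _ _ _) (norm_nonneg _)),
          ENNReal.ofReal_mul (hb.productKernel_nonneg _ _ _), ofReal_norm,
          ENNReal.ofReal_add (Real.rpow_nonneg (bracket_pos _).le _)
            (Real.rpow_nonneg (bracket_pos _).le _)]
        rfl
    _ ≤ _ := ENNReal.ofReal_le_ofReal h1
    _ = ENNReal.ofReal (2 * 3 ^ k * 4 ^ (γ + 1)) * (ENNReal.ofReal (b y * (1 - y) ^ (1 / 2 : ℝ)) *
          (bracketWeight (γ + 1) vs * bracketWeight (γ + 1 + k)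
            (vs + segmentMap t σ (v - vs)))) := by
        rw [ENNReal.ofReal_mul (by positivity), ENNReal.ofReal_mul hbn, ENNReal.ofReal_mul hs]
        rfl
    _ ≤ ENNReal.ofReal (2 * 3 ^ k * 4 ^ (γ + 1)) * ((ENNReal.ofReal C *
          angularWeight (1 / 2 + s) y) * (bracketWeight (γ + 1) vs * bracketWeight (γ + 1 + k)
            (vs + segmentMap t σ (v - vs)))) := by
        gcongr; exact hb.mul_sqrt_le y
    _ = _ := by ring

/-- Where `|v' - v| > ⟨v⟩/2`, the weights already compensate the angular singularity, and the
increment of `h` is not needed for this. -/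
lemma kernel_mul_weights_le_of_far (hb : AngularBound b C s) {γ k : ℝ} (hγ : 0 ≤ γ) (hk : 1 ≤ k)
    {v vs : V3} {σ : S2} {t : ℝ} (ht0 : 0 ≤ t) (ht1 : t ≤ 1)
    (hA : bracket v / 2 < ‖postVel v vs σ - v‖) :
    ENNReal.ofReal (productKernel γ b (v - vs) σ) *
        (bracketWeight k v + bracketWeight k (postVel v vs σ)) ≤
      ENNReal.ofReal (2 * 3 ^ k * 4 ^ (γ + k)) * ENNReal.ofReal C *
        (angularWeight (1 / 2 + s) (cosDeviation (v - vs) σ) *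
          (bracketWeight (γ + k) (vs + segmentMap t σ (v - vs)) + bracketWeight (γ + k) vs)) := by
  set y := cosDeviation (v - vs) σ with hydef
  by_cases hb0 : b y = 0
  · rw [productKernel_eq, ← hydef, hb0]; simp
  have hy := hb.cosDeviation_nonneg hb0
  have hy1 : 0 ≤ 1 - y := sub_nonneg.2 (cosDeviation_le_one _ _)
  have hbn : 0 ≤ b y * (1 - y) ^ (1 / 2 : ℝ) :=
    mul_nonneg (hb.nonneg y) (Real.rpow_nonneg hy1 _)
  have hs := Real.rpow_nonneg (bracket_pos vs).le (γ + k)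
  have hu := Real.rpow_nonneg (bracket_pos (vs + segmentMap t σ (v - vs))).le (γ + k)
  have h1 : productKernel γ b (v - vs) σ *
      (bracket v ^ k + bracket (postVel v vs σ) ^ k) ≤ (2 * 3 ^ k * 4 ^ (γ + k)) *
        ((b y * (1 - y) ^ (1 / 2 : ℝ)) * (bracket (vs + segmentMap t σ (v - vs)) ^ (γ + k) +
          bracket vs ^ (γ + k))) := by
    calc _ ≤ (‖v - vs‖ ^ γ * b y) * (2 * 3 ^ k * ‖v - vs‖ ^ k * (1 - y) ^ (1 / 2 : ℝ)) := by
          rw [productKernel_eq, ← hydef]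
          have := hb.nonneg y
          gcongr
          exact weights_le_of_far hk hy hA
      _ = (2 * 3 ^ k) * (b y * (1 - y) ^ (1 / 2 : ℝ)) * ‖v - vs‖ ^ (γ + k) := by
          rw [Real.rpow_add' (norm_nonneg _) (by linarith)]; ring
      _ ≤ (2 * 3 ^ k) * (b y * (1 - y) ^ (1 / 2 : ℝ)) * (4 ^ (γ + k) *
            (bracket (vs + segmentMap t σ (v - vs)) ^ (γ + k) + bracket vs ^ (γ + k))) := by
          gcongr
          exact norm_rpow_le_segmentMap (by linarith) ht0 ht1 hy
      _ = _ := by ring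
  calc _ = ENNReal.ofReal (productKernel γ b (v - vs) σ *
      (bracket v ^ k + bracket (postVel v vs σ) ^ k)) := by
        rw [ENNReal.ofReal_mul (hb.productKernel_nonneg _ _ _),
          ENNReal.ofReal_add (Real.rpow_nonneg (bracket_pos _).le _)
            (Real.rpow_nonneg (bracket_pos _).le _)]
        rfl
    _ ≤ _ := ENNReal.ofReal_le_ofReal h1
    _ = ENNReal.ofReal (2 * 3 ^ k * 4 ^ (γ + k)) * (ENNReal.ofReal (b y * (1 - y) ^ (1 / 2 : ℝ)) *
          (bracketWeight (γ + k) (vs + segmentMap t σ (v - vs)) + bracketWeight (γ + k) vs)) := by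
        rw [ENNReal.ofReal_mul (by positivity), ENNReal.ofReal_mul hbn, ENNReal.ofReal_add hu hs]
        rfl
    _ ≤ ENNReal.ofReal (2 * 3 ^ k * 4 ^ (γ + k)) * ((ENNReal.ofReal C *
          angularWeight (1 / 2 + s) y) *
          (bracketWeight (γ + k) (vs + segmentMap t σ (v - vs)) + bracketWeight (γ + k) vs)) := by
        gcongr; exact hb.mul_sqrt_le y
    _ = _ := by ring

end AngularBound

/-- The density `B |f' - f| (⟨v⟩^k + ⟨v'⟩^k)` at `v = v_* + z`, as a function of `(σ, z)`. -/
noncomputable def incrementDensity (γ : ℝ) (b : ℝ → ℝ) (k : ℝ) (vs : V3) (f : V3 → ℝ)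
    (q : S2 × V3) : ℝ≥0∞ :=
  ENNReal.ofReal (productKernel γ b q.2 q.1) *
    ‖f (postVel (vs + q.2) vs q.1) - f (vs + q.2)‖ₑ *
    (bracketWeight k (vs + q.2) + bracketWeight k (postVel (vs + q.2) vs q.1))

/-- The configurations `(σ, z)` for which `|v' - v| ≤ ⟨v⟩/2`, where `v = v_* + z`. -/
def closeSet (vs : V3) : Set (S2 × V3) :=
  {q | ‖postVel (vs + q.2) vs q.1 - (vs + q.2)‖ ≤ bracket (vs + q.2) / 2}

lemma measurableSet_closeSet (vs : V3) : MeasurableSet (closeSet vs) :=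
  measurableSet_le (by fun_prop) (by fun_prop)

lemma measurable_incrementDensity {γ : ℝ} {b : ℝ → ℝ} (hb : Measurable b) (k : ℝ) (vs : V3)
    {f : V3 → ℝ} (hf : Measurable f) : Measurable (incrementDensity γ b k vs f) := by
  have := hb.productKernel (γ := γ) (f := fun q : S2 × V3 => q.2) (h := fun q : S2 × V3 => q.1)
    (by fun_prop) (by fun_prop)
  unfold incrementDensity
  fun_prop

/-- The fundamental theorem of calculus along a segment. -/
lemma enorm_sub_le_lintegral_fderiv {f : V3 → ℝ} (hf : ContDiff ℝ 1 f) (v w : V3) :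
    ‖f w - f v‖ₑ ≤ ∫⁻ t in Set.Ioc (0 : ℝ) 1, ‖fderiv ℝ f (v + t • (w - v))‖ₑ * ‖w - v‖ₑ := by
  have hd : ∀ t : ℝ, HasDerivAt (fun t : ℝ => f (v + t • (w - v)))
      (fderiv ℝ f (v + t • (w - v)) (w - v)) t := by
    intro t
    have h1 : HasDerivAt (fun t : ℝ => v + t • (w - v)) (w - v) t := by
      simpa using ((hasDerivAt_id t).smul_const (w - v)).const_add v
    exact ((hf.differentiable one_ne_zero _).hasFDerivAt).comp_hasDerivAt t h1
  have hc : Continuous fun t : ℝ => fderiv ℝ f (v + t • (w - v)) (w - v) :=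
    ((hf.continuous_fderiv one_ne_zero).comp (by fun_prop)).clm_apply continuous_const
  have h := intervalIntegral.integral_eq_sub_of_hasDerivAt (fun t _ => hd t)
    (hc.intervalIntegrable 0 1)
  simp only [one_smul, add_sub_cancel, zero_smul, add_zero] at h
  rw [← h, intervalIntegral.integral_of_le zero_le_one]
  refine (enorm_integral_le_lintegral_enorm _).trans (lintegral_mono fun t => ?_)
  exact ContinuousLinearMap.le_opENorm _ _

lemma AngularBound.lintegral_closeSet_le_of_contDiff {b : ℝ → ℝ} {C s : ℝ}
    (hb : AngularBound b C s) {γ k : ℝ} (hγ : 0 ≤ γ) (hk : 0 ≤ k) (vs : V3) {f : V3 → ℝ}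
    (hf : ContDiff ℝ 1 f) :
    ∫⁻ q in closeSet vs, incrementDensity γ b k vs f q ∂(surfaceMeasure.prod volume) ≤
      ENNReal.ofReal (2 * 3 ^ k * 4 ^ (γ + 1)) * ENNReal.ofReal C *
        (8 * angularMass (1 / 2 + s)) * (bracketWeight (γ + 1) vs *
          ∫⁻ w, ‖fderiv ℝ f w‖ₑ * bracketWeight (γ + 1 + k) w) := by
  set c := ENNReal.ofReal (2 * 3 ^ k * 4 ^ (γ + 1)) * ENNReal.ofReal C with hc
  have hct : c ≠ ⊤ := ENNReal.mul_ne_top ENNReal.ofReal_ne_top ENNReal.ofReal_ne_top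
  have hbt : bracketWeight (γ + 1) vs ≠ ⊤ := ENNReal.ofReal_ne_top
  set F : V3 → ℝ≥0∞ := fun w => ‖fderiv ℝ f (vs + w)‖ₑ * bracketWeight (γ + 1 + k) (vs + w)
    with hF
  have hfd : Measurable (fderiv ℝ f) := (hf.continuous_fderiv one_ne_zero).measurable
  have hFm : Measurable F := by fun_prop
  have hFi : ∫⁻ w, F w = ∫⁻ w, ‖fderiv ℝ f w‖ₑ * bracketWeight (γ + 1 + k) w :=
    lintegral_add_left_eq_self (fun w => ‖fderiv ℝ f w‖ₑ * bracketWeight (γ + 1 + k) w) vs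
  have hpt : ∀ q ∈ closeSet vs, incrementDensity γ b k vs f q ≤
      ∫⁻ t in Set.Ioc (0 : ℝ) 1, c * (bracketWeight (γ + 1) vs *
        (angularWeight (1 / 2 + s) (cosDeviation q.2 q.1) * F (segmentMap t q.1 q.2))) := by
    rintro ⟨σ, z⟩ hq
    simp only [closeSet, Set.mem_ofPred_eq] at hq
    unfold incrementDensity
    simp only
    calc _ ≤ ENNReal.ofReal (productKernel γ b z σ) *
          (∫⁻ t in Set.Ioc (0 : ℝ) 1, ‖fderiv ℝ f (vs + z + t • (postVel (vs + z) vs σ -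
            (vs + z)))‖ₑ * ‖postVel (vs + z) vs σ - (vs + z)‖ₑ) *
          (bracketWeight k (vs + z) + bracketWeight k (postVel (vs + z) vs σ)) := by
          gcongr
          exact enorm_sub_le_lintegral_fderiv hf _ _
      _ = ∫⁻ t in Set.Ioc (0 : ℝ) 1, ‖fderiv ℝ f (vs + segmentMap t σ z)‖ₑ *
          (ENNReal.ofReal (productKernel γ b z σ) * ‖postVel (vs + z) vs σ - (vs + z)‖ₑ *
          (bracketWeight k (vs + z) + bracketWeight k (postVel (vs + z) vs σ))) := by
          have hM : bracketWeight k (vs + z) + bracketWeight k (postVel (vs + z) vs σ) ≠ ⊤ :=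
            ENNReal.add_ne_top.2 ⟨ENNReal.ofReal_ne_top, ENNReal.ofReal_ne_top⟩
          rw [← lintegral_const_mul' _ _ ENNReal.ofReal_ne_top, ← lintegral_mul_const' _ _ hM]
          refine lintegral_congr fun t => ?_
          rw [← segmentMap_sub, add_sub_cancel_left]
          ring
      _ ≤ _ := by
          refine setLIntegral_mono' measurableSet_Ioc fun t ht => ?_
          have h := hb.kernel_mul_weights_le_of_close hγ hk ht.1.le ht.2 hq
          rw [add_sub_cancel_left] at h
          calc _ ≤ ‖fderiv ℝ f (vs + segmentMap t σ z)‖ₑ * (c * (bracketWeight (γ + 1) vs *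
                (angularWeight (1 / 2 + s) (cosDeviation z σ) *
                bracketWeight (γ + 1 + k) (vs + segmentMap t σ z)))) := by gcongr
            _ = _ := by rw [hF]; ring
  calc _ ≤ ∫⁻ q in closeSet vs, (∫⁻ t in Set.Ioc (0 : ℝ) 1, c * (bracketWeight (γ + 1) vs *
        (angularWeight (1 / 2 + s) (cosDeviation q.2 q.1) * F (segmentMap t q.1 q.2))))
        ∂(surfaceMeasure.prod volume) := setLIntegral_mono' (measurableSet_closeSet vs) hpt
    _ ≤ ∫⁻ q : S2 × V3, (∫⁻ t in Set.Ioc (0 : ℝ) 1, c * (bracketWeight (γ + 1) vs *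
        (angularWeight (1 / 2 + s) (cosDeviation q.2 q.1) * F (segmentMap t q.1 q.2))))
        ∂(surfaceMeasure.prod volume) := setLIntegral_le_lintegral _ _
    _ = ∫⁻ t in Set.Ioc (0 : ℝ) 1, ∫⁻ q : S2 × V3, c * (bracketWeight (γ + 1) vs *
        (angularWeight (1 / 2 + s) (cosDeviation q.2 q.1) * F (segmentMap t q.1 q.2)))
        ∂(surfaceMeasure.prod volume) :=
        lintegral_lintegral_swap (Measurable.aemeasurable (by fun_prop))
    _ ≤ ∫⁻ t in Set.Ioc (0 : ℝ) 1, c * (bracketWeight (γ + 1) vs *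
          (8 * angularMass (1 / 2 + s) * ∫⁻ w, F w)) := by
        refine setLIntegral_mono' measurableSet_Ioc fun t ht => ?_
        rw [lintegral_const_mul' _ _ hct, lintegral_const_mul' _ _ hbt]
        gcongr
        exact lintegral_angularWeight_segmentMap_le (by linarith [hb.s_pos]) ht.1.le ht.2 hFm
    _ = _ := by
        rw [lintegral_const, Measure.restrict_apply_univ, Real.volume_Ioc, hFi]
        simp
        ring

/-- No regularity of `f` is needed on the complement of `closeSet`: `|f' - f|` is bounded by
`|f'| + |f|`, and the two terms are the cases `t = 1` and `t = 0` of the change of variables. -/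
lemma AngularBound.lintegral_compl_closeSet_le {b : ℝ → ℝ} {C s : ℝ}
    (hb : AngularBound b C s) {γ k : ℝ} (hγ : 0 ≤ γ) (hk : 1 ≤ k) (vs : V3) {f : V3 → ℝ}
    (hf : Measurable f) :
    ∫⁻ q in (closeSet vs)ᶜ, incrementDensity γ b k vs f q ∂(surfaceMeasure.prod volume) ≤
      ENNReal.ofReal (2 * 3 ^ k * 4 ^ (γ + k)) * ENNReal.ofReal C *
        (2 * (8 * angularMass (1 / 2 + s))) *
        (weightedMass (γ + k) f + bracketWeight (γ + k) vs * weightedMass 0 f) := by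
  set c := ENNReal.ofReal (2 * 3 ^ k * 4 ^ (γ + k)) * ENNReal.ofReal C with hc
  have hct : c ≠ ⊤ := ENNReal.mul_ne_top ENNReal.ofReal_ne_top ENNReal.ofReal_ne_top
  set F : V3 → ℝ≥0∞ := fun w => ‖f (vs + w)‖ₑ *
    (bracketWeight (γ + k) (vs + w) + bracketWeight (γ + k) vs) with hF
  have hFm : Measurable F := by fun_prop
  have hFi : ∫⁻ w, F w = weightedMass (γ + k) f + bracketWeight (γ + k) vs * weightedMass 0 f := by
    rw [hF, lintegral_add_left_eq_self (fun w => ‖f w‖ₑ *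
      (bracketWeight (γ + k) w + bracketWeight (γ + k) vs)) vs]
    simp only [mul_add]
    rw [lintegral_add_left (by fun_prop), lintegral_mul_const _ (by fun_prop), mul_comm _
      (bracketWeight (γ + k) vs)]
    simp [weightedMass, bracketWeight]
  have hpt : ∀ q ∈ (closeSet vs)ᶜ, incrementDensity γ b k vs f q ≤
      c * (angularWeight (1 / 2 + s) (cosDeviation q.2 q.1) * F (segmentMap 1 q.1 q.2) +
        angularWeight (1 / 2 + s) (cosDeviation q.2 q.1) * F (segmentMap 0 q.1 q.2)) := by
    rintro ⟨σ, z⟩ hq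
    simp only [closeSet, Set.mem_compl_iff, Set.mem_ofPred_eq, not_le] at hq
    have h1 := hb.kernel_mul_weights_le_of_far hγ hk zero_le_one le_rfl hq
    have h0 := hb.kernel_mul_weights_le_of_far hγ hk le_rfl zero_le_one hq
    rw [add_sub_cancel_left] at h1 h0
    have hp : vs + segmentMap 1 σ z = postVel (vs + z) vs σ := by
      rw [← segmentMap_one_sub, add_sub_cancel_left]
    unfold incrementDensity
    simp only
    set A := ENNReal.ofReal (productKernel γ b z σ)
    set M := bracketWeight k (vs + z) + bracketWeight k (postVel (vs + z) vs σ)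
    calc _ ≤ A * (‖f (postVel (vs + z) vs σ)‖ₑ + ‖f (vs + z)‖ₑ) * M := by
          gcongr; exact enorm_sub_le
      _ = ‖f (postVel (vs + z) vs σ)‖ₑ * (A * M) + ‖f (vs + z)‖ₑ * (A * M) := by ring
      _ ≤ ‖f (postVel (vs + z) vs σ)‖ₑ * (c * (angularWeight (1 / 2 + s) (cosDeviation z σ) *
            (bracketWeight (γ + k) (vs + segmentMap 1 σ z) + bracketWeight (γ + k) vs))) +
          ‖f (vs + z)‖ₑ * (c * (angularWeight (1 / 2 + s) (cosDeviation z σ) *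
            (bracketWeight (γ + k) (vs + segmentMap 0 σ z) + bracketWeight (γ + k) vs))) := by
          gcongr
      _ = _ := by
          simp only [hF]
          rw [← hp, segmentMap_zero]
          ring
  have hbound : ∀ t : ℝ, 0 ≤ t → t ≤ 1 → ∫⁻ q : S2 × V3, angularWeight (1 / 2 + s)
      (cosDeviation q.2 q.1) * F (segmentMap t q.1 q.2) ∂(surfaceMeasure.prod volume) ≤
      8 * angularMass (1 / 2 + s) * ∫⁻ w, F w := fun t ht0 ht1 =>
    lintegral_angularWeight_segmentMap_le (by linarith [hb.s_pos]) ht0 ht1 hFm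
  calc _ ≤ ∫⁻ q in (closeSet vs)ᶜ, c * (angularWeight (1 / 2 + s) (cosDeviation q.2 q.1) *
          F (segmentMap 1 q.1 q.2) + angularWeight (1 / 2 + s) (cosDeviation q.2 q.1) *
          F (segmentMap 0 q.1 q.2)) ∂(surfaceMeasure.prod volume) :=
        setLIntegral_mono' (measurableSet_closeSet vs).compl hpt
    _ ≤ ∫⁻ q, c * (angularWeight (1 / 2 + s) (cosDeviation q.2 q.1) *
          F (segmentMap 1 q.1 q.2) + angularWeight (1 / 2 + s) (cosDeviation q.2 q.1) *
          F (segmentMap 0 q.1 q.2)) ∂(surfaceMeasure.prod volume) := setLIntegral_le_lintegral _ _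
    _ ≤ c * (8 * angularMass (1 / 2 + s) * (∫⁻ w, F w) +
          8 * angularMass (1 / 2 + s) * ∫⁻ w, F w) := by
        rw [lintegral_const_mul' _ _ hct, lintegral_add_left (by fun_prop)]
        gcongr
        · exact hbound 1 zero_le_one le_rfl
        · exact hbound 0 le_rfl zero_le_one
    _ = _ := by rw [hFi]; ring

/-! ### Mollification of Sobolev functions -/

lemma enorm_clm_le_sum (L : V3 →L[ℝ] ℝ) :
    ‖L‖ₑ ≤ ∑ i : Fin 3, ‖L (EuclideanSpace.single i 1)‖ₑ := by
  have h : ‖L‖ ≤ ∑ i : Fin 3, ‖L (EuclideanSpace.single i 1)‖ := by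
    refine L.opNorm_le_bound (by positivity) fun v => ?_
    have hv : v = ∑ i : Fin 3, v i • EuclideanSpace.single i (1 : ℝ) := by
      simpa using ((EuclideanSpace.basisFun (Fin 3) ℝ).sum_repr v).symm
    have hL : L v = ∑ i : Fin 3, v i * L (EuclideanSpace.single i (1 : ℝ)) := by
      conv_lhs => rw [hv]
      simp [map_sum]
    rw [hL, Finset.sum_mul]
    refine (norm_sum_le _ _).trans (Finset.sum_le_sum fun i _ => ?_)
    rw [norm_mul, mul_comm]
    gcongr
    exact PiLp.norm_apply_le v i
  rw [← ofReal_norm]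
  refine (ENNReal.ofReal_le_ofReal h).trans ?_
  rw [ENNReal.ofReal_sum_of_nonneg fun i _ => norm_nonneg _]
  exact (Finset.sum_congr rfl fun i _ => ofReal_norm _).le

/-- The mollification of `h` by the normed bump function `φ`. -/
noncomputable def mollify (φ : ContDiffBump (0 : V3)) (h : V3 → ℝ) : V3 → ℝ :=
  convolution (φ.normed volume) h (ContinuousLinearMap.lsmul ℝ ℝ) volume

lemma contDiff_mollify (φ : ContDiffBump (0 : V3)) {h : V3 → ℝ}
    (hh : LocallyIntegrable h volume) : ContDiff ℝ 1 (mollify φ h) :=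
  φ.hasCompactSupport_normed.contDiff_convolution_left (n := 1) _ φ.contDiff_normed hh

lemma fderiv_mollify_apply (φ : ContDiffBump (0 : V3)) {i : Fin 3} {h g : V3 → ℝ}
    (hg : HasWeakPartial i h g) (x : V3) :
    fderiv ℝ (mollify φ h) x (EuclideanSpace.single i 1) =
      ∫ t, g t * φ.normed volume (x - t) := by
  obtain ⟨hh, -, hφ⟩ := hg
  set ρ := φ.normed (volume : Measure V3) with hρ
  have hρs : ContDiff ℝ ∞ ρ := φ.contDiff_normed
  have hρ1 : ContDiff ℝ 1 ρ := hρs.of_le (by exact_mod_cast le_top)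
  have hd : fderiv ℝ (mollify φ h) x = convolution h (fderiv ℝ ρ)
      ((ContinuousLinearMap.lsmul ℝ ℝ).flip.precompR V3) volume x := by
    rw [mollify, ← convolution_flip]
    exact (φ.hasCompactSupport_normed.hasFDerivAt_convolution_right _ hh hρ1 x).fderiv
  rw [hd, convolution_precompR_apply _ hh (φ.hasCompactSupport_normed.fderiv ℝ)
    (hρ1.continuous_fderiv one_ne_zero)]
  have hψ : ∀ t, fderiv ℝ (fun t => ρ (x - t)) t (EuclideanSpace.single i 1) =
      - fderiv ℝ ρ (x - t) (EuclideanSpace.single i 1) := by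
    intro t
    have h1 : HasFDerivAt (fun t => ρ (x - t))
        ((fderiv ℝ ρ (x - t)).comp (-ContinuousLinearMap.id ℝ V3)) t :=
      (hρ1.differentiable one_ne_zero _).hasFDerivAt.comp t ((hasFDerivAt_id t).const_sub x)
    rw [h1.fderiv]
    simp
  have hc : HasCompactSupport fun t => ρ (x - t) :=
    φ.hasCompactSupport_normed.comp_homeomorph (Homeomorph.subLeft x)
  have h2 := hφ (fun t => ρ (x - t)) (hρs.comp (contDiff_const.sub contDiff_id)) hc
  simp only [hψ, mul_neg, integral_neg, neg_inj] at h2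
  rw [← h2, convolution_def]
  refine integral_congr_ae (ae_of_all _ fun t => ?_)
  simp [mul_comm, hρ]

lemma bracketWeight_le_of_norm_sub_le {a : ℝ} (ha : 0 ≤ a) {x t : V3} (h : ‖x - t‖ ≤ 1) :
    bracketWeight a x ≤ ENNReal.ofReal (2 ^ a) * bracketWeight a t := by
  rw [bracketWeight, bracketWeight, ← ENNReal.ofReal_mul (by positivity),
    ← Real.mul_rpow (by norm_num) (bracket_pos t).le]
  refine ENNReal.ofReal_le_ofReal (Real.rpow_le_rpow (bracket_pos x).le ?_ ha)
  linarith [bracket_le_add x t, one_le_bracket t]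

lemma lintegral_normed (φ : ContDiffBump (0 : V3)) :
    ∫⁻ x, ENNReal.ofReal (φ.normed volume x) = 1 := by
  rw [← ofReal_integral_eq_lintegral_ofReal φ.integrable_normed
    (ae_of_all _ fun x => φ.nonneg_normed x), φ.integral_normed, ENNReal.ofReal_one]

/-- Mollification at scale at most `1` preserves the weighted norms up to a constant. -/
lemma lintegral_mollified_mul_weight_le {φ : ContDiffBump (0 : V3)} (hφ : φ.rOut ≤ 1) {a : ℝ}
    (ha : 0 ≤ a) {g : V3 → ℝ} (hg : AEMeasurable g volume) :
    ∫⁻ x, (∫⁻ t, ‖g t‖ₑ * ENNReal.ofReal (φ.normed volume (x - t))) * bracketWeight a x ≤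
      ENNReal.ofReal (2 ^ a) * weightedMass a g := by
  have hφm : Measurable (φ.normed (volume : Measure V3)) := φ.continuous_normed.measurable
  have hw : ∀ x, bracketWeight a x ≠ ⊤ := fun x => ENNReal.ofReal_ne_top
  calc ∫⁻ x, (∫⁻ t, ‖g t‖ₑ * ENNReal.ofReal (φ.normed volume (x - t))) * bracketWeight a x
      = ∫⁻ x, ∫⁻ t, ‖g t‖ₑ * ENNReal.ofReal (φ.normed volume (x - t)) * bracketWeight a x :=
        lintegral_congr fun x => (lintegral_mul_const' _ _ (hw x)).symm
    _ = ∫⁻ t, ∫⁻ x, ‖g t‖ₑ * ENNReal.ofReal (φ.normed volume (x - t)) * bracketWeight a x := by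
        refine lintegral_lintegral_swap ?_
        have h1 : AEMeasurable (fun p : V3 × V3 => ‖g p.2‖ₑ) (volume.prod volume) :=
          hg.enorm.comp_quasiMeasurePreserving Measure.quasiMeasurePreserving_snd
        refine (h1.mul (Measurable.aemeasurable ?_)).mul (Measurable.aemeasurable ?_) <;> fun_prop
    _ ≤ ∫⁻ t, ∫⁻ x, (‖g t‖ₑ * (ENNReal.ofReal (2 ^ a) * bracketWeight a t)) *
          ENNReal.ofReal (φ.normed volume (x - t)) := by
        refine lintegral_mono fun t => lintegral_mono fun x => ?_
        by_cases hx : φ.normed volume (x - t) = 0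
        · simp [hx]
        · have hx' : x - t ∈ Function.support (φ.normed volume) := hx
          rw [φ.support_normed_eq, mem_ball_zero_iff] at hx'
          calc _ = ‖g t‖ₑ * bracketWeight a x * ENNReal.ofReal (φ.normed volume (x - t)) := by ring
            _ ≤ _ := by
              gcongr
              exact bracketWeight_le_of_norm_sub_le ha (hx'.le.trans hφ)
    _ = ∫⁻ t, ENNReal.ofReal (2 ^ a) * (‖g t‖ₑ * bracketWeight a t) := by
        refine lintegral_congr fun t => ?_
        rw [lintegral_const_mul _ (by fun_prop), lintegral_sub_right_eq_self
          (fun x => ENNReal.ofReal (φ.normed volume x)) t, lintegral_normed]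
        ring
    _ = _ := lintegral_const_mul' _ _ ENNReal.ofReal_ne_top

lemma lintegral_fderiv_mollify_le {φ : ContDiffBump (0 : V3)} (hφ : φ.rOut ≤ 1) {a : ℝ}
    (ha : 0 ≤ a) {h : V3 → ℝ} {g : Fin 3 → V3 → ℝ} (hg : ∀ i, HasWeakPartial i h (g i)) :
    ∫⁻ w, ‖fderiv ℝ (mollify φ h) w‖ₑ * bracketWeight a w ≤
      ENNReal.ofReal (2 ^ a) * ∑ i, weightedMass a (g i) := by
  have hfm : Measurable (fderiv ℝ (mollify φ h)) :=
    ((contDiff_mollify φ (hg 0).1).continuous_fderiv one_ne_zero).measurable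
  calc _ ≤ ∫⁻ w, ∑ i, ‖fderiv ℝ (mollify φ h) w (EuclideanSpace.single i 1)‖ₑ *
          bracketWeight a w := by
        refine lintegral_mono fun w => ?_
        rw [← Finset.sum_mul]
        gcongr
        exact enorm_clm_le_sum _
    _ = ∑ i, ∫⁻ w, ‖fderiv ℝ (mollify φ h) w (EuclideanSpace.single i 1)‖ₑ *
          bracketWeight a w := by
        refine lintegral_finsetSum _ fun i _ => ?_
        have := hfm.apply_continuousLinearMap (EuclideanSpace.single i (1 : ℝ))
        fun_prop
    _ ≤ ∑ i, ENNReal.ofReal (2 ^ a) * weightedMass a (g i) := by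
        refine Finset.sum_le_sum fun i _ => ?_
        refine le_trans ?_ (lintegral_mollified_mul_weight_le hφ ha
          (hg i).2.1.aestronglyMeasurable.aemeasurable)
        refine lintegral_mono fun w => ?_
        gcongr
        rw [fderiv_mollify_apply φ (hg i)]
        refine (enorm_integral_le_lintegral_enorm _).trans_eq (lintegral_congr fun t => ?_)
        rw [enorm_mul, Real.enorm_of_nonneg (φ.nonneg_normed _)]
    _ = _ := (Finset.mul_sum _ _ _).symm

/-- Smooth approximation: almost everywhere convergence with bounded weighted gradients. -/
lemma exists_contDiff_approx {a : ℝ} (ha : 0 ≤ a) {h : V3 → ℝ} {g : Fin 3 → V3 → ℝ}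
    (hg : ∀ i, HasWeakPartial i h (g i)) :
    ∃ f : ℕ → V3 → ℝ, (∀ n, ContDiff ℝ 1 (f n)) ∧
      (∀ᵐ x, Filter.Tendsto (fun n => f n x) Filter.atTop (nhds (h x))) ∧
      ∀ n, ∫⁻ w, ‖fderiv ℝ (f n) w‖ₑ * bracketWeight a w ≤
        ENNReal.ofReal (2 ^ a) * ∑ i, weightedMass a (g i) := by
  let φ : ℕ → ContDiffBump (0 : V3) := fun n =>
    { rIn := 1 / ((n : ℝ) + 1) / 2
      rOut := 1 / ((n : ℝ) + 1)
      rIn_pos := by positivity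
      rIn_lt_rOut := half_lt_self (by positivity) }
  have hφ : ∀ n, (φ n).rOut ≤ 1 := fun n => by
    change 1 / ((n : ℝ) + 1) ≤ 1
    rw [div_le_one (by positivity)]
    linarith [n.cast_nonneg (α := ℝ)]
  refine ⟨fun n => mollify (φ n) h, fun n => contDiff_mollify _ (hg 0).1, ?_, fun n =>
    lintegral_fderiv_mollify_le (hφ n) ha hg⟩
  refine ContDiffBump.ae_convolution_tendsto_right_of_locallyIntegrable (K := 2)
    tendsto_one_div_add_atTop_nhds_zero_nat (Filter.Eventually.of_forall fun n => ?_) (hg 0).1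
  change 1 / ((n : ℝ) + 1) ≤ 2 * (1 / ((n : ℝ) + 1) / 2)
  linarith

/-! ### Weighted increments of a Sobolev function -/

/-- For fixed `v_*`, the map to the post-collisional velocity is nonsingular on the support of the
kernel. -/
lemma AngularBound.ae_postVel {b : ℝ → ℝ} {C s : ℝ} (hb : AngularBound b C s) (vs : V3)
    {P : V3 → Prop} (hP : ∀ᵐ v, P v) :
    ∀ᵐ q : S2 × V3 ∂(surfaceMeasure.prod volume),
      b (cosDeviation q.2 q.1) ≠ 0 → P (postVel (vs + q.2) vs q.1) := by
  obtain ⟨N, hN, hNm, hN0⟩ := exists_measurable_superset_of_null hP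
  have hF : Measurable fun w : V3 => N.indicator (1 : V3 → ℝ≥0∞) (vs + w) :=
    (measurable_one.indicator hNm).comp (by fun_prop)
  have h := lintegral_angularWeight_segmentMap_le (p := 0) le_rfl zero_le_one le_rfl hF
  rw [lintegral_add_left_eq_self (N.indicator (1 : V3 → ℝ≥0∞)) vs, lintegral_indicator_one hNm, hN0,
    mul_zero, nonpos_iff_eq_zero, lintegral_eq_zero_iff (by fun_prop)] at h
  filter_upwards [h] with q hq hbq
  have hy := hb.cosDeviation_nonneg hbq
  have h1 : angularWeight 0 (cosDeviation q.2 q.1) = 1 := by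
    rw [angularWeight, if_pos hy]; simp
  have hp : vs + segmentMap 1 q.1 q.2 = postVel (vs + q.2) vs q.1 := by
    rw [← segmentMap_one_sub, add_sub_cancel_left]
  simp only [h1, one_mul, Pi.zero_apply, hp, Set.indicator_apply_eq_zero, Pi.one_apply,
    one_ne_zero, imp_false] at hq
  by_contra hcon
  exact hq (hN hcon)

lemma ae_add_snd (vs : V3) {P : V3 → Prop} (hP : ∀ᵐ v, P v) :
    ∀ᵐ q : S2 × V3 ∂(surfaceMeasure.prod volume), P (vs + q.2) := by
  have h1 : Measure.QuasiMeasurePreserving (fun q : S2 × V3 => vs + q.2)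
      (surfaceMeasure.prod volume) volume :=
    (measurePreserving_add_left volume vs).quasiMeasurePreserving.comp
      Measure.quasiMeasurePreserving_snd
  exact h1.ae hP

/-- The gradient estimate passes from smooth to Sobolev functions by Fatou's lemma. -/
lemma AngularBound.lintegral_closeSet_le {b : ℝ → ℝ} {C s : ℝ}
    (hb : AngularBound b C s) {γ k : ℝ} (hγ : 0 ≤ γ) (hk : 0 ≤ k) (vs : V3) {h : V3 → ℝ}
    {g : Fin 3 → V3 → ℝ} (hg : ∀ i, HasWeakPartial i h (g i)) :
    ∫⁻ q in closeSet vs, incrementDensity γ b k vs h q ∂(surfaceMeasure.prod volume) ≤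
      ENNReal.ofReal (2 * 3 ^ k * 4 ^ (γ + 1)) * ENNReal.ofReal C *
        (8 * angularMass (1 / 2 + s)) * (bracketWeight (γ + 1) vs *
          (ENNReal.ofReal (2 ^ (γ + 1 + k)) * ∑ i, weightedMass (γ + 1 + k) (g i))) := by
  obtain ⟨f, hf, hlim, hbound⟩ := exists_contDiff_approx (a := γ + 1 + k) (by linarith) hg
  have hlim2 := hb.ae_postVel vs hlim
  have hlim1 := ae_add_snd vs hlim
  have hpt : ∀ᵐ q ∂((surfaceMeasure.prod volume).restrict (closeSet vs)),
      incrementDensity γ b k vs h q ≤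
        Filter.liminf (fun n => incrementDensity γ b k vs (f n) q) Filter.atTop := by
    refine ae_restrict_of_ae ?_
    filter_upwards [hlim1, hlim2] with q h1 h2
    by_cases hbq : b (cosDeviation q.2 q.1) = 0
    · unfold incrementDensity
      rw [productKernel_eq, hbq]
      simp
    · refine (Filter.Tendsto.liminf_eq ?_).ge
      unfold incrementDensity
      have hM : bracketWeight k (vs + q.2) + bracketWeight k (postVel (vs + q.2) vs q.1) ≠ ⊤ :=
        ENNReal.add_ne_top.2 ⟨ENNReal.ofReal_ne_top, ENNReal.ofReal_ne_top⟩
      refine ENNReal.Tendsto.mul_const (ENNReal.Tendsto.const_mul ?_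
        (Or.inr ENNReal.ofReal_ne_top)) (Or.inr hM)
      exact (continuous_enorm.tendsto _).comp ((h2 hbq).sub h1)
  calc _ ≤ ∫⁻ q in closeSet vs, Filter.liminf (fun n => incrementDensity γ b k vs (f n) q)
          Filter.atTop ∂(surfaceMeasure.prod volume) := lintegral_mono_ae hpt
    _ ≤ Filter.liminf (fun n => ∫⁻ q in closeSet vs, incrementDensity γ b k vs (f n) q
          ∂(surfaceMeasure.prod volume)) Filter.atTop :=
        lintegral_liminf_le fun n => measurable_incrementDensity hb.measurable k vs
          (hf n).continuous.measurable
    _ ≤ _ := by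
        refine Filter.liminf_le_of_le (by isBoundedDefault) fun c hc => ?_
        obtain ⟨n, hn⟩ := hc.exists
        refine hn.trans ((hb.lintegral_closeSet_le_of_contDiff hγ hk vs (hf n)).trans ?_)
        gcongr
        exact hbound n

lemma AngularBound.exists_lintegral_incrementDensity_le {b : ℝ → ℝ} {C s : ℝ}
    (hb : AngularBound b C s) {γ k : ℝ} (hγ : 0 ≤ γ) (hk : 1 ≤ k) :
    ∃ K : ℝ≥0∞, K ≠ ⊤ ∧ ∀ (h : V3 → ℝ) (g : Fin 3 → V3 → ℝ), Measurable h →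
      (∀ i, HasWeakPartial i h (g i)) → ∀ vs : V3,
      ∫⁻ q, incrementDensity γ b k vs h q ∂(surfaceMeasure.prod volume) ≤
        K * (bracketWeight (γ + 1) vs * (∑ i, weightedMass (γ + 1 + k) (g i)) +
          (weightedMass (γ + k) h + bracketWeight (γ + k) vs * weightedMass 0 h)) := by
  have hA : angularMass (1 / 2 + s) ≠ ⊤ := (angularMass_lt_top (by linarith [hb.s_lt])).ne
  have hA8 : 8 * angularMass (1 / 2 + s) ≠ ⊤ := ENNReal.mul_ne_top (by simp) hA
  set K1 := ENNReal.ofReal (2 * 3 ^ k * 4 ^ (γ + 1)) * ENNReal.ofReal C *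
        (8 * angularMass (1 / 2 + s)) * ENNReal.ofReal (2 ^ (γ + 1 + k)) with hK1
  set K2 := ENNReal.ofReal (2 * 3 ^ k * 4 ^ (γ + k)) * ENNReal.ofReal C *
        (2 * (8 * angularMass (1 / 2 + s))) with hK2
  have hK1t : K1 ≠ ⊤ := ENNReal.mul_ne_top (ENNReal.mul_ne_top (ENNReal.mul_ne_top
    ENNReal.ofReal_ne_top ENNReal.ofReal_ne_top) hA8) ENNReal.ofReal_ne_top
  have hK2t : K2 ≠ ⊤ := ENNReal.mul_ne_top (ENNReal.mul_ne_top
    ENNReal.ofReal_ne_top ENNReal.ofReal_ne_top) (ENNReal.mul_ne_top (by simp) hA8)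
  refine ⟨K1 + K2, ENNReal.add_ne_top.2 ⟨hK1t, hK2t⟩, fun h g hm hg vs => ?_⟩
  rw [← lintegral_add_compl _ (measurableSet_closeSet vs), mul_add]
  refine add_le_add ?_ ?_
  · refine (hb.lintegral_closeSet_le hγ (by linarith) vs hg).trans ?_
    calc _ = K1 * (bracketWeight (γ + 1) vs * ∑ i, weightedMass (γ + 1 + k) (g i)) := by
          rw [hK1]; ring
      _ ≤ _ := by gcongr; exact le_self_add
  · refine (hb.lintegral_compl_closeSet_le hγ hk vs hm).trans ?_
    rw [← hK2]
    gcongr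
    exact le_add_self

/-- The integrand `|h_*| B |h' - h| (⟨v⟩^k + ⟨v'⟩^k)`. -/
noncomputable def weightedIncrement (γ : ℝ) (b : ℝ → ℝ) (k : ℝ) (h : V3 → ℝ) (v vs : V3) (σ : S2) :
    ℝ≥0∞ :=
  ‖h vs‖ₑ * (ENNReal.ofReal (productKernel γ b (v - vs) σ) *
    ‖h (postVel v vs σ) - h v‖ₑ * (bracketWeight k v + bracketWeight k (postVel v vs σ)))

/-- The total weighted increment `∫∫∫ B |h_*| |h' - h| (⟨v⟩^k + ⟨v'⟩^k) dσ dv_* dv`. -/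
noncomputable def totalIncrement (γ : ℝ) (b : ℝ → ℝ) (k : ℝ) (h : V3 → ℝ) : ℝ≥0∞ :=
  ∫⁻ v, ∫⁻ vs, ∫⁻ σ, weightedIncrement γ b k h v vs σ ∂surfaceMeasure

lemma totalIncrement_eq {γ : ℝ} {b : ℝ → ℝ} (hb : Measurable b) (k : ℝ) {h : V3 → ℝ}
    (hm : Measurable h) :
    totalIncrement γ b k h = ∫⁻ vs, ‖h vs‖ₑ *
      ∫⁻ q, incrementDensity γ b k vs h q ∂(surfaceMeasure.prod volume) := by
  have hB : Measurable fun p : (V3 × V3) × S2 => productKernel γ b (p.1.1 - p.1.2) p.2 :=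
    hb.productKernel (by fun_prop) (by fun_prop)
  have hF : Measurable fun p : (V3 × V3) × S2 => ‖h p.1.2‖ₑ *
      (ENNReal.ofReal (productKernel γ b (p.1.1 - p.1.2) p.2) *
      ‖h (postVel p.1.1 p.1.2 p.2) - h p.1.1‖ₑ *
      (bracketWeight k p.1.1 + bracketWeight k (postVel p.1.1 p.1.2 p.2))) := by
    fun_prop
  simp only [totalIncrement, weightedIncrement]
  rw [lintegral_lintegral_swap hF.lintegral_prod_right'.aemeasurable]
  refine lintegral_congr fun vs => ?_
  have hF' : Measurable fun p : V3 × S2 => ‖h vs‖ₑ *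
      (ENNReal.ofReal (productKernel γ b (p.1 - vs) p.2) *
      ‖h (postVel p.1 vs p.2) - h p.1‖ₑ *
      (bracketWeight k p.1 + bracketWeight k (postVel p.1 vs p.2))) :=
    hF.comp (f := fun p : V3 × S2 => ((p.1, vs), p.2)) (by fun_prop)
  have hI := measurable_incrementDensity (γ := γ) hb k vs hm
  rw [lintegral_lintegral_swap hF'.aemeasurable, ← lintegral_const_mul _ hI,
    lintegral_prod _ (by fun_prop)]
  refine lintegral_congr fun σ => ?_
  rw [← lintegral_add_left_eq_self _ vs]
  refine lintegral_congr fun z => ?_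
  rw [incrementDensity, add_sub_cancel_left]

lemma AngularBound.exists_totalIncrement_le {b : ℝ → ℝ} {C s : ℝ}
    (hb : AngularBound b C s) {γ k : ℝ} (hγ : 0 ≤ γ) (hk : 1 ≤ k) :
    ∃ K : ℝ≥0∞, K ≠ ⊤ ∧ ∀ (h : V3 → ℝ) (g : Fin 3 → V3 → ℝ), Measurable h →
      (∀ i, HasWeakPartial i h (g i)) →
      totalIncrement γ b k h ≤ K * (weightedMass (γ + k) h * weightedMass k h +
          weightedMass (γ + 1) h * ∑ i, weightedMass (γ + 1 + k) (g i)) := by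
  obtain ⟨K, hK, hle⟩ := hb.exists_lintegral_incrementDensity_le hγ hk
  refine ⟨2 * K, ENNReal.mul_ne_top (by simp) hK, fun h g hm hg => ?_⟩
  rw [totalIncrement_eq hb.measurable k hm]
  set G := ∑ i, weightedMass (γ + 1 + k) (g i)
  have h0 : weightedMass 0 h = ∫⁻ v, ‖h v‖ₑ := by simp [weightedMass, bracketWeight]
  calc _ ≤ ∫⁻ vs, ‖h vs‖ₑ * (K * (bracketWeight (γ + 1) vs * G +
          (weightedMass (γ + k) h + bracketWeight (γ + k) vs * weightedMass 0 h))) := by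
        refine lintegral_mono fun vs => ?_
        gcongr
        exact hle h g hm hg vs
    _ = ∫⁻ vs, K * ((‖h vs‖ₑ * bracketWeight (γ + 1) vs) * G +
          (‖h vs‖ₑ * weightedMass (γ + k) h + (‖h vs‖ₑ * bracketWeight (γ + k) vs) *
            weightedMass 0 h)) := lintegral_congr fun vs => by ring
    _ = K * (weightedMass (γ + 1) h * G +
          (weightedMass 0 h * weightedMass (γ + k) h + weightedMass (γ + k) h *
            weightedMass 0 h)) := by
        rw [lintegral_const_mul _ (by fun_prop), lintegral_add_left (by fun_prop),
          lintegral_add_left (by fun_prop), lintegral_mul_const _ (by fun_prop),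
          lintegral_mul_const _ (by fun_prop), lintegral_mul_const _ (by fun_prop), ← h0]
        rfl
    _ ≤ K * ((2 * (weightedMass (γ + 1) h * G)) +
          (weightedMass k h * weightedMass (γ + k) h + weightedMass (γ + k) h *
            weightedMass k h)) := by
        have : weightedMass 0 h ≤ weightedMass k h := weightedMass_mono (by linarith) h
        refine mul_le_mul_right (add_le_add ?_ (by gcongr)) _
        exact le_mul_of_one_le_left' one_le_two
    _ = _ := by ring

/-! ### The change of variables `v_* ↦ v'_*` -/

/-- The angular weight obtained from `β(cos θ)` by the change of variables `v_* ↦ v'_*`, as a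
function of `x = cos (θ/2)`. -/
noncomputable def halfAngleWeight (γ : ℝ) (β : ℝ → ℝ≥0∞) (x : ℝ) : ℝ≥0∞ :=
  if 0 < x then ENNReal.ofReal (4 * x ^ (-γ - 2)) * β (2 * x ^ 2 - 1) else 0

lemma measurable_halfAngleWeight (γ : ℝ) {β : ℝ → ℝ≥0∞} (hβ : Measurable β) :
    Measurable (halfAngleWeight γ β) :=
  Measurable.ite measurableSet_Ioi (by fun_prop) measurable_const

@[fun_prop]
lemma Measurable.halfAngleWeight {α : Type*} [MeasurableSpace α] {γ : ℝ} {β : ℝ → ℝ≥0∞}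
    (hβ : Measurable β) {f : α → ℝ} (hf : Measurable f) :
    Measurable fun x => halfAngleWeight γ β (f x) :=
  (measurable_halfAngleWeight γ hβ).comp hf

lemma inner_segmentMap_one (σ : S2) (z : V3) :
    inner ℝ (segmentMap 1 σ z) (σ : V3) = ‖z‖ * ((1 + cosDeviation z σ) / 2) := by
  rw [segmentMap, inner_add_left, inner_smul_left, inner_smul_left, ← norm_mul_cosDeviation,
    real_inner_self_eq_norm_sq, norm_coe_sphere]
  simp only [conj_trivial]
  ring

lemma norm_segmentMap_one_sq (σ : S2) (z : V3) :
    ‖segmentMap 1 σ z‖ ^ 2 = ‖z‖ ^ 2 * ((1 + cosDeviation z σ) / 2) := by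
  rw [segmentMap, norm_add_sq_real, inner_smul_left, inner_smul_right, norm_smul, norm_smul,
    norm_coe_sphere, ← norm_mul_cosDeviation, mul_one, mul_pow, Real.norm_eq_abs, Real.norm_eq_abs,
    sq_abs, sq_abs]
  simp only [conj_trivial]
  ring

/-- The map `z ↦ (z + |z| σ)/2` halves the angle with `σ`. -/
lemma cosDeviation_segmentMap_one {σ : S2} {z : V3} (hz : z ≠ 0) (hy : 0 ≤ cosDeviation z σ) :
    0 < cosDeviation (segmentMap 1 σ z) σ ∧
    cosDeviation (segmentMap 1 σ z) σ ^ 2 = (1 + cosDeviation z σ) / 2 ∧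
    ‖segmentMap 1 σ z‖ = ‖z‖ * cosDeviation (segmentMap 1 σ z) σ := by
  have hzp := norm_pos_iff.2 hz
  have hi := inner_segmentMap_one σ z
  have hn := norm_segmentMap_one_sq σ z
  set w := segmentMap 1 σ z
  set y := cosDeviation z σ
  have hw : 0 < ‖w‖ := by
    have : 0 < ‖w‖ ^ 2 := by rw [hn]; positivity
    exact lt_of_le_of_ne (norm_nonneg w) fun h => by simp [← h] at this
  have hx := cosDeviation_eq_div w σ
  rw [hi] at hx
  have hx2 : cosDeviation w σ ^ 2 = (1 + y) / 2 := by
    rw [hx, div_pow, hn]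
    field_simp
  refine ⟨by rw [hx]; positivity, hx2, ?_⟩
  rw [hx, eq_comm, ← mul_div_assoc, div_eq_iff hw.ne', ← pow_two, hn]
  ring

lemma mem_image_segmentMap_one {σ : S2} {w : V3} (hx : 0 < cosDeviation w σ)
    (hx2 : 0 ≤ 2 * cosDeviation w σ ^ 2 - 1) : w ∈ segmentMap 1 σ '' forwardCone σ := by
  have hw0 : w ≠ 0 := by
    rintro rfl
    simp [cosDeviation] at hx
  have hw := norm_pos_iff.2 hw0
  have hi := norm_mul_cosDeviation w σ
  set x := cosDeviation w σ
  set i := inner ℝ w (σ : V3)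
  have hip : 0 < i := by rw [← hi]; positivity
  set z := (2 : ℝ) • w - (‖w‖ ^ 2 / i) • (σ : V3) with hz
  have hnz : ‖z‖ = ‖w‖ ^ 2 / i := by
    have : ‖z‖ ^ 2 = (‖w‖ ^ 2 / i) ^ 2 := by
      rw [hz, norm_sub_sq_real, inner_smul_left, inner_smul_right, norm_smul, norm_smul,
        norm_coe_sphere, mul_one, mul_pow, Real.norm_eq_abs, Real.norm_eq_abs, sq_abs, sq_abs]
      simp only [conj_trivial]
      change 2 ^ 2 * ‖w‖ ^ 2 - 2 * (2 * (‖w‖ ^ 2 / i * i)) + (‖w‖ ^ 2 / i) ^ 2 = _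
      rw [div_mul_cancel₀ _ hip.ne']
      ring
    exact (sq_eq_sq₀ (norm_nonneg _) (by positivity)).1 this
  refine ⟨z, ⟨?_, ?_⟩, ?_⟩
  · rw [← norm_pos_iff, hnz]; positivity
  · rw [hz, inner_sub_left, inner_smul_left, inner_smul_left, real_inner_self_eq_norm_sq,
      norm_coe_sphere]
    simp only [conj_trivial]
    change 0 ≤ 2 * i - ‖w‖ ^ 2 / i * 1 ^ 2
    have : 2 * i - ‖w‖ ^ 2 / i * 1 ^ 2 = ‖w‖ ^ 2 * (2 * x ^ 2 - 1) / i := by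
      rw [← hi]
      field_simp
    rw [this]
    positivity
  · rw [segmentMap, hnz, hz]
    module

/-- The change of variables `w = (z + |z| σ)/2`, with the exact Jacobian `(1 + cos θ)/8`. -/
lemma lintegral_comp_segmentMap_one (γ : ℝ) {β : ℝ → ℝ≥0∞} (hβ0 : ∀ x < 0, β x = 0) (σ : S2)
    (F : V3 → ℝ≥0∞) :
    ∫⁻ z, ENNReal.ofReal (‖z‖ ^ γ) * β (cosDeviation z σ) * F (segmentMap 1 σ z) =
      ∫⁻ w, ENNReal.ofReal (‖w‖ ^ γ) * halfAngleWeight γ β (cosDeviation w σ) * F w := by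
  have himg := lintegral_image_eq_lintegral_abs_det_fderiv_mul volume (measurableSet_forwardCone σ)
    (fun z hz => (hasFDerivAt_segmentMap 1 σ hz.1).hasFDerivWithinAt)
    (injOn_segmentMap zero_le_one le_rfl σ)
    (fun w => ENNReal.ofReal (‖w‖ ^ γ) * halfAngleWeight γ β (cosDeviation w σ) * F w)
  have hL : ∫⁻ z, ENNReal.ofReal (‖z‖ ^ γ) * β (cosDeviation z σ) * F (segmentMap 1 σ z) =
      ∫⁻ z in forwardCone σ,
        ENNReal.ofReal (‖z‖ ^ γ) * β (cosDeviation z σ) * F (segmentMap 1 σ z) := by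
    rw [← lintegral_indicator (measurableSet_forwardCone σ)]
    refine lintegral_congr_ae ?_
    filter_upwards [Measure.ae_ne volume (0 : V3)] with z hz
    by_cases h : z ∈ forwardCone σ
    · rw [Set.indicator_of_mem h]
    · rw [Set.indicator_of_notMem h, hβ0, mul_zero, zero_mul]
      by_contra! h'
      exact h ⟨hz, (cosDeviation_nonneg_iff hz σ).1 h'⟩
  have hmi : MeasurableSet (segmentMap 1 σ '' forwardCone σ) :=
    measurable_image_of_fderivWithin (measurableSet_forwardCone σ)
      (fun z hz => (hasFDerivAt_segmentMap 1 σ hz.1).hasFDerivWithinAt)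
      (injOn_segmentMap zero_le_one le_rfl σ)
  have hR : ∫⁻ w, ENNReal.ofReal (‖w‖ ^ γ) * halfAngleWeight γ β (cosDeviation w σ) * F w =
      ∫⁻ w in segmentMap 1 σ '' forwardCone σ,
        ENNReal.ofReal (‖w‖ ^ γ) * halfAngleWeight γ β (cosDeviation w σ) * F w := by
    rw [← lintegral_indicator hmi]
    refine lintegral_congr fun w => ?_
    by_cases h : w ∈ segmentMap 1 σ '' forwardCone σ
    · rw [Set.indicator_of_mem h]
    · rw [Set.indicator_of_notMem h]
      have : halfAngleWeight γ β (cosDeviation w σ) = 0 := by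
        unfold halfAngleWeight
        split_ifs with hx
        · rw [hβ0, mul_zero]
          by_contra! h'
          exact h (mem_image_segmentMap_one hx h')
        · rfl
      rw [this, mul_zero, zero_mul]
  rw [hL, hR, himg]
  refine setLIntegral_congr_fun (measurableSet_forwardCone σ) fun z hz => ?_
  have hy := (cosDeviation_nonneg_iff hz.1 σ).2 hz.2
  obtain ⟨hx0, hx2, hn⟩ := cosDeviation_segmentMap_one hz.1 hy
  set x := cosDeviation (segmentMap 1 σ z) σ
  have hdet : |(segmentMapDeriv 1 σ z).det| = x ^ 2 / 4 := by
    rw [det_segmentMapDeriv le_rfl, hx2, abs_of_nonneg (by positivity)]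
    ring
  have hr : ENNReal.ofReal (‖z‖ ^ γ) = ENNReal.ofReal |(segmentMapDeriv 1 σ z).det| *
      (ENNReal.ofReal (‖segmentMap 1 σ z‖ ^ γ) * ENNReal.ofReal (4 * x ^ (-γ - 2))) := by
    rw [hdet, ← ENNReal.ofReal_mul (by positivity), ← ENNReal.ofReal_mul (by positivity), hn,
      Real.mul_rpow (norm_nonneg _) hx0.le]
    congr 1
    have : x ^ γ * x ^ (-γ - 2) * x ^ 2 = 1 := by
      rw [← Real.rpow_natCast x 2, ← Real.rpow_add hx0, ← Real.rpow_add hx0]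
      convert Real.rpow_zero x using 2
      push_cast
      ring
    linear_combination (-‖z‖ ^ γ) * this
  have hβx : halfAngleWeight γ β x =
      ENNReal.ofReal (4 * x ^ (-γ - 2)) * β (cosDeviation z σ) := by
    rw [halfAngleWeight, if_pos hx0, hx2]
    congr 2
    ring
  simp only [hβx, hr]
  ring

/-- The change of variables `v_* ↦ v'_*`, integrated over the sphere. -/
lemma lintegral_kernel_postVelStar (γ : ℝ) {β : ℝ → ℝ≥0∞} (hβ : Measurable β)
    (hβ0 : ∀ x < 0, β x = 0) (v : V3) {F : V3 → ℝ≥0∞} (hF : Measurable F) :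
    ∫⁻ p : V3 × S2, ENNReal.ofReal (‖v - p.1‖ ^ γ) * β (cosDeviation (v - p.1) p.2) *
        F (postVelStar v p.1 p.2) ∂(volume.prod surfaceMeasure) =
      (ENNReal.ofReal (2 * Real.pi) * ∫⁻ t in Set.Ioo (-1 : ℝ) 1, halfAngleWeight γ β t) *
        ∫⁻ vs, ENNReal.ofReal (‖v - vs‖ ^ γ) * F vs := by
  have e1 : ∀ σ : S2, ∫⁻ vs, ENNReal.ofReal (‖v - vs‖ ^ γ) * β (cosDeviation (v - vs) σ) *
      F (postVelStar v vs σ) =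
      ∫⁻ w, ENNReal.ofReal (‖w‖ ^ γ) * halfAngleWeight γ β (cosDeviation w σ) * F (v - w) := by
    intro σ
    rw [← lintegral_comp_segmentMap_one γ hβ0 σ (fun w => F (v - w)),
      ← lintegral_sub_left_eq_self _ v]
    refine lintegral_congr fun vs => ?_
    rw [sub_sub_cancel, ← segmentMap_one_sub', sub_sub_cancel]
  have hm : Measurable fun p : V3 × S2 => ENNReal.ofReal (‖v - p.1‖ ^ γ) *
      β (cosDeviation (v - p.1) p.2) * F (postVelStar v p.1 p.2) := by fun_prop
  rw [lintegral_prod _ hm.aemeasurable, lintegral_lintegral_swap hm.aemeasurable,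
    lintegral_congr e1, lintegral_lintegral_swap (Measurable.aemeasurable (by fun_prop)),
    ← lintegral_sub_left_eq_self (fun vs => ENNReal.ofReal (‖v - vs‖ ^ γ) * F vs) v,
    ← lintegral_const_mul _ (by fun_prop)]
  refine lintegral_congr_ae ?_
  filter_upwards [Measure.ae_ne volume (0 : V3)] with w hw
  rw [lintegral_mul_const _ (by fun_prop), lintegral_const_mul _ (by fun_prop),
    lintegral_cosDeviation (measurable_halfAngleWeight γ hβ) hw, sub_sub_cancel]
  ring

lemma lintegral_kernel_star (γ : ℝ) {β : ℝ → ℝ≥0∞} (hβ : Measurable β) (v : V3) {F : V3 → ℝ≥0∞}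
    (hF : Measurable F) :
    ∫⁻ p : V3 × S2, ENNReal.ofReal (‖v - p.1‖ ^ γ) * β (cosDeviation (v - p.1) p.2) *
        F p.1 ∂(volume.prod surfaceMeasure) =
      (ENNReal.ofReal (2 * Real.pi) * ∫⁻ t in Set.Ioo (-1 : ℝ) 1, β t) *
        ∫⁻ vs, ENNReal.ofReal (‖v - vs‖ ^ γ) * F vs := by
  rw [lintegral_prod _ (Measurable.aemeasurable (by fun_prop)), ← lintegral_const_mul _
    (by fun_prop)]
  refine lintegral_congr_ae ?_
  filter_upwards [Measure.ae_ne volume v] with vs hvs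
  rw [lintegral_mul_const _ (by fun_prop), lintegral_const_mul _ (by fun_prop),
    lintegral_cosDeviation hβ (sub_ne_zero.2 hvs.symm)]
  ring

/-- The substitution `y = 2 x² - 1`, that is, `cos θ = 2 cos² (θ/2) - 1`. -/
lemma lintegral_halfAngleWeight (γ : ℝ) (β : ℝ → ℝ≥0∞) :
    ∫⁻ t in Set.Ioo (-1 : ℝ) 1, halfAngleWeight γ β t =
      ∫⁻ y in Set.Ioo (-1 : ℝ) 1, β y * ENNReal.ofReal (((1 + y) / 2) ^ (-(γ + 3) / 2)) := by
  have himg : (fun x : ℝ => 2 * x ^ 2 - 1) '' Set.Ioo 0 1 = Set.Ioo (-1) 1 := by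
    refine Set.Subset.antisymm ?_ fun y hy => ⟨√((1 + y) / 2), ⟨?_, ?_⟩, ?_⟩
    · rintro _ ⟨x, hx, rfl⟩
      constructor <;> nlinarith [hx.1, hx.2]
    · exact Real.sqrt_pos.2 (by linarith [hy.1])
    · rw [Real.sqrt_lt' one_pos]; linarith [hy.2]
    · change 2 * √((1 + y) / 2) ^ 2 - 1 = y
      rw [Real.sq_sqrt (by linarith [hy.1])]; ring
  have hinj : Set.InjOn (fun x : ℝ => 2 * x ^ 2 - 1) (Set.Ioo 0 1) := by
    intro x hx y hy h
    simp only at h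
    exact (sq_eq_sq₀ hx.1.le hy.1.le).1 (by linarith)
  have hd : ∀ x ∈ Set.Ioo (0 : ℝ) 1, HasDerivWithinAt (fun x : ℝ => 2 * x ^ 2 - 1) (4 * x)
      (Set.Ioo 0 1) x := fun x _ => by
    have := (((hasDerivAt_id x).pow 2).const_mul 2).sub_const 1
    refine (this.congr_deriv ?_).hasDerivWithinAt
    simp; ring
  have himg' := lintegral_image_eq_lintegral_abs_deriv_mul measurableSet_Ioo hd hinj
    (fun y => β y * ENNReal.ofReal (((1 + y) / 2) ^ (-(γ + 3) / 2)))
  rw [himg] at himg'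
  rw [himg', ← lintegral_indicator measurableSet_Ioo, ← lintegral_indicator measurableSet_Ioo]
  refine lintegral_congr fun x => ?_
  by_cases hx : x ∈ Set.Ioo (0 : ℝ) 1
  · rw [Set.indicator_of_mem hx, Set.indicator_of_mem (Set.mem_Ioo.2 ⟨by linarith [hx.1], hx.2⟩),
      halfAngleWeight, if_pos hx.1, mul_left_comm, mul_comm _ (β _),
      ← ENNReal.ofReal_mul (abs_nonneg _), abs_of_pos (by linarith [hx.1])]
    congr 2
    rw [show (1 + (2 * x ^ 2 - 1)) / 2 = x ^ 2 by ring, ← Real.rpow_natCast x 2,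
      ← Real.rpow_mul hx.1.le, mul_assoc,
      show -γ - 2 = 1 + ((2 : ℕ) : ℝ) * (-(γ + 3) / 2) by push_cast; ring, Real.rpow_add hx.1,
      Real.rpow_one]
  · rw [Set.indicator_of_notMem hx]
    refine Set.indicator_apply_eq_zero.2 fun h' => ?_
    rw [halfAngleWeight, if_neg]
    exact fun h0 => hx ⟨h0, h'.2⟩

/-! ### The cancellation lemma -/

lemma rpow_neg_le_one_add {p u : ℝ} (hp : p ≤ 2) (hu0 : 1 / 2 ≤ u) (hu1 : u ≤ 1) :
    u ^ (-p) ≤ 1 + 8 * (1 - u) := by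
  have hu : 0 < u := by linarith
  calc u ^ (-p) ≤ u ^ (-2 : ℝ) := Real.rpow_le_rpow_of_exponent_ge hu hu1 (by linarith)
    _ = (u ^ 2)⁻¹ := by rw [Real.rpow_neg hu.le]; norm_cast
    _ ≤ 1 + 8 * (1 - u) := by
        rw [inv_le_iff_one_le_mul₀ (by positivity)]
        nlinarith [mul_nonneg (sub_nonneg.2 hu1) (sub_nonneg.2 hu0),
          mul_nonneg (mul_nonneg (sub_nonneg.2 hu1) (sub_nonneg.2 hu0)) hu.le]

/-- The total angular mass `∫ b(cos θ) dσ`. -/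
noncomputable def totalMass (b : ℝ → ℝ) : ℝ≥0∞ :=
  ENNReal.ofReal (2 * Real.pi) * ∫⁻ t in Set.Ioo (-1 : ℝ) 1, ENNReal.ofReal (b t)

/-- The total angular mass after the change of variables `v_* ↦ v'_*`. -/
noncomputable def halfAngleMass (γ : ℝ) (b : ℝ → ℝ) : ℝ≥0∞ :=
  ENNReal.ofReal (2 * Real.pi) *
    ∫⁻ t in Set.Ioo (-1 : ℝ) 1, halfAngleWeight γ (fun x => ENNReal.ofReal (b x)) t

lemma halfAngleMass_eq (γ : ℝ) (b : ℝ → ℝ) :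
    halfAngleMass γ b = ENNReal.ofReal (2 * Real.pi) * ∫⁻ y in Set.Ioo (-1 : ℝ) 1,
      ENNReal.ofReal (b y) * ENNReal.ofReal (((1 + y) / 2) ^ (-(γ + 3) / 2)) := by
  rw [halfAngleMass, lintegral_halfAngleWeight]

lemma totalMass_le_halfAngleMass {γ : ℝ} (hγ : 0 ≤ γ) (b : ℝ → ℝ) :
    totalMass b ≤ halfAngleMass γ b := by
  rw [halfAngleMass_eq, totalMass]
  gcongr ENNReal.ofReal (2 * Real.pi) * ?_
  refine setLIntegral_mono' measurableSet_Ioo fun y hy => ?_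
  refine le_mul_of_one_le_right' ?_
  rw [ENNReal.one_le_ofReal]
  exact Real.one_le_rpow_of_pos_of_le_one_of_nonpos (by linarith [hy.1]) (by linarith [hy.2])
    (by linarith)

namespace AngularBound

variable {b : ℝ → ℝ} {C s : ℝ}

/-- The quantitative cancellation: both masses may be infinite in the limit of a singular `b`, but
they differ by a quantity that only sees `∫ (1 - cos θ) b(cos θ) dσ`. -/
lemma halfAngleMass_le (hb : AngularBound b C s) {γ : ℝ} (hγ : γ ≤ 1) :
    halfAngleMass γ b ≤ totalMass b + ENNReal.ofReal (4 * C) * angularMass s := by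
  rw [halfAngleMass_eq, totalMass, angularMass, mul_left_comm, ← mul_add]
  gcongr ENNReal.ofReal (2 * Real.pi) * ?_
  rw [← lintegral_const_mul _ (measurable_angularWeight s), ← lintegral_add_left
    (hb.measurable.ennreal_ofReal)]
  refine setLIntegral_mono' measurableSet_Ioo fun y hy => ?_
  rcases lt_or_ge y 0 with h0 | h0
  · simp [hb.eq_zero_of_neg y h0]
  have h1 : 0 < 1 - y := by linarith [hy.2]
  have hby := hb.nonneg y
  have hC := hb.const_nonneg
  rw [angularWeight_of_lt_one h0 hy.2, ← ENNReal.ofReal_mul hby,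
    ← ENNReal.ofReal_mul (by positivity), ← ENNReal.ofReal_add hby (by positivity)]
  apply ENNReal.ofReal_le_ofReal
  have e1 : ((1 + y) / 2) ^ (-(γ + 3) / 2) ≤ 1 + 4 * (1 - y) := by
    have := rpow_neg_le_one_add (p := (γ + 3) / 2) (u := (1 + y) / 2) (by linarith) (by linarith)
      (by linarith)
    rw [neg_div]
    linarith
  calc b y * ((1 + y) / 2) ^ (-(γ + 3) / 2) ≤ b y * (1 + 4 * (1 - y)) := by gcongr
    _ = b y + 4 * (b y * (1 - y)) := by ring
    _ ≤ b y + 4 * ((C * (1 - y) ^ (-(1 + s))) * (1 - y)) := by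
        gcongr
        exact hb.le y h0 hy.2
    _ = _ := by
        rw [mul_assoc C, ← Real.rpow_add_one h1.ne', ← mul_assoc]
        congr 3
        ring

/-- The cancellation lemma for angular functions of finite mass. -/
lemma norm_integral_cancellation_le_of_finite (hb : AngularBound b C s) {γ : ℝ} (hγ0 : 0 ≤ γ)
    (hγ1 : γ ≤ 1) (hfin : totalMass b ≠ ⊤) {h : V3 → ℝ} (hm : Measurable h) (v : V3)
    (hI : ∫⁻ vs, ENNReal.ofReal (‖v - vs‖ ^ γ) * ‖h vs‖ₑ ≠ ⊤) :
    ‖∫ p : V3 × S2, productKernel γ b (v - p.1) p.2 * (h (postVelStar v p.1 p.2) - h p.1)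
      ∂(volume.prod surfaceMeasure)‖ ≤
      (ENNReal.ofReal (4 * C) * angularMass s *
        ∫⁻ vs, ENNReal.ofReal (‖v - vs‖ ^ γ) * ‖h vs‖ₑ).toReal := by
  set I : (V3 → ℝ≥0∞) → ℝ≥0∞ := fun F => ∫⁻ vs, ENNReal.ofReal (‖v - vs‖ ^ γ) * F vs with hIdef
  set κ := totalMass b
  set κ' := halfAngleMass γ b
  have hsm : angularMass s ≠ ⊤ := (angularMass_lt_top (by linarith [hb.s_lt])).ne
  have hK : ENNReal.ofReal (4 * C) * angularMass s ≠ ⊤ :=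
    ENNReal.mul_ne_top ENNReal.ofReal_ne_top hsm
  have hκ'le : κ' ≤ κ + ENNReal.ofReal (4 * C) * angularMass s := hb.halfAngleMass_le hγ1
  have hκ' : κ' ≠ ⊤ := ne_top_of_le_ne_top (ENNReal.add_ne_top.2 ⟨hfin, hK⟩) hκ'le
  have hκle : κ ≤ κ' := totalMass_le_halfAngleMass hγ0 b
  have hβ : Measurable fun x => ENNReal.ofReal (b x) := hb.measurable.ennreal_ofReal
  have hβ0 : ∀ x < 0, ENNReal.ofReal (b x) = 0 := fun x hx => by
    rw [hb.eq_zero_of_neg x hx, ENNReal.ofReal_zero]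
  have hB0 := hb.productKernel_nonneg γ
  have hBe : ∀ p : V3 × S2, ENNReal.ofReal (productKernel γ b (v - p.1) p.2) =
      ENNReal.ofReal (‖v - p.1‖ ^ γ) * ENNReal.ofReal (b (cosDeviation (v - p.1) p.2)) := fun p =>
    ENNReal.ofReal_mul (Real.rpow_nonneg (norm_nonneg _) _)
  have hBm : Measurable fun p : V3 × S2 => productKernel γ b (v - p.1) p.2 :=
    hb.measurable.productKernel (by fun_prop) (by fun_prop)
  have e' : ∀ F : V3 → ℝ≥0∞, Measurable F → ∫⁻ p : V3 × S2,
      ENNReal.ofReal (productKernel γ b (v - p.1) p.2) * F (postVelStar v p.1 p.2)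
      ∂(volume.prod surfaceMeasure) = κ' * I F := fun F hF => by
    simp only [hBe]
    exact lintegral_kernel_postVelStar γ hβ hβ0 v hF
  have e : ∀ F : V3 → ℝ≥0∞, Measurable F → ∫⁻ p : V3 × S2,
      ENNReal.ofReal (productKernel γ b (v - p.1) p.2) * F p.1
      ∂(volume.prod surfaceMeasure) = κ * I F := fun F hF => by
    simp only [hBe]
    exact lintegral_kernel_star γ hβ v hF
  have i' : Integrable (fun p : V3 × S2 => productKernel γ b (v - p.1) p.2 *
      h (postVelStar v p.1 p.2)) (volume.prod surfaceMeasure) := by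
    refine ⟨Measurable.aestronglyMeasurable (by fun_prop), ?_⟩
    rw [hasFiniteIntegral_iff_enorm]
    simp only [enorm_mul, Real.enorm_of_nonneg (hB0 _ _)]
    rw [e' (fun x => ‖h x‖ₑ) (by fun_prop)]
    exact ENNReal.mul_lt_top hκ'.lt_top (lt_top_iff_ne_top.2 hI)
  have i : Integrable (fun p : V3 × S2 => productKernel γ b (v - p.1) p.2 * h p.1)
      (volume.prod surfaceMeasure) := by
    refine ⟨Measurable.aestronglyMeasurable (by fun_prop), ?_⟩
    rw [hasFiniteIntegral_iff_enorm]
    simp only [enorm_mul, Real.enorm_of_nonneg (hB0 _ _)]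
    rw [e (fun x => ‖h x‖ₑ) (by fun_prop)]
    exact ENNReal.mul_lt_top hfin.lt_top (lt_top_iff_ne_top.2 hI)
  set P := I fun x => ENNReal.ofReal (h x)
  set N := I fun x => ENNReal.ofReal (-h x)
  have hP : P ≤ I fun x => ‖h x‖ₑ := by
    refine lintegral_mono fun x => ?_
    gcongr
    exact Real.ofReal_le_enorm _
  have hN : N ≤ I fun x => ‖h x‖ₑ := by
    refine lintegral_mono fun x => ?_
    beta_reduce
    gcongr
    rw [← enorm_neg]
    exact Real.ofReal_le_enorm _
  have j' : ∫ p : V3 × S2, productKernel γ b (v - p.1) p.2 * h (postVelStar v p.1 p.2)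
      ∂(volume.prod surfaceMeasure) = κ'.toReal * (P.toReal - N.toReal) := by
    rw [integral_eq_lintegral_pos_part_sub_lintegral_neg_part i']
    simp only [← mul_neg, ENNReal.ofReal_mul (hB0 _ _)]
    rw [e' (fun x => ENNReal.ofReal (h x)) (by fun_prop),
      e' (fun x => ENNReal.ofReal (-h x)) (by fun_prop), ENNReal.toReal_mul, ENNReal.toReal_mul,
      mul_sub]
  have j : ∫ p : V3 × S2, productKernel γ b (v - p.1) p.2 * h p.1
      ∂(volume.prod surfaceMeasure) = κ.toReal * (P.toReal - N.toReal) := by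
    rw [integral_eq_lintegral_pos_part_sub_lintegral_neg_part i]
    simp only [← mul_neg, ENNReal.ofReal_mul (hB0 _ _)]
    rw [e (fun x => ENNReal.ofReal (h x)) (by fun_prop),
      e (fun x => ENNReal.ofReal (-h x)) (by fun_prop), ENNReal.toReal_mul, ENNReal.toReal_mul,
      mul_sub]
  simp only [mul_sub]
  rw [integral_sub i' i, j', j, ← sub_mul, norm_mul, ENNReal.toReal_mul]
  have hκr : κ.toReal ≤ κ'.toReal := ENNReal.toReal_mono hκ' hκle
  have hκr' : κ'.toReal ≤ κ.toReal + (ENNReal.ofReal (4 * C) * angularMass s).toReal := by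
    rw [← ENNReal.toReal_add hfin hK]
    exact ENNReal.toReal_mono (ENNReal.add_ne_top.2 ⟨hfin, hK⟩) hκ'le
  have hPr := ENNReal.toReal_mono hI hP
  have hNr := ENNReal.toReal_mono hI hN
  gcongr
  · rw [Real.norm_of_nonneg (by linarith)]
    linarith
  · rw [Real.norm_eq_abs, abs_le]
    constructor <;> linarith [ENNReal.toReal_nonneg (a := P), ENNReal.toReal_nonneg (a := N)]

/-- Removing the angles with `cos θ ≥ 1 - 1/(n+1)`. -/
lemma truncate (hb : AngularBound b C s) (n : ℕ) :
    AngularBound (fun x => if x < 1 - 1 / ((n : ℝ) + 1) then b x else 0) C s where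
  measurable := Measurable.ite measurableSet_Iio hb.measurable measurable_const
  nonneg x := by split_ifs; exacts [hb.nonneg x, le_rfl]
  eq_zero_of_neg x hx := by rw [hb.eq_zero_of_neg x hx, ite_self]
  eq_zero_of_one_le x hx := by rw [hb.eq_zero_of_one_le x hx, ite_self]
  le x h0 h1 := by
    split_ifs
    · exact hb.le x h0 h1
    · exact mul_nonneg hb.const_nonneg (Real.rpow_nonneg (by linarith) _)
  const_nonneg := hb.const_nonneg
  s_pos := hb.s_pos
  s_lt := hb.s_lt

lemma totalMass_truncate_ne_top (hb : AngularBound b C s) (n : ℕ) :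
    totalMass (fun x => if x < 1 - 1 / ((n : ℝ) + 1) then b x else 0) ≠ ⊤ := by
  have hδ : 0 < 1 / ((n : ℝ) + 1) := by positivity
  set δ := 1 / ((n : ℝ) + 1)
  refine ENNReal.mul_ne_top ENNReal.ofReal_ne_top (ne_top_of_le_ne_top
    (b := ∫⁻ _ in Set.Ioo (-1 : ℝ) 1, ENNReal.ofReal (C * δ ^ (-(1 + s)))) ?_
    (lintegral_mono fun x => ENNReal.ofReal_le_ofReal ?_))
  · rw [lintegral_const, Measure.restrict_apply_univ, Real.volume_Ioo]
    exact ENNReal.mul_ne_top ENNReal.ofReal_ne_top ENNReal.ofReal_ne_top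
  · have h0 : 0 ≤ C * δ ^ (-(1 + s)) := mul_nonneg hb.const_nonneg (Real.rpow_nonneg hδ.le _)
    beta_reduce
    split_ifs with hx
    · rcases lt_or_ge x 0 with hx0 | hx0
      · rw [hb.eq_zero_of_neg x hx0]; exact h0
      · refine (hb.le x hx0 (by linarith)).trans (mul_le_mul_of_nonneg_left ?_ hb.const_nonneg)
        exact Real.rpow_le_rpow_of_nonpos hδ (by linarith) (by linarith [hb.s_pos])
    · exact h0

/-- The cancellation lemma: `|∫∫ B (h'_* - h_*) dσ dv_*| ≤ K ∫ |v - v_*|^γ |h_*| dv_*` at every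
point where the left-hand side converges absolutely. -/
theorem norm_integral_cancellation_le (hb : AngularBound b C s) {γ : ℝ} (hγ0 : 0 ≤ γ)
    (hγ1 : γ ≤ 1) {h : V3 → ℝ} (hm : Measurable h) (v : V3)
    (hI : ∫⁻ vs, ENNReal.ofReal (‖v - vs‖ ^ γ) * ‖h vs‖ₑ ≠ ⊤)
    (hint : Integrable (fun p : V3 × S2 => productKernel γ b (v - p.1) p.2 *
      (h (postVelStar v p.1 p.2) - h p.1)) (volume.prod surfaceMeasure)) :
    ‖∫ p : V3 × S2, productKernel γ b (v - p.1) p.2 * (h (postVelStar v p.1 p.2) - h p.1)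
      ∂(volume.prod surfaceMeasure)‖ ≤
      (ENNReal.ofReal (4 * C) * angularMass s *
        ∫⁻ vs, ENNReal.ofReal (‖v - vs‖ ^ γ) * ‖h vs‖ₑ).toReal := by
  set bn : ℕ → ℝ → ℝ := fun n x => if x < 1 - 1 / ((n : ℝ) + 1) then b x else 0
  have hlim : Filter.Tendsto (fun n => ∫ p : V3 × S2, productKernel γ (bn n) (v - p.1) p.2 *
      (h (postVelStar v p.1 p.2) - h p.1) ∂(volume.prod surfaceMeasure)) Filter.atTop
      (nhds (∫ p : V3 × S2, productKernel γ b (v - p.1) p.2 *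
        (h (postVelStar v p.1 p.2) - h p.1) ∂(volume.prod surfaceMeasure))) := by
    refine tendsto_integral_of_dominated_convergence (fun p => ‖productKernel γ b (v - p.1) p.2 *
      (h (postVelStar v p.1 p.2) - h p.1)‖) (fun n => ?_) hint.norm (fun n => ?_) ?_
    · have := (hb.truncate n).measurable.productKernel (γ := γ) (f := fun p : V3 × S2 => v - p.1)
        (h := fun p : V3 × S2 => p.2) (by fun_prop) (by fun_prop)
      refine Measurable.aestronglyMeasurable ?_
      fun_prop
    · refine ae_of_all _ fun p => ?_
      rw [norm_mul, norm_mul]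
      gcongr ?_ * _
      rw [Real.norm_of_nonneg ((hb.truncate n).productKernel_nonneg _ _ _),
        Real.norm_of_nonneg (hb.productKernel_nonneg _ _ _), productKernel_eq, productKernel_eq]
      gcongr
      change (if _ then _ else _) ≤ _
      split_ifs
      exacts [le_rfl, hb.nonneg _]
    · refine ae_of_all _ fun p => ?_
      refine Filter.Tendsto.mul_const _ ?_
      refine tendsto_const_nhds.congr' ?_
      set x := cosDeviation (v - p.1) p.2 with hx
      rcases lt_or_ge x 1 with h1 | h1
      · have h2 : Filter.Tendsto (fun n : ℕ => 1 / ((n : ℝ) + 1)) Filter.atTop (nhds 0) :=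
          tendsto_one_div_add_atTop_nhds_zero_nat
        filter_upwards [h2.eventually_lt_const (sub_pos.2 h1)] with n hn
        rw [productKernel_eq, productKernel_eq, ← hx]
        change _ = _ * (if _ then _ else _)
        rw [if_pos (by linarith)]
      · refine Filter.Eventually.of_forall fun n => ?_
        beta_reduce
        rw [productKernel_eq, productKernel_eq, ← hx, hb.eq_zero_of_one_le x h1,
          show bn n x = 0 from (hb.truncate n).eq_zero_of_one_le x h1]
  refine le_of_tendsto hlim.norm (Filter.Eventually.of_forall fun n => ?_)
  exact (hb.truncate n).norm_integral_cancellation_le_of_finite hγ0 hγ1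
    (hb.totalMass_truncate_ne_top n) hm v hI

end AngularBound

/-! ### Splitting of the collision operator -/

lemma postVel_sub_postVelStar (v vs : V3) (σ : S2) :
    postVel v vs σ - postVelStar v vs σ = ‖v - vs‖ • (σ : V3) := by
  unfold postVel postVelStar; module

lemma postVel_add_postVelStar (v vs : V3) (σ : S2) :
    postVel v vs σ + postVelStar v vs σ = v + vs := by
  unfold postVel postVelStar; module

/-- The pre-post-collisional change of variables is an involution. -/
lemma postVel_postVel (v vs : V3) (σ : S2) :
    postVel (postVel v vs σ) (postVelStar v vs σ) (direction (v - vs)) = v := by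
  rw [postVel, postVel_add_postVelStar, postVel_sub_postVelStar, norm_smul, norm_coe_sphere,
    mul_one, norm_norm, div_eq_inv_mul, mul_smul, norm_smul_direction]
  module

lemma cosDeviation_smul_direction (z : V3) (σ : S2) :
    cosDeviation (‖z‖ • (σ : V3)) (direction z) = cosDeviation z σ := by
  by_cases hz : z = 0
  · simp [hz, cosDeviation]
  · have hn := norm_ne_zero_iff.2 hz
    rw [cosDeviation, cosDeviation, norm_smul, norm_coe_sphere, mul_one, norm_norm, smul_smul,
      inv_mul_cancel₀ hn, one_smul, coe_direction hz, real_inner_comm]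

lemma productKernel_postVel (γ : ℝ) (b : ℝ → ℝ) (v vs : V3) (σ : S2) :
    productKernel γ b (postVel v vs σ - postVelStar v vs σ) (direction (v - vs)) =
      productKernel γ b (v - vs) σ := by
  rw [productKernel_eq, productKernel_eq, postVel_sub_postVelStar, cosDeviation_smul_direction,
    norm_smul, norm_coe_sphere, mul_one, norm_norm]

lemma measurePreserving_neg_sphere :
    MeasurePreserving (fun σ : S2 => -σ) surfaceMeasure surfaceMeasure := by
  have hm : Measurable fun σ : S2 => -σ := continuous_neg.measurable
  refine ⟨hm, Measure.ext fun s hs => ?_⟩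
  rw [Measure.map_apply hm hs, surfaceMeasure, Measure.toSphere_apply' _ hs,
    Measure.toSphere_apply' _ (hm hs)]
  congr 1
  rw [← Measure.measure_preimage_neg]
  congr 1
  ext x
  simp only [Set.mem_preimage, Set.mem_smul, Set.mem_image]
  constructor
  · rintro ⟨r, hr, _, ⟨σ, hσ, rfl⟩, hx⟩
    exact ⟨r, hr, _, ⟨-σ, by simpa using hσ, rfl⟩, by simp [hx]⟩
  · rintro ⟨r, hr, _, ⟨σ, hσ, rfl⟩, hx⟩
    exact ⟨r, hr, _, ⟨-σ, by simpa using hσ, rfl⟩, by simp [hx]⟩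

/-- Integrals over the configuration `(v, v_*, σ)` are symmetric under exchange of the two
particles. -/
lemma lintegral_exchange {F : V3 → V3 → S2 → ℝ≥0∞}
    (hF : Measurable fun p : V3 × V3 × S2 => F p.1 p.2.1 p.2.2) :
    ∫⁻ v, ∫⁻ vs, ∫⁻ σ, F vs v (-σ) ∂surfaceMeasure = ∫⁻ v, ∫⁻ vs, ∫⁻ σ, F v vs σ ∂surfaceMeasure := by
  have h1 : ∀ v vs, ∫⁻ σ, F vs v (-σ) ∂surfaceMeasure = ∫⁻ σ, F vs v σ ∂surfaceMeasure := by
    intro v vs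
    have hm : Measurable fun σ => F vs v σ := hF.comp₃ (by fun_prop) (by fun_prop) (by fun_prop)
    exact measurePreserving_neg_sphere.lintegral_comp hm
  simp only [h1]
  have hm : Measurable fun p : (V3 × V3) × S2 => F p.1.2 p.1.1 p.2 :=
    hF.comp₃ (by fun_prop) (by fun_prop) (by fun_prop)
  exact lintegral_lintegral_swap hm.lintegral_prod_right'.aemeasurable

section Splitting

variable {b : ℝ → ℝ} {C s γ k : ℝ} {h : V3 → ℝ}

/-- The part `B h'_* (h' - h)` of the collision integrand. -/
noncomputable def gainIncrement (γ : ℝ) (b : ℝ → ℝ) (h : V3 → ℝ) (v : V3) (p : V3 × S2) : ℝ :=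
  productKernel γ b (v - p.1) p.2 *
    (h (postVelStar v p.1 p.2) * (h (postVel v p.1 p.2) - h v))

/-- The part `h B (h'_* - h_*)` of the collision integrand, to which the cancellation lemma
applies. -/
noncomputable def cancellationPart (γ : ℝ) (b : ℝ → ℝ) (h : V3 → ℝ) (v : V3) (p : V3 × S2) : ℝ :=
  h v * (productKernel γ b (v - p.1) p.2 * (h (postVelStar v p.1 p.2) - h p.1))

lemma collisionIntegrand_eq_add (γ : ℝ) (b : ℝ → ℝ) (h : V3 → ℝ) (v : V3) (p : V3 × S2) :
    collisionIntegrand (productKernel γ b) h h v p =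
      gainIncrement γ b h v p + cancellationPart γ b h v p := by
  unfold collisionIntegrand gainIncrement cancellationPart; ring

lemma measurable_kernel_uncurry (γ : ℝ) (hb : Measurable b) :
    Measurable fun q : V3 × V3 × S2 => productKernel γ b (q.1 - q.2.1) q.2.2 :=
  hb.productKernel (by fun_prop) (by fun_prop)

lemma measurable_gainIncrement (hb : Measurable b) (hm : Measurable h) :
    Measurable fun q : V3 × V3 × S2 => gainIncrement γ b h q.1 q.2 := by
  have := measurable_kernel_uncurry γ hb
  unfold gainIncrement
  fun_prop

lemma measurable_gainIncrement_apply (hb : Measurable b) (hm : Measurable h) (v : V3) :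
    Measurable (gainIncrement γ b h v) := by
  have : Measurable fun p : V3 × S2 => productKernel γ b (v - p.1) p.2 :=
    hb.productKernel (by fun_prop) (by fun_prop)
  unfold gainIncrement
  fun_prop

lemma measurable_cancellationPart (hb : Measurable b) (hm : Measurable h) :
    Measurable fun q : V3 × V3 × S2 => cancellationPart γ b h q.1 q.2 := by
  have := measurable_kernel_uncurry γ hb
  unfold cancellationPart
  fun_prop

lemma measurable_cancellationPart_apply (hb : Measurable b) (hm : Measurable h) (v : V3) :
    Measurable (cancellationPart γ b h v) := by
  have : Measurable fun p : V3 × S2 => productKernel γ b (v - p.1) p.2 :=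
    hb.productKernel (by fun_prop) (by fun_prop)
  unfold cancellationPart
  fun_prop

lemma measurable_weightedIncrement (hb : Measurable b) (k : ℝ) (hm : Measurable h) :
    Measurable fun q : V3 × V3 × S2 => weightedIncrement γ b k h q.1 q.2.1 q.2.2 := by
  have := measurable_kernel_uncurry γ hb
  unfold weightedIncrement
  fun_prop

/-- By the pre-post-collisional change of variables. -/
lemma AngularBound.lintegral_gainIncrement_le (hb : AngularBound b C s) (hm : Measurable h) :
    ∫⁻ v, (∫⁻ p, ‖gainIncrement γ b h v p‖ₑ ∂(volume.prod surfaceMeasure)) * bracketWeight k v ≤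
      totalIncrement γ b k h := by
  rw [totalIncrement, ← lintegral_prePost (F := weightedIncrement γ b k h)
    (measurable_weightedIncrement hb.measurable k hm)]
  refine lintegral_mono fun v => ?_
  have hGv := measurable_gainIncrement_apply (γ := γ) hb.measurable hm v
  have hW : bracketWeight k v ≠ ⊤ := ENNReal.ofReal_ne_top
  have hp : Measurable fun p => ‖gainIncrement γ b h v p‖ₑ * bracketWeight k v :=
    hGv.enorm.mul_const _
  refine (lintegral_mul_const' _ _ hW).symm.le.trans ?_
  rw [lintegral_prod _ hp.aemeasurable]
  refine lintegral_mono fun vs => lintegral_mono fun σ => ?_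
  rw [weightedIncrement, productKernel_postVel, postVel_postVel, gainIncrement, enorm_mul, enorm_mul,
    Real.enorm_of_nonneg (hb.productKernel_nonneg _ _ _), enorm_sub_rev (h v)]
  calc _ = ‖h (postVelStar v vs σ)‖ₑ * (ENNReal.ofReal (productKernel γ b (v - vs) σ) *
        ‖h (postVel v vs σ) - h v‖ₑ * bracketWeight k v) := by ring
    _ ≤ _ := by gcongr; exact le_add_self

lemma productKernel_neg_neg (γ : ℝ) (b : ℝ → ℝ) (v vs : V3) (σ : S2) :
    productKernel γ b (vs - v) (-σ) = productKernel γ b (v - vs) σ := by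
  rw [productKernel_eq, productKernel_eq, norm_sub_rev, cosDeviation_eq_div, cosDeviation_eq_div,
    norm_sub_rev vs v, coe_neg_sphere, inner_neg_right, ← inner_neg_left, neg_sub]

lemma postVel_exchange (v vs : V3) (σ : S2) : postVel vs v (-σ) = postVelStar v vs σ := by
  rw [postVel, postVelStar, norm_sub_rev, coe_neg_sphere, add_comm vs v, smul_neg,
    ← sub_eq_add_neg]

/-- By exchange of the particles; the weights are only used to be at least `1`. This gives absolute
convergence, not the final bound. -/
lemma AngularBound.lintegral_cancellationPart_le (hb : AngularBound b C s) (hk : 0 ≤ k)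
    (hm : Measurable h) :
    ∫⁻ v, (∫⁻ p, ‖cancellationPart γ b h v p‖ₑ ∂(volume.prod surfaceMeasure)) ≤
      totalIncrement γ b k h := by
  rw [totalIncrement, ← lintegral_exchange (F := weightedIncrement γ b k h)
    (measurable_weightedIncrement hb.measurable k hm)]
  refine lintegral_mono fun v => ?_
  have hGv := measurable_cancellationPart_apply (γ := γ) hb.measurable hm v
  rw [lintegral_prod _ (by fun_prop)]
  refine lintegral_mono fun vs => lintegral_mono fun σ => ?_
  rw [weightedIncrement, productKernel_neg_neg, postVel_exchange, cancellationPart, enorm_mul, enorm_mul,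
    Real.enorm_of_nonneg (hb.productKernel_nonneg _ _ _)]
  refine mul_le_mul_right ?_ _
  exact le_mul_of_one_le_right' ((one_le_bracketWeight hk vs).trans le_self_add)

/-- The convolution `∫ |v - v_*|^γ |h_*| dv_*`. -/
noncomputable def powerConvolution (γ : ℝ) (h : V3 → ℝ) (v : V3) : ℝ≥0∞ :=
  ∫⁻ vs, ENNReal.ofReal (‖v - vs‖ ^ γ) * ‖h vs‖ₑ

lemma powerConvolution_le (hγ : 0 ≤ γ) (hm : Measurable h) (v : V3) :
    powerConvolution γ h v ≤ ENNReal.ofReal (2 ^ γ) *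
      (bracketWeight γ v * weightedMass 0 h + weightedMass γ h) := by
  have h0 : weightedMass 0 h = ∫⁻ v, ‖h v‖ₑ := by simp [weightedMass, bracketWeight]
  calc _ ≤ ∫⁻ vs, ENNReal.ofReal (2 ^ γ) * (bracketWeight γ v * ‖h vs‖ₑ +
          ‖h vs‖ₑ * bracketWeight γ vs) := by
        refine lintegral_mono fun vs => ?_
        have h1 : ENNReal.ofReal (‖v - vs‖ ^ γ) ≤
            ENNReal.ofReal (2 ^ γ) * (bracketWeight γ v + bracketWeight γ vs) := by
          rw [bracketWeight, bracketWeight, ← ENNReal.ofReal_add (Real.rpow_nonneg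
            (bracket_pos _).le _) (Real.rpow_nonneg (bracket_pos _).le _),
            ← ENNReal.ofReal_mul (by positivity)]
          exact ENNReal.ofReal_le_ofReal (norm_sub_rpow_le hγ v vs)
        calc _ ≤ ENNReal.ofReal (2 ^ γ) * (bracketWeight γ v + bracketWeight γ vs) * ‖h vs‖ₑ := by
              gcongr
          _ = _ := by ring
    _ = _ := by
        rw [lintegral_const_mul _ (by fun_prop), lintegral_add_left (by fun_prop),
          lintegral_const_mul _ (by fun_prop), ← h0]
        rfl

lemma lintegral_powerConvolution_le (hγ : 0 ≤ γ) (hk : 0 ≤ k) (hm : Measurable h) :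
    ∫⁻ v, ‖h v‖ₑ * powerConvolution γ h v * bracketWeight k v ≤
      ENNReal.ofReal (2 ^ γ) * (2 * (weightedMass (γ + k) h * weightedMass k h)) := by
  have hadd : ∀ v, bracketWeight γ v * bracketWeight k v = bracketWeight (γ + k) v := fun v => by
    rw [bracketWeight, bracketWeight, bracketWeight, Real.rpow_add (bracket_pos v),
      ENNReal.ofReal_mul (Real.rpow_nonneg (bracket_pos _).le _)]
  calc _ ≤ ∫⁻ v, ENNReal.ofReal (2 ^ γ) * ((‖h v‖ₑ * bracketWeight (γ + k) v) * weightedMass 0 h +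
          (‖h v‖ₑ * bracketWeight k v) * weightedMass γ h) := by
        refine lintegral_mono fun v => ?_
        calc _ ≤ ‖h v‖ₑ * (ENNReal.ofReal (2 ^ γ) *
              (bracketWeight γ v * weightedMass 0 h + weightedMass γ h)) * bracketWeight k v := by
              gcongr
              exact powerConvolution_le hγ hm v
          _ = _ := by rw [← hadd]; ring
    _ = ENNReal.ofReal (2 ^ γ) * (weightedMass (γ + k) h * weightedMass 0 h +
          weightedMass k h * weightedMass γ h) := by
        rw [lintegral_const_mul _ (by fun_prop), lintegral_add_left (by fun_prop),
          lintegral_mul_const _ (by fun_prop), lintegral_mul_const _ (by fun_prop)]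
        rfl
    _ ≤ ENNReal.ofReal (2 ^ γ) * (weightedMass (γ + k) h * weightedMass k h +
          weightedMass k h * weightedMass (γ + k) h) := by
        gcongr
        · exact weightedMass_mono hk h
        · exact weightedMass_mono (by linarith) h
    _ = _ := by ring

lemma AngularBound.enorm_integral_cancellationPart_le (hb : AngularBound b C s) (hγ0 : 0 ≤ γ)
    (hγ1 : γ ≤ 1) (hm : Measurable h) {v : V3} (hI : powerConvolution γ h v ≠ ⊤)
    (hint : Integrable (cancellationPart γ b h v) (volume.prod surfaceMeasure)) :
    ‖∫ p, cancellationPart γ b h v p ∂(volume.prod surfaceMeasure)‖ₑ ≤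
      ENNReal.ofReal (4 * C) * angularMass s * (‖h v‖ₑ * powerConvolution γ h v) := by
  by_cases hv : h v = 0
  · simp [cancellationPart, hv]
  have hint' : Integrable (fun p : V3 × S2 => productKernel γ b (v - p.1) p.2 *
      (h (postVelStar v p.1 p.2) - h p.1)) (volume.prod surfaceMeasure) :=
    (integrable_const_mul_iff (IsUnit.mk0 _ hv) _).1 hint
  have h1 := hb.norm_integral_cancellation_le hγ0 hγ1 hm v hI hint'
  simp only [cancellationPart]
  rw [integral_const_mul, enorm_mul, mul_left_comm]
  gcongr
  rw [← ofReal_norm]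
  refine (ENNReal.ofReal_le_ofReal h1).trans ENNReal.ofReal_toReal_le

end Splitting

/-- The estimate of the collision operator, for a measurable `h` and a normalized angular
function. -/
theorem AngularBound.exists_collisionQ_bound {b : ℝ → ℝ} {C s γ k : ℝ} (hb : AngularBound b C s)
    (hγ0 : 0 ≤ γ) (hγ1 : γ ≤ 1) (hk : 1 ≤ k) :
    ∃ K : ℝ≥0∞, K ≠ ⊤ ∧ ∀ (h : V3 → ℝ) (g : Fin 3 → V3 → ℝ), Measurable h →
      (∀ i, HasWeakPartial i h (g i)) → weightedMass (γ + 1 + k) h ≠ ⊤ →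
      (∀ i, weightedMass (γ + 1 + k) (g i) ≠ ⊤) →
      (∀ᵐ v : V3, Integrable (collisionIntegrand (productKernel γ b) h h v)
        ((volume : Measure V3).prod surfaceMeasure)) ∧
      StronglyMeasurable (collisionQ (productKernel γ b) h h) ∧
      weightedMass k (collisionQ (productKernel γ b) h h) ≤
        K * (weightedMass (γ + k) h * weightedMass k h +
          weightedMass (γ + 1) h * ∑ i, weightedMass (γ + 1 + k) (g i)) := by
  obtain ⟨K, hK, hle⟩ := hb.exists_totalIncrement_le hγ0 hk
  have hsm : angularMass s ≠ ⊤ := (angularMass_lt_top (by linarith [hb.s_lt])).ne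
  set K2 := ENNReal.ofReal (4 * C) * angularMass s with hK2
  have hK2t : K2 ≠ ⊤ := ENNReal.mul_ne_top ENNReal.ofReal_ne_top hsm
  set K3 := K2 * (ENNReal.ofReal (2 ^ γ) * 2) with hK3
  have hK3t : K3 ≠ ⊤ := ENNReal.mul_ne_top hK2t (ENNReal.mul_ne_top ENNReal.ofReal_ne_top (by simp))
  refine ⟨K + K3, ENNReal.add_ne_top.2 ⟨hK, hK3t⟩, fun h g hm hg hhf hgf => ?_⟩
  have hmass : ∀ a, a ≤ γ + 1 + k → weightedMass a h ≠ ⊤ := fun a ha =>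
    ne_top_of_le_ne_top hhf (weightedMass_mono ha h)
  have hsum : ∑ i, weightedMass (γ + 1 + k) (g i) ≠ ⊤ := ENNReal.sum_ne_top.2 fun i _ => hgf i
  have hT := hle h g hm hg
  have hTfin : totalIncrement γ b k h ≠ ⊤ := by
    refine ne_top_of_le_ne_top (ENNReal.mul_ne_top hK (ENNReal.add_ne_top.2 ⟨?_, ?_⟩)) hT
    · exact ENNReal.mul_ne_top (hmass _ (by linarith)) (hmass _ (by linarith))
    · exact ENNReal.mul_ne_top (hmass _ (by linarith)) hsum
  have hGm := measurable_gainIncrement (γ := γ) hb.measurable hm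
  have hCm := measurable_cancellationPart (γ := γ) hb.measurable hm
  have hGI : Measurable fun v => ∫⁻ p, ‖gainIncrement γ b h v p‖ₑ ∂(volume.prod surfaceMeasure) :=
    hGm.enorm.lintegral_prod_right'
  have hCI : Measurable fun v =>
      ∫⁻ p, ‖cancellationPart γ b h v p‖ₑ ∂(volume.prod surfaceMeasure) :=
    hCm.enorm.lintegral_prod_right'
  have hG1 : ∀ᵐ v, Integrable (gainIncrement γ b h v) (volume.prod surfaceMeasure) := by
    filter_upwards [ae_lt_top (hGI.mul (measurable_bracketWeight k)) (ne_top_of_le_ne_top hTfin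
      (hb.lintegral_gainIncrement_le hm))] with v hv
    refine ⟨(measurable_gainIncrement_apply hb.measurable hm v).aestronglyMeasurable, ?_⟩
    rw [hasFiniteIntegral_iff_enorm]
    exact lt_of_le_of_lt (le_mul_of_one_le_right' (one_le_bracketWeight (by linarith) v)) hv
  have hC1 : ∀ᵐ v, Integrable (cancellationPart γ b h v) (volume.prod surfaceMeasure) := by
    filter_upwards [ae_lt_top hCI (ne_top_of_le_ne_top hTfin
      (hb.lintegral_cancellationPart_le (by linarith) hm))] with v hv
    exact ⟨(measurable_cancellationPart_apply hb.measurable hm v).aestronglyMeasurable, hv⟩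
  have hconv : ∀ v, powerConvolution γ h v ≠ ⊤ := fun v =>
    ne_top_of_le_ne_top (ENNReal.mul_ne_top ENNReal.ofReal_ne_top (ENNReal.add_ne_top.2
      ⟨ENNReal.mul_ne_top ENNReal.ofReal_ne_top (hmass 0 (by linarith)),
        hmass γ (by linarith)⟩)) (powerConvolution_le hγ0 hm v)
  have heq : ∀ v, collisionIntegrand (productKernel γ b) h h v =
      gainIncrement γ b h v + cancellationPart γ b h v := fun v =>
    funext fun p => collisionIntegrand_eq_add γ b h v p
  refine ⟨?_, ?_, ?_⟩
  · filter_upwards [hG1, hC1] with v h1 h2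
    rw [heq]
    exact h1.add h2
  · unfold collisionQ
    simp only [heq]
    exact ((hGm.add hCm).stronglyMeasurable).integral_prod_right'
  · have hQ : ∀ᵐ v, ‖collisionQ (productKernel γ b) h h v‖ₑ * bracketWeight k v ≤
        (∫⁻ p, ‖gainIncrement γ b h v p‖ₑ ∂(volume.prod surfaceMeasure)) * bracketWeight k v +
        K2 * (‖h v‖ₑ * powerConvolution γ h v * bracketWeight k v) := by
      filter_upwards [hG1, hC1] with v h1 h2
      rw [← mul_assoc K2, ← add_mul]
      gcongr
      unfold collisionQ
      simp only [heq, Pi.add_apply]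
      rw [integral_add h1 h2]
      refine (enorm_add_le _ _).trans (add_le_add (enorm_integral_le_lintegral_enorm _) ?_)
      exact hb.enorm_integral_cancellationPart_le hγ0 hγ1 hm (hconv v) h2
    calc _ ≤ ∫⁻ v, ((∫⁻ p, ‖gainIncrement γ b h v p‖ₑ ∂(volume.prod surfaceMeasure)) *
          bracketWeight k v + K2 * (‖h v‖ₑ * powerConvolution γ h v * bracketWeight k v)) :=
          lintegral_mono_ae hQ
      _ = (∫⁻ v, (∫⁻ p, ‖gainIncrement γ b h v p‖ₑ ∂(volume.prod surfaceMeasure)) *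
          bracketWeight k v) + K2 * ∫⁻ v, ‖h v‖ₑ * powerConvolution γ h v * bracketWeight k v := by
          rw [lintegral_add_left (by fun_prop), lintegral_const_mul' _ _ hK2t]
      _ ≤ K * (weightedMass (γ + k) h * weightedMass k h +
            weightedMass (γ + 1) h * ∑ i, weightedMass (γ + 1 + k) (g i)) +
          K2 * (ENNReal.ofReal (2 ^ γ) * (2 * (weightedMass (γ + k) h * weightedMass k h))) := by
          gcongr
          · exact (hb.lintegral_gainIncrement_le hm).trans hT
          · exact lintegral_powerConvolution_le hγ0 (by linarith) hm
      _ = K * (weightedMass (γ + k) h * weightedMass k h +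
            weightedMass (γ + 1) h * ∑ i, weightedMass (γ + 1 + k) (g i)) +
          K3 * (weightedMass (γ + k) h * weightedMass k h) := by rw [hK3]; ring
      _ ≤ _ := by
          rw [add_mul]
          gcongr
          exact le_self_add

/-! ### Normalization of `b` and choice of a representative of `h` -/

/-- A normalized angular function: the value at `cos θ = 1`, which the hypotheses on `b` do not
control, is replaced by `0`. -/
noncomputable def normalizeAngular (b : ℝ → ℝ) (x : ℝ) : ℝ := if 0 ≤ x ∧ x < 1 then b x else 0

lemma IsModerateAngular.exists_angularBound {b : ℝ → ℝ} (hb : IsModerateAngular b) :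
    ∃ C s : ℝ, AngularBound (normalizeAngular b) C s := by
  obtain ⟨cb, s, hcb, hs0, hs1, hsing⟩ := hb.singularity
  -- With `x = cos θ`, `sin θ ≥ 2 θ / π` and `1 - x ≤ θ² / 2` turn the bound on `sin θ b(cos θ)`
  -- into `b(x) ≤ C θ^{-2-2s} ≤ C (1 - x)^{-1-s}`.
  have key : ∀ x, 0 ≤ x → x < 1 →
      0 ≤ b x ∧ b x ≤ Real.pi / (2 * cb) * (1 - x) ^ (-(1 + s)) := by
    intro x h0 h1
    set θ := Real.arccos x with hθ
    have hcos : Real.cos θ = x := Real.cos_arccos (by linarith) h1.le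
    have hθ0 : 0 < θ := Real.arccos_pos.2 h1
    have hθ1 : θ ≤ Real.pi / 2 := Real.arccos_le_pi_div_two.2 h0
    have hsin0 : 0 < Real.sin θ :=
      Real.sin_pos_of_pos_of_lt_pi hθ0 (by linarith [Real.pi_pos])
    obtain ⟨hlow, hup⟩ := hsing θ hθ0 hθ1
    rw [hcos] at hlow hup
    have hpow : 0 < θ ^ (1 + 2 * s) := Real.rpow_pos_of_pos hθ0 _
    have hb0 : 0 ≤ b x := by
      have : 0 < Real.sin θ * b x := lt_of_lt_of_le (by positivity) hlow
      exact ((pos_iff_pos_of_mul_pos this).1 hsin0).le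
    refine ⟨hb0, ?_⟩
    have hsin : 2 / Real.pi * θ ≤ Real.sin θ := Real.mul_le_sin hθ0.le hθ1
    have h2 : 1 - x ≤ θ ^ 2 := by
      have := Real.one_sub_sq_div_two_le_cos (x := θ)
      rw [hcos] at this
      nlinarith [sq_nonneg θ]
    have hpi := Real.pi_pos
    have h3 : b x ≤ Real.pi / (2 * cb) * θ ^ (-(2 + 2 * s)) := by
      have e1 : 2 / Real.pi * θ * b x ≤ 1 / (cb * θ ^ (1 + 2 * s)) :=
        (mul_le_mul_of_nonneg_right hsin hb0).trans hup
      have e2 : θ ^ (-(2 + 2 * s)) = (θ * θ ^ (1 + 2 * s))⁻¹ := by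
        rw [Real.rpow_neg hθ0.le, show 2 + 2 * s = 1 + (1 + 2 * s) by ring, Real.rpow_add hθ0,
          Real.rpow_one]
      rw [e2]
      calc b x = Real.pi / (2 * θ) * (2 / Real.pi * θ * b x) := by field_simp
        _ ≤ Real.pi / (2 * θ) * (1 / (cb * θ ^ (1 + 2 * s))) := by gcongr
        _ = _ := by field_simp
    have h4 : θ ^ (-(2 + 2 * s)) ≤ (1 - x) ^ (-(1 + s)) := by
      have e1 : θ ^ (-(2 + 2 * s)) = (θ ^ 2) ^ (-(1 + s)) := by
        rw [← Real.rpow_natCast, ← Real.rpow_mul hθ0.le]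
        congr 1; push_cast; ring
      rw [e1]
      exact Real.rpow_le_rpow_of_nonpos (by linarith) h2 (by linarith)
    exact h3.trans (by gcongr)
  refine ⟨Real.pi / (2 * cb), s, ?_, ?_, ?_, ?_, ?_, ?_, hs0, hs1⟩
  · exact Measurable.ite (measurableSet_Ici.inter measurableSet_Iio) hb.measurable measurable_const
  · intro x
    unfold normalizeAngular
    split_ifs with h
    exacts [(key x h.1 h.2).1, le_rfl]
  · exact fun x hx => if_neg fun h => h.1.not_gt hx
  · exact fun x hx => if_neg fun h => h.2.not_ge hx
  · intro x h0 h1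
    rw [normalizeAngular, if_pos ⟨h0, h1⟩]
    exact (key x h0 h1).2
  · have := Real.pi_pos
    positivity

/-- The normalization does not change the collision integrand, since `v' = v` for `cos θ = 1`. -/
lemma collisionIntegrand_normalizeAngular (γ : ℝ) {b : ℝ → ℝ} (hb : ∀ x < 0, b x = 0)
    (h : V3 → ℝ) :
    collisionIntegrand (productKernel γ (normalizeAngular b)) h h =
      collisionIntegrand (productKernel γ b) h h := by
  funext v ⟨vs, σ⟩
  simp only [collisionIntegrand, productKernel_eq]
  set x := cosDeviation (v - vs) σ with hx
  rcases lt_trichotomy x 1 with h1 | h1 | h1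
  · congr 2
    unfold normalizeAngular
    split_ifs with h'
    · rfl
    · exact (hb x (by by_contra! h0; exact h' ⟨h0, h1⟩)).symm
  · have h2 : postVel v vs σ = v := by
      have := norm_postVel_sub_sq v vs σ
      rw [← hx, h1, sub_self, zero_div, mul_zero] at this
      exact sub_eq_zero.1 (norm_eq_zero.1 (pow_eq_zero_iff two_ne_zero |>.1 this))
    have h3 : postVelStar v vs σ = vs := by
      have := postVel_add_postVelStar v vs σ
      rw [h2] at this
      exact add_left_cancel this
    rw [h2, h3, sub_self, mul_zero, mul_zero]
  · exact absurd (cosDeviation_le_one (v - vs) σ) (not_le.2 h1)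

/-- The collision integrand does not depend on the representative of `h`. -/
lemma ae_collisionIntegrand_congr (B : V3 → S2 → ℝ) {h h' : V3 → ℝ} (hh : h =ᵐ[volume] h') :
    ∀ᵐ v : V3, collisionIntegrand B h h v =ᵐ[(volume : Measure V3).prod surfaceMeasure]
      collisionIntegrand B h' h' v := by
  obtain ⟨N, hN, hNm, hN0⟩ := exists_measurable_superset_of_null hh
  have hNc : ∀ x, N.indicator (1 : V3 → ℝ≥0∞) x = 0 → h x = h' x := fun x hx => by
    by_contra hne
    have hxN : x ∈ N := hN hne
    rw [Set.indicator_of_mem hxN] at hx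
    simp at hx
  set χ : V3 → ℝ≥0∞ := N.indicator 1 with hχ
  have hχm : Measurable χ := measurable_one.indicator hNm
  have hχ0 : ∫⁻ x, χ x = 0 := by rw [hχ, lintegral_indicator_one hNm, hN0]
  have hχae : ∀ᵐ x, χ x = 0 := (lintegral_eq_zero_iff hχm).1 hχ0
  have hpp := lintegral_prePost (F := fun v vs _ => χ v + χ vs) (by fun_prop)
  have hzero : ∫⁻ v : V3, ∫⁻ vs : V3, ∫⁻ _ : S2, χ v + χ vs ∂surfaceMeasure = 0 := by
    rw [← lintegral_zero (μ := (volume : Measure V3))]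
    refine lintegral_congr_ae ?_
    filter_upwards [hχae] with v hv
    rw [← lintegral_zero (μ := (volume : Measure V3))]
    refine lintegral_congr_ae ?_
    filter_upwards [hχae] with vs hvs
    simp [hv, hvs]
  rw [hzero] at hpp
  have hm : Measurable fun q : V3 × V3 × S2 =>
      χ (postVel q.1 q.2.1 q.2.2) + χ (postVelStar q.1 q.2.1 q.2.2) := by fun_prop
  have hm1 : ∀ v, Measurable fun p : V3 × S2 =>
      χ (postVel v p.1 p.2) + χ (postVelStar v p.1 p.2) := fun v => by fun_prop
  have hpp' : ∫⁻ v, ∫⁻ p : V3 × S2, χ (postVel v p.1 p.2) + χ (postVelStar v p.1 p.2)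
      ∂(volume.prod surfaceMeasure) = 0 := by
    rw [← hpp]
    exact lintegral_congr fun v => lintegral_prod _ (hm1 v).aemeasurable
  have hae := (lintegral_eq_zero_iff hm.lintegral_prod_right').1 hpp'
  filter_upwards [hae, hχae] with v hv1 hv2
  have hv3 := (lintegral_eq_zero_iff (hm1 v)).1 hv1
  have hfst : ∀ᵐ p : V3 × S2 ∂(volume.prod surfaceMeasure), χ p.1 = 0 :=
    Measure.quasiMeasurePreserving_fst.ae hχae
  filter_upwards [hv3, hfst] with p hp1 hp2
  obtain ⟨h1, h2⟩ := add_eq_zero.1 hp1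
  unfold collisionIntegrand
  rw [hNc _ h1, hNc _ h2, hNc _ hp2, hNc _ hv2]

lemma HasWeakPartial.congr {i : Fin 3} {h h' g : V3 → ℝ} (hg : HasWeakPartial i h g)
    (hh : h =ᵐ[volume] h') : HasWeakPartial i h' g := by
  refine ⟨hg.1.congr hh, hg.2.1, fun φ hφ hc => ?_⟩
  rw [← hg.2.2 φ hφ hc]
  refine integral_congr_ae ?_
  filter_upwards [hh] with v hv
  rw [hv]

lemma hasWeakPartial_weakPartial {i : Fin 3} {h : V3 → ℝ} (H : ∃ g, HasWeakPartial i h g) :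
    HasWeakPartial i h (weakPartial i h) := by
  rw [weakPartial, dif_pos H]
  exact H.choose_spec

lemma wL1Norm_bracket_rpow (a : ℝ) (h : V3 → ℝ) :
    wL1Norm (fun v => bracket v ^ a) h = weightedMass a h := by
  rw [wL1Norm, eLpNorm_one_eq_lintegral_enorm]
  refine lintegral_congr fun v => ?_
  rw [enorm_mul, Real.enorm_of_nonneg (Real.rpow_nonneg (bracket_pos v).le a)]
  rfl

lemma weightedMass_congr {a : ℝ} {h h' : V3 → ℝ} (hh : h =ᵐ[volume] h') :
    weightedMass a h = weightedMass a h' := by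
  refine lintegral_congr_ae ?_
  filter_upwards [hh] with v hv
  rw [hv]

theorem proposition3p1 (γ : ℝ) (hγ0 : 0 < γ) (hγ1 : γ < 1)
    (b : ℝ → ℝ) (hb : IsModerateAngular b)
    (k : ℝ) (hk : 2 < k) :
    ∃ C : ℝ, 0 < C ∧ ∀ h : V3 → ℝ,
      MemWW11 (fun v => bracket v ^ (γ + 1) * bracket v ^ k) h →
        (∀ᵐ v : V3, Integrable (collisionIntegrand (productKernel γ b) h h v)
          ((volume : Measure V3).prod surfaceMeasure)) ∧
        MemWL1 (fun v => bracket v ^ k) (collisionQ (productKernel γ b) h h) ∧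
        wL1Norm (fun v => bracket v ^ k) (collisionQ (productKernel γ b) h h) ≤
          ENNReal.ofReal C *
            (wL1Norm (fun v => bracket v ^ γ * bracket v ^ k) h *
                wL1Norm (fun v => bracket v ^ k) h +
              wL1Norm (fun v => bracket v ^ (γ + 1)) h *
                wW11Norm (fun v => bracket v ^ (γ + 1) * bracket v ^ k) h) := by
  obtain ⟨C, s, hbs⟩ := hb.exists_angularBound
  obtain ⟨K, hK, hle⟩ := hbs.exists_collisionQ_bound (γ := γ) (k := k) hγ0.le hγ1.le (by linarith)
  refine ⟨K.toReal + 1, by positivity, fun h hh => ?_⟩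
  have hw : ∀ a : ℝ, (fun v : V3 => bracket v ^ a * bracket v ^ k) =
      fun v => bracket v ^ (a + k) := fun a =>
    funext fun v => (Real.rpow_add (bracket_pos v) a k).symm
  simp only [hw] at hh ⊢
  have hweak : ∀ i, HasWeakPartial i h (weakPartial i h) := fun i =>
    hasWeakPartial_weakPartial (hh.2 i).1
  have hmeas : AEStronglyMeasurable h volume := (hweak 0).1.aestronglyMeasurable
  set h' := hmeas.mk h with hh'
  have hhae : h =ᵐ[volume] h' := hmeas.ae_eq_mk
  have hfin : weightedMass (γ + 1 + k) h ≠ ⊤ := by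
    rw [← wL1Norm_bracket_rpow]; exact hh.1.2.ne
  have hfing : ∀ i, weightedMass (γ + 1 + k) (weakPartial i h) ≠ ⊤ := fun i => by
    rw [← wL1Norm_bracket_rpow]; exact (hh.2 i).2.2.ne
  obtain ⟨h1, h2, h3⟩ := hle h' (fun i => weakPartial i h) hmeas.stronglyMeasurable_mk.measurable
    (fun i => (hweak i).congr hhae) (by rwa [← weightedMass_congr hhae]) hfing
  have hQint := ae_collisionIntegrand_congr (productKernel γ (normalizeAngular b)) hhae
  have hQ : collisionQ (productKernel γ (normalizeAngular b)) h h =ᵐ[volume]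
      collisionQ (productKernel γ (normalizeAngular b)) h' h' := by
    filter_upwards [hQint] with v hv
    exact integral_congr_ae hv
  have hnorm := collisionIntegrand_normalizeAngular γ hb.support h
  have hnormQ : collisionQ (productKernel γ (normalizeAngular b)) h h =
      collisionQ (productKernel γ b) h h := by
    unfold collisionQ
    rw [hnorm]
  rw [hnormQ] at hQ
  rw [← weightedMass_congr hhae, ← weightedMass_congr hhae, ← weightedMass_congr hhae,
    ← weightedMass_congr hQ] at h3
  have hbound : weightedMass k (collisionQ (productKernel γ b) h h) ≤
      ENNReal.ofReal (K.toReal + 1) * (weightedMass (γ + k) h * weightedMass k h +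
        weightedMass (γ + 1) h * wW11Norm (fun v => bracket v ^ (γ + 1 + k)) h) := by
    refine h3.trans ?_
    gcongr
    · rw [ENNReal.le_ofReal_iff_toReal_le hK (by positivity)]
      linarith
    · rw [wW11Norm]
      simp only [wL1Norm_bracket_rpow]
      exact le_add_self
  have hmass : ∀ a, a ≤ γ + 1 + k → weightedMass a h ≠ ⊤ := fun a ha =>
    ne_top_of_le_ne_top hfin (weightedMass_mono ha h)
  have hWfin : wW11Norm (fun v => bracket v ^ (γ + 1 + k)) h ≠ ⊤ := by
    rw [wW11Norm]
    simp only [wL1Norm_bracket_rpow]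
    exact ENNReal.add_ne_top.2 ⟨hfin, ENNReal.sum_ne_top.2 fun i _ => hfing i⟩
  refine ⟨?_, ⟨?_, ?_⟩, ?_⟩
  · filter_upwards [h1, hQint] with v hv1 hv2
    rw [← hnorm]
    exact hv1.congr hv2.symm
  · have hQm : AEStronglyMeasurable (collisionQ (productKernel γ b) h h) volume :=
      h2.aestronglyMeasurable.congr hQ.symm
    have hwm : Measurable fun v : V3 => bracket v ^ k := by fun_prop
    exact hQm.mul hwm.aestronglyMeasurable
  · change wL1Norm (fun v => bracket v ^ k) (collisionQ (productKernel γ b) h h) < ⊤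
    rw [wL1Norm_bracket_rpow]
    refine lt_of_le_of_lt hbound (ENNReal.mul_lt_top ENNReal.ofReal_lt_top
      (ENNReal.add_lt_top.2 ⟨?_, ?_⟩))
    · exact ENNReal.mul_lt_top (hmass _ (by linarith)).lt_top (hmass _ (by linarith)).lt_top
    · exact ENNReal.mul_lt_top (hmass _ (by linarith)).lt_top hWfin.lt_top
  · simp only [wL1Norm_bracket_rpow]
    exact hbound
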